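/- **Setting.** Fix a set of constructors $f$ and destructors $g$ with arities, some of them public. A destructor $g$ is given by a finite set $\mathrm{def}(g)$ of rewrite rules $g(M_1,\dots,M_n)\to M$ without names, where the variables of $M$ occur in $M_1,\dots,M_n$. Some public constructors $f$ are data constructors: for each $i$ there is a public destructor defined by the single rule $g_i(f(x_1,\dots,x_n))\to x_i$. Terms are built from variables, names and constructors. Processes are $$0,\quad P\mid Q,\quad !P,\quad (\nu a)P,\quad \overline{M}\langle N\rangle.P,\quad M(x).P,\quad \mathsf{let}\ x=g(\vec M)\ \mathsf{in}\ P\ \mathsf{else}\ Q,\quad \mathsf{if}\ M=N\ \mathsf{then}\ P\ \mathsf{else}\ Q,\quad \mathsf{event}(M).P .$$ For a finite set $\mathrm{Init}$ of names, an $\mathrm{Init}$-adversary is a closed process with free names in $\mathrm{Init}$, without events, using only public constructors and destructors. **Instrumentation.** Patterns are built from variables, constructors, and names $a[p_1,\dots,p_n,i_1,\dots,i_m]$, where the $i_j$ are session identifiers (variables or constants); $b_0$ is a special name function symbol. In $P_0'=\mathrm{instr}(P_0)$ each replication carries a distinct session identifier variable and each restriction $(\nu a)$ is labeled $a[t,s]$,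 where $t$ lists the variables bound above it by inputs and by successful non-deterministic destructor applications, and $s$ lists the session identifiers of the replications above it. In $Q'=\mathrm{instrAdv}(Q)$ the label is $b_0[a[s]]$ instead. A configuration $S,E,\mathcal P$ consists of a set $S$ of unused constant session identifiers, a map $E$ from names to closed patterns, and a finite multiset $\mathcal P$ of processes. Reduction is that of the pi calculus (with destructor, conditional and event steps), where $!^iP$ spawns $P\{\lambda/i\}$ for some $\lambda\in S$ and removes $\lambda$ from $S$, and $(\nu a:\ell)P$ picks a name $a'\notin\mathrm{dom}(E)$, adds $a'\mapsto E(\ell)$ to $E$ and continues as $P\{a'/a\}$. Facts are $\mathrm{attacker}(p)$, $\mathrm{message}(p,p')$, $\text{m-event}(p)$, $\mathrm{event}(p)$. A trace with final environment $E'$ satisfies $\mathrm{message}(E'(M),E'(N))$ if it contains a communication of $N$ on channel $M$; $\mathrm{attacker}(E'(N))$ if it contains a communication of $N$ on some channel $c\in\mathrm{Init}$; and $\mathrm{event}(E'(M))$ if it contains the execution of $\mathsf{event}(M)$. **Clauses.** A clause $H\Rightarrow C$ has a multiset $H$ of facts as hypothesis and a fact $C$ as conclusion. $\mathcal R_{P_0',\mathrm{Init}}$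 consists of $[\![P_0']\!]\rho\emptyset$ with $\rho=\{a\mapsto a[\,]\mid a\in \mathrm{fn}(P_0')\}$, together with $\mathrm{attacker}(a[\,])$ for $a\in\mathrm{Init}$; $\mathrm{attacker}(b_0[x])$; $\bigwedge_k\mathrm{attacker}(x_k)\Rightarrow\mathrm{attacker}(f(x_1,\dots,x_n))$ for public $f$; $\bigwedge_k\mathrm{attacker}(M_k)\Rightarrow\mathrm{attacker}(M)$ for the rules $g(M_1,\dots,M_n)\to M$ of public $g$; $\mathrm{message}(x,y)\wedge\mathrm{attacker}(x)\Rightarrow\mathrm{attacker}(y)$; and $\mathrm{attacker}(x)\wedge\mathrm{attacker}(y)\Rightarrow\mathrm{message}(x,y)$. Bound variables being renamed to fresh ones, - $[\![0]\!]\rho H=\emptyset$; $[\![P\mid Q]\!]\rho H=[\![P]\!]\rho H\cup[\![Q]\!]\rho H$; $[\![!^iP]\!]\rho H=[\![P]\!](\rho[i\mapsto i])H$; $[\![(\nu a:\ell)P]\!]\rho H=[\![P]\!](\rho[a\mapsto\rho(\ell)])H$; - $[\![M(x).P]\!]\rho H=[\![P]\!](\rho[x\mapsto x])(H\wedge\mathrm{message}(\rho(M),x))$;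 - $[\![\overline M\langle N\rangle.P]\!]\rho H=[\![P]\!]\rho H\cup\{H\Rightarrow\mathrm{message}(\rho(M),\rho(N))\}$; - $[\![\mathsf{event}(M).P]\!]\rho H=[\![P]\!]\rho(H\wedge\text{m-event}(\rho(M)))\cup\{H\Rightarrow\mathrm{event}(\rho(M))\}$; - $[\![\mathsf{let}\ x=g(\vec M)\ \mathsf{in}\ P\ \mathsf{else}\ Q]\!]\rho H$ is the union of $[\![Q]\!]\rho H$ and of $[\![P]\!]((\sigma\rho)[x\mapsto\sigma'p'])(\sigma H)$ for each rule $g(p'_1,\dots,p'_n)\to p'$ in $\mathrm{def}(g)$ such that there is a most general pair $(\sigma,\sigma')$ with $\sigma\rho(M_k)=\sigma'p'_k$ for all $k$; - $[\![\mathsf{if}\ M=N\ \mathsf{then}\ P\ \mathsf{else}\ Q]\!]\rho H$ is the union of $[\![Q]\!]\rho H$ and, if $\rho(M),\rho(N)$ have a most general unifier $\sigma$, of $[\![P]\!](\sigma\rho)(\sigma H)$. **Solver.** The parameters are a set $\mathcal F_{\mathrm{not}}$ of facts and a selection function $\mathrm{sel}$, which maps a clause $H\Rightarrow C$ to a set of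 facts of $H$, never selects $\mathrm{attacker}(x)$ ($x$ a variable) or m-event facts, and satisfies $\mathrm{sel}(H\Rightarrow\mathrm{attacker}(x))\ne\emptyset$ when $H$ contains any other fact. If $R=H\Rightarrow C$, $R'=H'\Rightarrow C'$ (with variables renamed apart), $F_0\in H'$, and $\sigma$ is a most general unifier of $C$ and $F_0$, then $R\circ_{F_0}R'=\sigma(H\cup(H'\setminus\{F_0\}))\Rightarrow\sigma C'$. $H_1\Rightarrow C_1$ subsumes $H_2\Rightarrow C_2$ if $\sigma C_1=C_2$ and $\sigma H_1\subseteq H_2$ (as multisets) for some $\sigma$; $\mathrm{elim}$ removes subsumed clauses, keeping one of several clauses that subsume each other. The function $\mathrm{simplify}$ performs, in this order: recursive replacement of $\mathrm{attacker}(f(p_1,\dots,p_n))$, $f$ a data constructor, by the facts $\mathrm{attacker}(p_i)$, in hypotheses and (giving one clause for each $i$) in the conclusion, except that the clauses $\bigwedge_k\mathrm{attacker}(x_k)\Rightarrow\mathrm{attacker}(f(x_1,\dots,x_n))$ and $\mathrm{attacker}(f(x_1,\dots,x_n))\Rightarrow\mathrm{attacker}(x_i)$ are left unchanged; removal of duplicate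 hypotheses; optionally, replacement of $H\wedge H'\Rightarrow C$ by $H'\Rightarrow C$ when some $\sigma$ that fixes the variables of $H'$ and $C$ maps $H$ into $H'$; removal of the clauses with a hypothesis that is an instance of a fact of $\mathcal F_{\mathrm{not}}$; removal of the clauses whose conclusion is among their hypotheses; removal of the hypotheses $\mathrm{attacker}(x)$ with $x$ not occurring elsewhere in the clause. $\mathrm{simplify}'$ is the same without decomposition of the conclusion and without removal of tautologies. $\mathrm{saturate}(\mathcal R_0)$ starts from $\mathcal R=\emptyset$, performs $\mathcal R\leftarrow\mathrm{elim}(\mathrm{simplify}(R)\cup\mathcal R)$ for each $R\in\mathcal R_0$, then repeats $\mathcal R\leftarrow\mathrm{elim}(\mathrm{simplify}(R\circ_{F_0}R')\cup\mathcal R)$ for $R,R'\in\mathcal R$, $\mathrm{sel}(R)=\emptyset$, $F_0\in\mathrm{sel}(R')$, until a fixpoint is reached, and returns $\{R\in\mathcal R\mid\mathrm{sel}(R)=\emptyset\}$. Further, $\mathrm{deriv}(R,\mathcal R,\mathcal R_1)$ is $\emptyset$ if some clause of $\mathcal R$ subsumes $R$; otherwise $\{R\}$ if $\mathrm{sel}(R)=\emptyset$;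 otherwise the union of the sets $\mathrm{deriv}(R'',\{R\}\cup\mathcal R,\mathcal R_1)$ over $R''\in\mathrm{simplify}'(R'\circ_{F_0}R)$, $R'\in\mathcal R_1$, $F_0\in\mathrm{sel}(R)$; and $\mathrm{derivable}(F,\mathcal R_1)=\mathrm{deriv}(F\Rightarrow F,\emptyset,\mathcal R_1)$. Finally, $\mathrm{solve}_{P_0',\mathrm{Init}}(F)$ computes $\mathcal R_1=\mathrm{saturate}(\mathcal R_{P_0',\mathrm{Init}})$, terminates with an error if $\mathrm{derivable}(G,\mathcal R_1)\neq\emptyset$ for some $G\in\mathcal F_{\mathrm{not}}$, and otherwise returns $\mathrm{derivable}(F,\mathcal R_1)$. **Theorem.** Let $P_0$ be a closed process, $P_0'=\mathrm{instr}(P_0)$, let $Q$ be an $\mathrm{Init}$-adversary and $Q'=\mathrm{instrAdv}(Q)$. Consider a trace $\mathcal T=S_0,E_0,\{P_0',Q'\}\to^*S',E',\mathcal P'$ with $\mathrm{fn}(P_0')\cup\mathrm{Init}\subseteq\mathrm{dom}(E_0)$ and $E_0(a)=a[\,]$ for all $a\in\mathrm{dom}(E_0)$. Let $F$ be a fact for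 which $\mathrm{solve}_{P_0',\mathrm{Init}}(F)$ has a value, that is, the computation terminates and does not end in an error. If $\mathcal T$ satisfies an instance $F'$ of $F$, then there exist a clause $H\Rightarrow C$ in $\mathrm{solve}_{P_0',\mathrm{Init}}(F)$ and a substitution $\sigma$ such that $F'=\sigma C$ and, for every $\text{m-event}(p)$ in $\sigma H$, $\mathcal T$ satisfies $\mathrm{event}(p)$. -/

import Mathlib

namespace HornProtocol

/-! ### Identifiers: ordinary variables, session identifier variables, names, and constant
session identifiers range over four separate countably infinite sets. -/

abbrev Var := ℕ
abbrev SVar := ℕ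
abbrev Name := ℕ
abbrev SId := ℕ

/-! ### Constructors and destructors -/

/-- Terms without names, used in the rewrite rules of destructors. -/
inductive Tm {C : Type} (ar : C → ℕ) where
  | var (x : Var) : Tm ar
  | con (f : C) (ts : Fin (ar f) → Tm ar) : Tm ar

def Tm.vars {C : Type} {ar : C → ℕ} : Tm ar → Set Var
  | .var x => {x}
  | .con _ ts => ⋃ k, (ts k).vars

/-- A rewrite rule `g(M₁, …, Mₙ) → M` of a destructor `g` of arity `n`. -/
structure RewriteRule {C : Type} (ar : C → ℕ) (n : ℕ) where
  lhs : Fin n → Tm ar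
  rhs : Tm ar
  vars_rhs : rhs.vars ⊆ ⋃ k, (lhs k).vars

/-- The constructors and destructors of the calculus, with the finite set `def(g)` of rewrite
rules of each destructor `g`, the public symbols, and the data constructors: a data constructor
`f` is public and has, for each `i`, a public destructor defined by the single rule
`gᵢ(f(x₁, …, xₙ)) → xᵢ`. -/
structure Signature where
  Con : Type
  arity : Con → ℕ
  Des : Type
  desArity : Des → ℕ
  rules : (g : Des) → List (RewriteRule arity (desArity g))
  publicCon : Set Con
  publicDes : Set Des
  dataCon : Set Con
  data_public : dataCon ⊆ publicCon
  data_proj : ∀ f ∈ dataCon, ∀ i : Fin (arity f), ∃ g ∈ publicDes,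
    desArity g = 1 ∧ ∃ (r : RewriteRule arity (desArity g)) (x : Fin (arity f) → Var),
      Function.Injective x ∧ rules g = [r] ∧
      (∀ k, r.lhs k = Tm.con f (fun j => Tm.var (x j))) ∧ r.rhs = Tm.var (x i)

/-! ### Terms, patterns, restriction labels -/

/-- Terms of processes. `name a` is a free name (or a name created at run time); `bname a` is an
occurrence of a name bound by an enclosing restriction of `a`, and is replaced with a fresh
`name a'` when that restriction is executed. Keeping the two apart makes all the substitutions
performed during reductions capture-free. -/
inductive Term (S : Signature) where
  | var (x : Var) : Term S
  | bname (a : Name) : Term S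
  | name (a : Name) : Term S
  | con (f : S.Con) (ts : Fin (S.arity f) → Term S) : Term S

/-- Session identifiers: variables or constants. -/
inductive Sess where
  | var (i : SVar) : Sess
  | const (l : SId) : Sess

/-- Name function symbols: the names, and the special symbol `b₀` for names generated by the
adversary. -/
inductive NameSym where
  | nm (a : Name) : NameSym
  | b0 : NameSym

/-- Patterns: variables, names `a[p₁, …, pₙ, i₁, …, iₘ]`, and constructor applications. -/
inductive Pat (S : Signature) where
  | var (x : Var) : Pat S
  | name (a : NameSym) (n : ℕ) (ps : Fin n → Pat S) (ss : List Sess) : Pat S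
  | con (f : S.Con) (ps : Fin (S.arity f) → Pat S) : Pat S

/-- Labels of restrictions: `a[M₁, …, Mₙ, i₁, …, iₘ]` in honest processes and
`b₀[a[i₁, …, iₘ]]` in the adversary. -/
inductive Label (S : Signature) where
  | honest (a : Name) (ts : List (Term S)) (ss : List Sess) : Label S
  | adv (a : Name) (ss : List Sess) : Label S

/-! ### Processes -/

/-- Processes; replications carry a label in `ι`, restrictions a label in `κ`. -/
inductive Proc (S : Signature) (ι κ : Type) where
  | nil : Proc S ι κ
  | par (P Q : Proc S ι κ) : Proc S ι κ
  | repl (i : ι) (P : Proc S ι κ) : Proc S ι κ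
  | new (a : Name) (l : κ) (P : Proc S ι κ) : Proc S ι κ
  | out (M N : Term S) (P : Proc S ι κ) : Proc S ι κ
  | inp (M : Term S) (x : Var) (P : Proc S ι κ) : Proc S ι κ
  | letd (x : Var) (g : S.Des) (Ms : Fin (S.desArity g) → Term S) (P Q : Proc S ι κ) :
      Proc S ι κ
  | cond (M N : Term S) (P Q : Proc S ι κ) : Proc S ι κ
  | event (M : Term S) (P : Proc S ι κ) : Proc S ι κ

/-- Processes of the standard calculus: no labels. -/
abbrev PlainProc (S : Signature) := Proc S Unit Unit

/-- Instrumented processes. -/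
abbrev IProc (S : Signature) := Proc S SVar (Label S)

section
variable {S : Signature}

/-- Free variables, free bound-name identifiers and free names of terms. -/
def Term.fv : Term S → Set Var
  | .var x => {x}
  | .bname _ => ∅
  | .name _ => ∅
  | .con _ ts => ⋃ k, (ts k).fv

def Term.fbn : Term S → Set Name
  | .var _ => ∅
  | .bname a => {a}
  | .name _ => ∅
  | .con _ ts => ⋃ k, (ts k).fbn

def Term.fn : Term S → Set Name
  | .var _ => ∅
  | .bname _ => ∅
  | .name a => {a}
  | .con _ ts => ⋃ k, (ts k).fn

/-- The term uses public constructors only. -/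
def Term.Public : Term S → Prop
  | .var _ => True
  | .bname _ => True
  | .name _ => True
  | .con f ts => f ∈ S.publicCon ∧ ∀ k, (ts k).Public

variable {ι κ : Type}

def Proc.fv : Proc S ι κ → Set Var
  | .nil => ∅
  | .par P Q => P.fv ∪ Q.fv
  | .repl _ P => P.fv
  | .new _ _ P => P.fv
  | .out M N P => M.fv ∪ N.fv ∪ P.fv
  | .inp M x P => M.fv ∪ (P.fv \ {x})
  | .letd x _ Ms P Q => (⋃ k, (Ms k).fv) ∪ (P.fv \ {x}) ∪ Q.fv
  | .cond M N P Q => M.fv ∪ N.fv ∪ P.fv ∪ Q.fv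
  | .event M P => M.fv ∪ P.fv

def Proc.fbn : Proc S ι κ → Set Name
  | .nil => ∅
  | .par P Q => P.fbn ∪ Q.fbn
  | .repl _ P => P.fbn
  | .new a _ P => P.fbn \ {a}
  | .out M N P => M.fbn ∪ N.fbn ∪ P.fbn
  | .inp M _ P => M.fbn ∪ P.fbn
  | .letd _ _ Ms P Q => (⋃ k, (Ms k).fbn) ∪ P.fbn ∪ Q.fbn
  | .cond M N P Q => M.fbn ∪ N.fbn ∪ P.fbn ∪ Q.fbn
  | .event M P => M.fbn ∪ P.fbn

/-- The free names of a process. -/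
def Proc.fn : Proc S ι κ → Set Name
  | .nil => ∅
  | .par P Q => P.fn ∪ Q.fn
  | .repl _ P => P.fn
  | .new _ _ P => P.fn
  | .out M N P => M.fn ∪ N.fn ∪ P.fn
  | .inp M _ P => M.fn ∪ P.fn
  | .letd _ _ Ms P Q => (⋃ k, (Ms k).fn) ∪ P.fn ∪ Q.fn
  | .cond M N P Q => M.fn ∪ N.fn ∪ P.fn ∪ Q.fn
  | .event M P => M.fn ∪ P.fn

/-- A process is closed when it has no free variable (and every `bname` is bound by a
restriction); it may have free names. -/
def Proc.Closed (P : Proc S ι κ) : Prop := P.fv = ∅ ∧ P.fbn = ∅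

def Proc.EventFree : Proc S ι κ → Prop
  | .nil => True
  | .par P Q => P.EventFree ∧ Q.EventFree
  | .repl _ P => P.EventFree
  | .new _ _ P => P.EventFree
  | .out _ _ P => P.EventFree
  | .inp _ _ P => P.EventFree
  | .letd _ _ _ P Q => P.EventFree ∧ Q.EventFree
  | .cond _ _ P Q => P.EventFree ∧ Q.EventFree
  | .event _ _ => False

/-- The process uses public constructors and destructors only. -/
def Proc.Public : Proc S ι κ → Prop
  | .nil => True
  | .par P Q => P.Public ∧ Q.Public
  | .repl _ P => P.Public
  | .new _ _ P => P.Public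
  | .out M N P => M.Public ∧ N.Public ∧ P.Public
  | .inp M _ P => M.Public ∧ P.Public
  | .letd _ g Ms P Q => g ∈ S.publicDes ∧ (∀ k, (Ms k).Public) ∧ P.Public ∧ Q.Public
  | .cond M N P Q => M.Public ∧ N.Public ∧ P.Public ∧ Q.Public
  | .event M P => M.Public ∧ P.Public

/-- `Init`-adversaries. -/
def IsAdversary (Init : Finset Name) (Q : PlainProc S) : Prop :=
  Q.Closed ∧ Q.fn ⊆ (Init : Set Name) ∧ Q.EventFree ∧ Q.Public

/-! ### Destructor evaluation -/

/-- A name-free term with its variables replaced by terms. -/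
def Tm.toTerm (σ : Var → Term S) : Tm S.arity → Term S
  | .var x => σ x
  | .con f ts => .con f (fun k => (ts k).toTerm σ)

/-- A name-free term with its variables replaced by patterns. -/
def Tm.toPat (σ : Var → Pat S) : Tm S.arity → Pat S
  | .var x => σ x
  | .con f ts => .con f (fun k => (ts k).toPat σ)

/-- `g(M₁, …, Mₙ) → M'`. -/
def DesRed (g : S.Des) (Ms : Fin (S.desArity g) → Term S) (M' : Term S) : Prop :=
  ∃ r ∈ S.rules g, ∃ σ : Var → Term S,
    (∀ k, Ms k = (r.lhs k).toTerm σ) ∧ M' = r.rhs.toTerm σ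

/-- A destructor is non-deterministic when it may return several different results for the
same arguments. -/
def NonDet (g : S.Des) : Prop :=
  ∃ Ms M' M'', DesRed g Ms M' ∧ DesRed g Ms M'' ∧ M' ≠ M''

/-! ### Instrumentation -/

open Classical in
/-- Labels the replications of a process with pairwise distinct session identifiers (the numbers
from `k` on, in depth-first order) and each restriction of a name `a` with `lab a t s`. Here `t`
is the sequence of variables bound above the restriction by inputs and by successful
non-deterministic destructor applications, `s` is the sequence of session identifiers of the
replications above it, both from top to bottom. Returns also the next unused identifier. -/
noncomputable def instrAux (lab : Name → List Var → List SVar → Label S) :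
    PlainProc S → List Var → List SVar → ℕ → IProc S × ℕ
  | .nil, _, _, k => (.nil, k)
  | .par P Q, t, s, k =>
      let p := instrAux lab P t s k
      let q := instrAux lab Q t s p.2
      (.par p.1 q.1, q.2)
  | .repl _ P, t, s, k =>
      let p := instrAux lab P t (s ++ [k]) (k + 1)
      (.repl k p.1, p.2)
  | .new a _ P, t, s, k =>
      let p := instrAux lab P t s k
      (.new a (lab a t s) p.1, p.2)
  | .out M N P, t, s, k =>
      let p := instrAux lab P t s k
      (.out M N p.1, p.2)
  | .inp M x P, t, s, k =>
      let p := instrAux lab P (t ++ [x]) s k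
      (.inp M x p.1, p.2)
  | .letd x g Ms P Q, t, s, k =>
      let p := instrAux lab P (if NonDet g then t ++ [x] else t) s k
      let q := instrAux lab Q t s p.2
      (.letd x g Ms p.1 q.1, q.2)
  | .cond M N P Q, t, s, k =>
      let p := instrAux lab P t s k
      let q := instrAux lab Q t s p.2
      (.cond M N p.1 q.1, q.2)
  | .event M P, t, s, k =>
      let p := instrAux lab P t s k
      (.event M p.1, p.2)

/-- The instrumentation of the protocol: `ν a` is labeled `a[t, s]`. -/
noncomputable def instr (P : PlainProc S) : IProc S :=
  (instrAux (fun a t s => .honest a (t.map .var) (s.map .var)) P [] [] 0).1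

/-- The instrumentation of the adversary: `ν a` is labeled `b₀[a[s]]`. -/
noncomputable def instrAdv (Q : PlainProc S) : IProc S :=
  (instrAux (fun a _ s => .adv a (s.map .var)) Q [] [] 0).1

/-! ### Substitution in instrumented processes -/

def Term.bind (v : Var → Term S) (b : Name → Term S) : Term S → Term S
  | .var x => v x
  | .bname a => b a
  | .name a => .name a
  | .con f ts => .con f (fun k => (ts k).bind v b)

def Sess.bind (s : SVar → Sess) : Sess → Sess
  | .var i => s i
  | .const l => .const l

def Label.bind (v : Var → Term S) (b : Name → Term S) (s : SVar → Sess) : Label S → Label S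
  | .honest a ts ss => .honest a (ts.map (Term.bind v b)) (ss.map (Sess.bind s))
  | .adv a ss => .adv a (ss.map (Sess.bind s))

/-- Simultaneous substitution for the free variables, bound-name identifiers and session
identifiers; an identifier is left alone below a binder for it. (It is only applied to substitute
closed terms, so that no capture can occur.) -/
def Proc.bind (v : Var → Term S) (b : Name → Term S) (s : SVar → Sess) : IProc S → IProc S
  | .nil => .nil
  | .par P Q => .par (P.bind v b s) (Q.bind v b s)
  | .repl i P => .repl i (P.bind v b (Function.update s i (.var i)))
  | .new a l P => .new a (l.bind v b s) (P.bind v (Function.update b a (.bname a)) s)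
  | .out M N P => .out (M.bind v b) (N.bind v b) (P.bind v b s)
  | .inp M x P => .inp (M.bind v b) x (P.bind (Function.update v x (.var x)) b s)
  | .letd x g Ms P Q =>
      .letd x g (fun k => (Ms k).bind v b) (P.bind (Function.update v x (.var x)) b s)
        (Q.bind v b s)
  | .cond M N P Q => .cond (M.bind v b) (N.bind v b) (P.bind v b s) (Q.bind v b s)
  | .event M P => .event (M.bind v b) (P.bind v b s)

/-- `P{M/x}`. -/
def Proc.substVar (P : IProc S) (x : Var) (M : Term S) : IProc S :=
  P.bind (Function.update .var x M) .bname .var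

/-- `P{a'/a}` for a bound name `a` and a name `a'`. -/
def Proc.substName (P : IProc S) (a a' : Name) : IProc S :=
  P.bind .var (Function.update .bname a (.name a')) .var

/-- `P{l/i}` for a session identifier variable `i` and a constant session identifier `l`. -/
def Proc.substSess (P : IProc S) (i : SVar) (l : SId) : IProc S :=
  P.bind .var .bname (Function.update .var i (.const l))

/-! ### Substitutions on patterns, facts and clauses -/

/-- Substitutions map ordinary variables to patterns and session identifier variables to session
identifiers. -/
structure Subst (S : Signature) where
  var : Var → Pat S
  sess : SVar → Sess

def Pat.subst (σ : Subst S) : Pat S → Pat S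
  | .var x => σ.var x
  | .name a n ps ss => .name a n (fun k => (ps k).subst σ) (ss.map (Sess.bind σ.sess))
  | .con f ps => .con f (fun k => (ps k).subst σ)

def Pat.vars : Pat S → Set Var
  | .var x => {x}
  | .name _ _ ps _ => ⋃ k, (ps k).vars
  | .con _ ps => ⋃ k, (ps k).vars

def Pat.svars : Pat S → Set SVar
  | .var _ => ∅
  | .name _ _ ps ss => (⋃ k, (ps k).svars) ∪ {i | Sess.var i ∈ ss}
  | .con _ ps => ⋃ k, (ps k).svars

/-- The pattern `a[]`. -/
def Pat.atom (a : NameSym) : Pat S := .name a 0 Fin.elim0 []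

/-- Facts; `mevent` is the must-event predicate `m-event`. -/
inductive PFact (S : Signature) where
  | attacker (p : Pat S) : PFact S
  | message (p q : Pat S) : PFact S
  | mevent (p : Pat S) : PFact S
  | event (p : Pat S) : PFact S

def PFact.subst (σ : Subst S) : PFact S → PFact S
  | .attacker p => .attacker (p.subst σ)
  | .message p q => .message (p.subst σ) (q.subst σ)
  | .mevent p => .mevent (p.subst σ)
  | .event p => .event (p.subst σ)

def PFact.vars : PFact S → Set Var
  | .attacker p => p.vars
  | .message p q => p.vars ∪ q.vars
  | .mevent p => p.vars
  | .event p => p.vars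

def PFact.svars : PFact S → Set SVar
  | .attacker p => p.svars
  | .message p q => p.svars ∪ q.svars
  | .mevent p => p.svars
  | .event p => p.svars

/-- Clauses `H ⇒ C`, where `H` is a multiset of facts. -/
structure Clause (S : Signature) where
  hyp : Multiset (PFact S)
  concl : PFact S

/-! ### Environments: from terms and labels to patterns -/

/-- An environment associates a pattern with each variable, bound name and name, and a session
identifier with each session identifier variable. -/
structure Env (S : Signature) where
  var : Var → Pat S
  bnm : Name → Pat S
  nm : Name → Pat S
  sess : SVar → Sess

def Term.eval (ρ : Env S) : Term S → Pat S
  | .var x => ρ.var x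
  | .bname a => ρ.bnm a
  | .name a => ρ.nm a
  | .con f ts => .con f (fun k => (ts k).eval ρ)

def Label.eval (ρ : Env S) : Label S → Pat S
  | .honest a ts ss =>
      .name (.nm a) ts.length (fun k => (ts.get k).eval ρ) (ss.map (Sess.bind ρ.sess))
  | .adv a ss =>
      .name .b0 1 (fun _ => .name (.nm a) 0 Fin.elim0 (ss.map (Sess.bind ρ.sess))) []

/-! ### Semantics of instrumented processes -/

/-- The environment of a semantic configuration: a mapping from the names of its domain to
patterns. The value of `val` outside of `dom` is irrelevant. -/
structure NameEnv (S : Signature) where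
  dom : Set Name
  val : Name → Pat S

/-- The extension of `E` to terms and labels. (It is used on closed terms and labels only, for
which the other components are irrelevant.) -/
def NameEnv.toEnv (E : NameEnv S) : Env S where
  var := .var
  bnm := fun a => Pat.atom (.nm a)
  nm := E.val
  sess := .var

/-- `E[a ↦ p]`. -/
def NameEnv.extend (E : NameEnv S) (a : Name) (p : Pat S) : NameEnv S where
  dom := insert a E.dom
  val := Function.update E.val a p

/-- Instrumented semantic configurations. -/
structure Config (S : Signature) where
  ids : Set SId
  env : NameEnv S
  procs : Multiset (IProc S)

/-- The reduction relation. -/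
inductive Step : Config S → Config S → Prop where
  | nil (L : Set SId) (E : NameEnv S) (Ps : Multiset (IProc S)) :
      Step ⟨L, E, .nil ::ₘ Ps⟩ ⟨L, E, Ps⟩
  | repl (L : Set SId) (E : NameEnv S) (Ps : Multiset (IProc S)) (i : SVar) (P : IProc S)
      (l : SId) (hl : l ∈ L) :
      Step ⟨L, E, .repl i P ::ₘ Ps⟩ ⟨L \ {l}, E, P.substSess i l ::ₘ .repl i P ::ₘ Ps⟩
  | par (L : Set SId) (E : NameEnv S) (Ps : Multiset (IProc S)) (P Q : IProc S) :
      Step ⟨L, E, .par P Q ::ₘ Ps⟩ ⟨L, E, P ::ₘ Q ::ₘ Ps⟩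
  | res (L : Set SId) (E : NameEnv S) (Ps : Multiset (IProc S)) (a : Name) (l : Label S)
      (P : IProc S) (a' : Name) (ha' : a' ∉ E.dom) :
      Step ⟨L, E, .new a l P ::ₘ Ps⟩
        ⟨L, E.extend a' (l.eval E.toEnv), P.substName a a' ::ₘ Ps⟩
  | io (L : Set SId) (E : NameEnv S) (Ps : Multiset (IProc S)) (N M : Term S) (x : Var)
      (Q P : IProc S) :
      Step ⟨L, E, .out N M Q ::ₘ .inp N x P ::ₘ Ps⟩ ⟨L, E, Q ::ₘ P.substVar x M ::ₘ Ps⟩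
  | destr1 (L : Set SId) (E : NameEnv S) (Ps : Multiset (IProc S)) (x : Var) (g : S.Des)
      (Ms : Fin (S.desArity g) → Term S) (P Q : IProc S) (M' : Term S) (h : DesRed g Ms M') :
      Step ⟨L, E, .letd x g Ms P Q ::ₘ Ps⟩ ⟨L, E, P.substVar x M' ::ₘ Ps⟩
  | destr2 (L : Set SId) (E : NameEnv S) (Ps : Multiset (IProc S)) (x : Var) (g : S.Des)
      (Ms : Fin (S.desArity g) → Term S) (P Q : IProc S) (h : ¬ ∃ M', DesRed g Ms M') :
      Step ⟨L, E, .letd x g Ms P Q ::ₘ Ps⟩ ⟨L, E, Q ::ₘ Ps⟩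
  | cond1 (L : Set SId) (E : NameEnv S) (Ps : Multiset (IProc S)) (M : Term S)
      (P Q : IProc S) :
      Step ⟨L, E, .cond M M P Q ::ₘ Ps⟩ ⟨L, E, P ::ₘ Ps⟩
  | cond2 (L : Set SId) (E : NameEnv S) (Ps : Multiset (IProc S)) (M N : Term S)
      (P Q : IProc S) (h : M ≠ N) :
      Step ⟨L, E, .cond M N P Q ::ₘ Ps⟩ ⟨L, E, Q ::ₘ Ps⟩
  | event (L : Set SId) (E : NameEnv S) (Ps : Multiset (IProc S)) (M : Term S) (P : IProc S) :
      Step ⟨L, E, .event M P ::ₘ Ps⟩ ⟨L, E, P ::ₘ Ps⟩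

/-- A trace: the configurations `conf 0 → conf 1 → … → conf len`. -/
structure Trace (S : Signature) where
  len : ℕ
  conf : ℕ → Config S
  step : ∀ k < len, Step (conf k) (conf (k + 1))

/-- The trace contains a reduction in which `N` is sent and received on channel `M`. -/
def Trace.Comm (T : Trace S) (M N : Term S) : Prop :=
  ∃ k < T.len, ∃ (L : Set SId) (E : NameEnv S) (Ps : Multiset (IProc S)) (x : Var)
    (Q P : IProc S),
    T.conf k = ⟨L, E, .out M N Q ::ₘ .inp M x P ::ₘ Ps⟩ ∧
    T.conf (k + 1) = ⟨L, E, Q ::ₘ P.substVar x N ::ₘ Ps⟩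

/-- The trace contains a reduction that executes `event(M)`. -/
def Trace.Exec (T : Trace S) (M : Term S) : Prop :=
  ∃ k < T.len, ∃ (L : Set SId) (E : NameEnv S) (Ps : Multiset (IProc S)) (P : IProc S),
    T.conf k = ⟨L, E, .event M P ::ₘ Ps⟩ ∧ T.conf (k + 1) = ⟨L, E, P ::ₘ Ps⟩

inductive Atom (S : Signature) where
  | attacker (M : Term S) : Atom S
  | message (M N : Term S) : Atom S
  | event (M : Term S) : Atom S

def Trace.SatisfiesAtom (T : Trace S) (Init : Finset Name) : Atom S → Prop
  | .attacker M => ∃ c ∈ Init, T.Comm (.name c) M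
  | .message M N => T.Comm M N
  | .event M => T.Exec M

/-- `E(α)`. -/
def Atom.eval (E : NameEnv S) : Atom S → PFact S
  | .attacker M => .attacker (M.eval E.toEnv)
  | .message M N => .message (M.eval E.toEnv) (N.eval E.toEnv)
  | .event M => .event (M.eval E.toEnv)

/-- A trace satisfies a fact when it satisfies some atom that its final environment maps to this
fact. (So it satisfies no `mevent` fact.) -/
def Trace.Satisfies (T : Trace S) (Init : Finset Name) (F : PFact S) : Prop :=
  ∃ α : Atom S, T.SatisfiesAtom Init α ∧ α.eval (T.conf T.len).env = F

/-! ### Generation of Horn clauses -/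

def Env.subst (σ : Subst S) (ρ : Env S) : Env S where
  var x := (ρ.var x).subst σ
  bnm a := (ρ.bnm a).subst σ
  nm a := (ρ.nm a).subst σ
  sess i := (ρ.sess i).bind σ.sess

def Env.setVar (ρ : Env S) (x : Var) (p : Pat S) : Env S :=
  { ρ with var := Function.update ρ.var x p }

def Env.setBnm (ρ : Env S) (a : Name) (p : Pat S) : Env S :=
  { ρ with bnm := Function.update ρ.bnm a p }

def Env.setSess (ρ : Env S) (i : SVar) (s : Sess) : Env S :=
  { ρ with sess := Function.update ρ.sess i s }

/-- The initial environment `{a ↦ a[]}`. Identifiers that are not free names are not in its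
domain; they are mapped to closed dummy values. -/
def Env.init : Env S where
  var _ := Pat.atom .b0
  bnm _ := Pat.atom .b0
  nm a := Pat.atom (.nm a)
  sess _ := .const 0

/-- The variable `x` occurs neither in the image of `ρ` nor in `H`. -/
def FreshVar (x : Var) (ρ : Env S) (H : Multiset (PFact S)) : Prop :=
  (∀ y, x ∉ (ρ.var y).vars) ∧ (∀ a, x ∉ (ρ.bnm a).vars) ∧ (∀ a, x ∉ (ρ.nm a).vars) ∧
    ∀ F ∈ H, x ∉ F.vars

/-- The session identifier variable `i` occurs neither in the image of `ρ` nor in `H`. -/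
def FreshSVar (i : SVar) (ρ : Env S) (H : Multiset (PFact S)) : Prop :=
  (∀ y, i ∉ (ρ.var y).svars) ∧ (∀ a, i ∉ (ρ.bnm a).svars) ∧ (∀ a, i ∉ (ρ.nm a).svars) ∧
    (∀ j, ρ.sess j ≠ .var i) ∧ ∀ F ∈ H, i ∉ F.svars

/-- `σ` and `σ'` satisfy `σ ρ(Mₖ) = σ' pₖ` for all `k`, where `p₁, …, pₙ` are the arguments of the
left-hand side of the rewrite rule `r`. -/
def PairUnifies {n : ℕ} (ρ : Env S) (Ms : Fin n → Term S) (r : RewriteRule S.arity n)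
    (σ : Subst S) (σ' : Var → Pat S) : Prop :=
  ∀ k, ((Ms k).eval ρ).subst σ = (r.lhs k).toPat σ'

/-- `(σ, σ')` is a most general such pair: any other one is an instance of it, on the patterns of
`ρ` and `H` and on the variables of the rewrite rule. -/
def MGPair {n : ℕ} (ρ : Env S) (H : Multiset (PFact S)) (Ms : Fin n → Term S)
    (r : RewriteRule S.arity n) (σ : Subst S) (σ' : Var → Pat S) : Prop :=
  PairUnifies ρ Ms r σ σ' ∧
  ∀ (τ : Subst S) (τ' : Var → Pat S), PairUnifies ρ Ms r τ τ' → ∃ θ : Subst S,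
    (ρ.subst σ).subst θ = ρ.subst τ ∧
    (∀ F ∈ H, (F.subst σ).subst θ = F.subst τ) ∧
    ∀ k, ∀ y ∈ (r.lhs k).vars, (σ' y).subst θ = τ' y

/-- `σ` is a most general unifier of `ρ(M)` and `ρ(N)`. -/
def MGCond (ρ : Env S) (H : Multiset (PFact S)) (M N : Term S) (σ : Subst S) : Prop :=
  (M.eval ρ).subst σ = (N.eval ρ).subst σ ∧
  ∀ τ : Subst S, (M.eval ρ).subst τ = (N.eval ρ).subst τ → ∃ θ : Subst S,
    (ρ.subst σ).subst θ = ρ.subst τ ∧ ∀ F ∈ H, (F.subst σ).subst θ = F.subst τ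

/-- `Trans P ρ H R`: the set of clauses `R` is a value of the translation `⟦P⟧ρH`. This value is
determined up to the names of the variables in the clauses, that is, up to the choice of the most
general unifiers and of the fresh variables that stand for the bound variables of `P`. -/
inductive Trans : IProc S → Env S → Multiset (PFact S) → Set (Clause S) → Prop where
  | nil (ρ : Env S) (H : Multiset (PFact S)) : Trans .nil ρ H ∅
  | par (P Q : IProc S) (ρ : Env S) (H : Multiset (PFact S)) (RP RQ : Set (Clause S))
      (hP : Trans P ρ H RP) (hQ : Trans Q ρ H RQ) : Trans (.par P Q) ρ H (RP ∪ RQ)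
  | repl (i i' : SVar) (P : IProc S) (ρ : Env S) (H : Multiset (PFact S)) (R : Set (Clause S))
      (hi : FreshSVar i' ρ H) (hP : Trans P (ρ.setSess i (.var i')) H R) :
      Trans (.repl i P) ρ H R
  | new (a b : Name) (ts : List (Term S)) (ss : List Sess) (P : IProc S) (ρ : Env S)
      (H : Multiset (PFact S)) (R : Set (Clause S))
      (hP : Trans P (ρ.setBnm a ((Label.honest b ts ss).eval ρ)) H R) :
      Trans (.new a (.honest b ts ss) P) ρ H R
  | inp (M : Term S) (x x' : Var) (P : IProc S) (ρ : Env S) (H : Multiset (PFact S))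
      (R : Set (Clause S)) (hx : FreshVar x' ρ H)
      (hP : Trans P (ρ.setVar x (.var x')) (.message (M.eval ρ) (.var x') ::ₘ H) R) :
      Trans (.inp M x P) ρ H R
  | out (M N : Term S) (P : IProc S) (ρ : Env S) (H : Multiset (PFact S)) (R : Set (Clause S))
      (hP : Trans P ρ H R) :
      Trans (.out M N P) ρ H (R ∪ {⟨H, .message (M.eval ρ) (N.eval ρ)⟩})
  | letd (x : Var) (g : S.Des) (Ms : Fin (S.desArity g) → Term S) (P Q : IProc S) (ρ : Env S)
      (H : Multiset (PFact S))
      (σ : RewriteRule S.arity (S.desArity g) → Subst S)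
      (σ' : RewriteRule S.arity (S.desArity g) → Var → Pat S)
      (RP : RewriteRule S.arity (S.desArity g) → Set (Clause S)) (RQ : Set (Clause S))
      (hσ : ∀ r ∈ S.rules g, (∃ τ τ', PairUnifies ρ Ms r τ τ') → MGPair ρ H Ms r (σ r) (σ' r))
      (hP : ∀ r ∈ S.rules g, (∃ τ τ', PairUnifies ρ Ms r τ τ') →
        Trans P ((ρ.subst (σ r)).setVar x (r.rhs.toPat (σ' r))) (H.map (PFact.subst (σ r))) (RP r))
      (hQ : Trans Q ρ H RQ) :
      Trans (.letd x g Ms P Q) ρ H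
        ({C | ∃ r ∈ S.rules g, (∃ τ τ', PairUnifies ρ Ms r τ τ') ∧ C ∈ RP r} ∪ RQ)
  | condUnif (M N : Term S) (P Q : IProc S) (ρ : Env S) (H : Multiset (PFact S)) (σ : Subst S)
      (RP RQ : Set (Clause S)) (hσ : MGCond ρ H M N σ)
      (hP : Trans P (ρ.subst σ) (H.map (PFact.subst σ)) RP) (hQ : Trans Q ρ H RQ) :
      Trans (.cond M N P Q) ρ H (RP ∪ RQ)
  | condNotUnif (M N : Term S) (P Q : IProc S) (ρ : Env S) (H : Multiset (PFact S))
      (RQ : Set (Clause S)) (h : ¬ ∃ τ : Subst S, (M.eval ρ).subst τ = (N.eval ρ).subst τ)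
      (hQ : Trans Q ρ H RQ) :
      Trans (.cond M N P Q) ρ H RQ
  | event (M : Term S) (P : IProc S) (ρ : Env S) (H : Multiset (PFact S)) (R : Set (Clause S))
      (hP : Trans P ρ (.mevent (M.eval ρ) ::ₘ H) R) :
      Trans (.event M P) ρ H (R ∪ {⟨H, .event (M.eval ρ)⟩})

/-- The clause (Rf) for `f`, with variables `x`:
`attacker(x₁) ∧ … ∧ attacker(xₙ) ⇒ attacker(f(x₁, …, xₙ))`. -/
def clauseRf (f : S.Con) (x : Fin (S.arity f) → Var) : Clause S where
  hyp := (Finset.univ : Finset (Fin (S.arity f))).val.map (fun k => .attacker (.var (x k)))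
  concl := .attacker (.con f (fun k => .var (x k)))

/-- The clause (Rg) for a rewrite rule:
`attacker(M₁) ∧ … ∧ attacker(Mₙ) ⇒ attacker(M)`. -/
def clauseRg {n : ℕ} (r : RewriteRule S.arity n) : Clause S where
  hyp := (Finset.univ : Finset (Fin n)).val.map (fun k => .attacker ((r.lhs k).toPat .var))
  concl := .attacker (r.rhs.toPat .var)

/-- The clauses for the attacker. -/
inductive AttackerClause (Init : Finset Name) : Clause S → Prop where
  | init (a : Name) (ha : a ∈ Init) : AttackerClause Init ⟨0, .attacker (.atom (.nm a))⟩
  | rn : AttackerClause Init ⟨0, .attacker (.name .b0 1 (fun _ => .var 0) [])⟩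
  | rf (f : S.Con) (hf : f ∈ S.publicCon) :
      AttackerClause Init (clauseRf f (fun k => (k : ℕ)))
  | rg (g : S.Des) (hg : g ∈ S.publicDes) (r : RewriteRule S.arity (S.desArity g))
      (hr : r ∈ S.rules g) : AttackerClause Init (clauseRg r)
  | rl : AttackerClause Init
      ⟨{.message (.var 0) (.var 1), .attacker (.var 0)}, .attacker (.var 1)⟩
  | rs : AttackerClause Init
      ⟨{.attacker (.var 0), .attacker (.var 1)}, .message (.var 0) (.var 1)⟩

/-- `R₀` is (a value of) the set of clauses corresponding to the instrumented process `P'` in the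
presence of `Init`-adversaries. -/
def ProtocolClauses (P' : IProc S) (Init : Finset Name) (R₀ : Set (Clause S)) : Prop :=
  ∃ R, Trans P' Env.init 0 R ∧ R₀ = R ∪ {C | AttackerClause Init C}

/-! ### Resolution and selection -/

def PFact.Unselectable (F : PFact S) : Prop :=
  (∃ x, F = .attacker (.var x)) ∨ ∃ p, F = .mevent p

/-- Selection functions. -/
structure SelFun (S : Signature) where
  sel : Clause S → Set (PFact S)
  sel_subset : ∀ R, ∀ F ∈ sel R, F ∈ R.hyp
  sel_selectable : ∀ R, ∀ F ∈ sel R, ¬ F.Unselectable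
  sel_attacker_var : ∀ (H : Multiset (PFact S)) (x : Var), (∃ F ∈ H, ¬ F.Unselectable) →
    sel ⟨H, .attacker (.var x)⟩ ≠ ∅

/-- `F` and `G` are unifiable after renaming their variables apart. -/
def Unifiable (F G : PFact S) : Prop := ∃ τ₁ τ₂ : Subst S, F.subst τ₁ = G.subst τ₂

open Classical in
/-- `R''` is the resolvent `R ∘_{F₀} R'`. The variables of `R` and `R'` are considered as disjoint,
so that their most general unifier is given by its restrictions `σ₁` to the variables of `R` and
`σ₂` to those of `R'`. -/
def Resolvent (R : Clause S) (F₀ : PFact S) (R' R'' : Clause S) : Prop :=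
  F₀ ∈ R'.hyp ∧ ∃ σ₁ σ₂ : Subst S, R.concl.subst σ₁ = F₀.subst σ₂ ∧
    (∀ τ₁ τ₂ : Subst S, R.concl.subst τ₁ = F₀.subst τ₂ → ∃ θ : Subst S,
      (∀ F ∈ R.concl ::ₘ R.hyp, (F.subst σ₁).subst θ = F.subst τ₁) ∧
      (∀ F ∈ R'.concl ::ₘ R'.hyp, (F.subst σ₂).subst θ = F.subst τ₂)) ∧
    R'' = ⟨R.hyp.map (PFact.subst σ₁) + (R'.hyp.erase F₀).map (PFact.subst σ₂),
      R'.concl.subst σ₂⟩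

/-- `R₁ ⊒ R₂`: `R₁` subsumes `R₂`. -/
def Subsumes (R₁ R₂ : Clause S) : Prop :=
  ∃ σ : Subst S, R₁.concl.subst σ = R₂.concl ∧ R₁.hyp.map (PFact.subst σ) ≤ R₂.hyp

/-- `R'` is obtained from the set `R` by eliminating subsumed clauses. -/
def Elim (R R' : Set (Clause S)) : Prop :=
  R' ⊆ R ∧ (∀ C ∈ R, ∃ C' ∈ R', Subsumes C' C) ∧
    ∀ C ∈ R', ∀ C' ∈ R', Subsumes C C' → C = C'

/-! ### Simplification of clauses -/

open Classical in
/-- Decomposition of the data constructors at the top of a pattern. -/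
noncomputable def Pat.parts : Pat S → Multiset (Pat S)
  | .var x => {.var x}
  | .name a n ps ss => {.name a n ps ss}
  | .con f ps => if f ∈ S.dataCon then ∑ k, (ps k).parts else {.con f ps}

noncomputable def PFact.parts : PFact S → Multiset (PFact S)
  | .attacker p => p.parts.map .attacker
  | .message p q => {.message p q}
  | .mevent p => {.mevent p}
  | .event p => {.event p}

/-- The clauses (Rf) and (Rg) of the data constructors, up to the names of the variables. -/
def Clause.IsData (R : Clause S) : Prop :=
  ∃ f ∈ S.dataCon, ∃ x : Fin (S.arity f) → Var, Function.Injective x ∧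
    (R = clauseRf f x ∨
      ∃ i, R = ⟨{.attacker (.con f (fun k => .var (x k)))}, .attacker (.var (x i))⟩)

open Classical in
/-- Decomposition of data constructors in the hypothesis. -/
noncomputable def decomphyp (R : Clause S) : Clause S :=
  if R.IsData then R else ⟨R.hyp.bind PFact.parts, R.concl⟩

open Classical in
/-- Decomposition of data constructors in the hypothesis and in the conclusion. -/
noncomputable def decomp (R : Clause S) : Set (Clause S) :=
  if R.IsData then {R} else {R' | ∃ C ∈ R.concl.parts, R' = ⟨R.hyp.bind PFact.parts, C⟩}

/-- Elimination of tautologies. -/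
def elimtaut (Rs : Set (Clause S)) : Set (Clause S) := {R ∈ Rs | R.concl ∉ R.hyp}

open Classical in
/-- Elimination of duplicate hypotheses. -/
noncomputable def elimdup (R : Clause S) : Clause S := ⟨R.hyp.dedup, R.concl⟩

open Classical in
/-- `F` is a hypothesis `attacker(x)` of `R`, where `x` does not occur elsewhere in `R`. -/
def IsUselessAttx (R : Clause S) (F : PFact S) : Prop :=
  ∃ x, F = .attacker (.var x) ∧ x ∉ R.concl.vars ∧ ∀ G ∈ R.hyp.erase F, x ∉ G.vars

open Classical in
/-- Elimination of useless `attacker(x)` hypotheses. -/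
noncomputable def elimattx (R : Clause S) : Clause S :=
  ⟨R.hyp.filter (fun F => ¬ IsUselessAttx R F), R.concl⟩

/-- Elimination of the clauses that have an instance of a fact of `Fnot` in their hypotheses. -/
def elimnot (Fnot : Set (PFact S)) (Rs : Set (Clause S)) : Set (Clause S) :=
  {R ∈ Rs | ¬ ∃ F ∈ R.hyp, ∃ G ∈ Fnot, ∃ σ : Subst S, F = G.subst σ}

/-- One elimination of redundant hypotheses: `H ∧ H' ⇒ C` is replaced with `H' ⇒ C` when there is
`σ` that maps the facts of `H` into `H'` and does not change the variables of `H'` and `C`. -/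
def RedundantStep (R R' : Clause S) : Prop :=
  ∃ (H H' : Multiset (PFact S)) (C : PFact S) (σ : Subst S),
    R = ⟨H + H', C⟩ ∧ R' = ⟨H', C⟩ ∧ (∀ F ∈ H, F.subst σ ∈ H') ∧
    (∀ F ∈ H', F.subst σ = F) ∧ C.subst σ = C

/-- `e` is a function that eliminates redundant hypotheses. According to user settings, any of
the possible eliminations may be performed or not. -/
def IsElimRedundantHyp (e : Clause S → Clause S) : Prop :=
  ∀ R, Relation.ReflTransGen RedundantStep R (e R)

/-- `Rs` is a value of
`simplify = elimattx ∘ elimtaut ∘ elimnot ∘ elimredundanthyp ∘ elimdup ∘ decomp` on `R`. -/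
def Simplify (Fnot : Set (PFact S)) (R : Clause S) (Rs : Set (Clause S)) : Prop :=
  ∃ e : Clause S → Clause S, IsElimRedundantHyp e ∧
    Rs = elimattx '' elimtaut (elimnot Fnot (e '' (elimdup '' decomp R)))

/-- `Rs` is a value of
`simplify' = elimattx ∘ elimnot ∘ elimredundanthyp ∘ elimdup ∘ decomphyp` on `R`. -/
def Simplify' (Fnot : Set (PFact S)) (R : Clause S) (Rs : Set (Clause S)) : Prop :=
  ∃ e : Clause S → Clause S, IsElimRedundantHyp e ∧
    Rs = elimattx '' elimnot Fnot {e (elimdup (decomphyp R))}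

/-! ### The solving algorithm

The algorithm is described by its terminating executions. Its result may depend on arbitrary
choices (order of the operations, choice of most general unifiers, clause that is kept when two
clauses subsume each other), so it is a relation. -/

/-- The instruction `R ← elim(simplify(C) ∪ R)`. -/
def AddClause (Fnot : Set (PFact S)) (C : Clause S) (R R' : Set (Clause S)) : Prop :=
  ∃ Cs, Simplify Fnot C Cs ∧ Elim (Cs ∪ R) R'

/-- Insertion of the clauses of a list one after the other. -/
inductive AddList (Fnot : Set (PFact S)) :
    List (Clause S) → Set (Clause S) → Set (Clause S) → Prop where
  | nil (R : Set (Clause S)) : AddList Fnot [] R R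
  | cons (C : Clause S) (l : List (Clause S)) (R R' R'' : Set (Clause S))
      (h : AddClause Fnot C R R') (hl : AddList Fnot l R' R'') : AddList Fnot (C :: l) R R''

/-- One iteration of the second step of `saturate`. -/
def SatStep (sf : SelFun S) (Fnot : Set (PFact S)) (R R' : Set (Clause S)) : Prop :=
  ∃ C ∈ R, sf.sel C = ∅ ∧ ∃ C' ∈ R, ∃ F₀ ∈ sf.sel C', ∃ C'', Resolvent C F₀ C' C'' ∧
    AddClause Fnot C'' R R'

/-- The second step of `saturate` leaves `R` unchanged. -/
def IsFixpoint (sf : SelFun S) (Fnot : Set (PFact S)) (R : Set (Clause S)) : Prop :=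
  ∀ C ∈ R, sf.sel C = ∅ → ∀ C' ∈ R, ∀ F₀ ∈ sf.sel C', Unifiable C.concl F₀ →
    ∃ C'', Resolvent C F₀ C' C'' ∧ AddClause Fnot C'' R R

/-- `saturate(R₀)` terminates and returns `R₁`. -/
def Saturate (sf : SelFun S) (Fnot : Set (PFact S)) (R₀ R₁ : Set (Clause S)) : Prop :=
  ∃ (l : List (Clause S)) (R R' : Set (Clause S)),
    (∀ C, C ∈ l ↔ C ∈ R₀) ∧ AddList Fnot l ∅ R ∧
    Relation.ReflTransGen (SatStep sf Fnot) R R' ∧ IsFixpoint sf Fnot R' ∧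
    R₁ = {C ∈ R' | sf.sel C = ∅}

/-- `Deriv sf Fnot R₁ C R out`: `deriv(C, R, R₁)` terminates and returns `out`. In the third case,
for each `C' ∈ R₁` and `F₀ ∈ sel(C)` such that `C' ∘_{F₀} C` is defined, `res C' F₀` is this
resolvent, `simp C' F₀` is its simplification, and `out C' F₀ C''` is the result of the recursive
call on the clause `C''` of `simp C' F₀`. -/
inductive Deriv (sf : SelFun S) (Fnot : Set (PFact S)) (R₁ : Set (Clause S)) :
    Clause S → Set (Clause S) → Set (Clause S) → Prop where
  | cycle (C : Clause S) (R : Set (Clause S)) (h : ∃ C' ∈ R, Subsumes C' C) :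
      Deriv sf Fnot R₁ C R ∅
  | leaf (C : Clause S) (R : Set (Clause S)) (h : ¬ ∃ C' ∈ R, Subsumes C' C)
      (hs : sf.sel C = ∅) : Deriv sf Fnot R₁ C R {C}
  | node (C : Clause S) (R : Set (Clause S)) (h : ¬ ∃ C' ∈ R, Subsumes C' C)
      (hs : sf.sel C ≠ ∅)
      (res : Clause S → PFact S → Clause S)
      (simp : Clause S → PFact S → Set (Clause S))
      (out : Clause S → PFact S → Clause S → Set (Clause S))
      (hres : ∀ C' ∈ R₁, ∀ F₀ ∈ sf.sel C, Unifiable C'.concl F₀ →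
        Resolvent C' F₀ C (res C' F₀))
      (hsimp : ∀ C' ∈ R₁, ∀ F₀ ∈ sf.sel C, Unifiable C'.concl F₀ →
        Simplify' Fnot (res C' F₀) (simp C' F₀))
      (hout : ∀ C' ∈ R₁, ∀ F₀ ∈ sf.sel C, Unifiable C'.concl F₀ → ∀ C'' ∈ simp C' F₀,
        Deriv sf Fnot R₁ C'' (insert C R) (out C' F₀ C'')) :
      Deriv sf Fnot R₁ C R
        {D | ∃ C' ∈ R₁, ∃ F₀ ∈ sf.sel C, Unifiable C'.concl F₀ ∧
          ∃ C'' ∈ simp C' F₀, D ∈ out C' F₀ C''}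

/-- `derivable(F, R₁)` terminates and returns `out`. -/
def Derivable (sf : SelFun S) (Fnot : Set (PFact S)) (F : PFact S) (R₁ out : Set (Clause S)) :
    Prop :=
  Deriv sf Fnot R₁ ⟨{F}, F⟩ ∅ out

/-- `solve_{P', Init}(F)` terminates without error and returns `out`. -/
def Solve (sf : SelFun S) (Fnot : Set (PFact S)) (P' : IProc S) (Init : Finset Name) (F : PFact S)
    (out : Set (Clause S)) : Prop :=
  ∃ R₀ R₁, ProtocolClauses P' Init R₀ ∧ Saturate sf Fnot R₀ R₁ ∧
    (∀ G ∈ Fnot, Derivable sf Fnot G R₁ ∅) ∧ Derivable sf Fnot F R₁ out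

end

end HornProtocol

open HornProtocol

/-!
The proof has two halves, joined by the set `D` of the facts that are derivable from the saturated
clauses `R₁` together with the must-events `mevent(p)` for the events that the trace executes.

*From the trace to `D`.* A process is well-typed (`WT`) with respect to a set of facts when all the
messages and events that it can produce, on inputs allowed by the set, satisfy facts of the set.
If the set is closed under the clauses generated from the protocol and from the adversary, then the
protocol is well-typed (`Trans.wt`), the adversary is well-typed (`wt_instrAux_adv`), and reduction
preserves typing (`Config.WellTyped.step`). Hence the set contains every fact satisfied by the
trace (`mem_of_closedUnder`).

*Saturation.* To see that `D` is closed under the initial clauses, each derivable fact is given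
the cost of its cheapest derivation (`cost`). Derivations are data-decomposed, so that the cost of
`attacker(f(p₁, …, pₙ))` for a data constructor `f` is one more than the sum of the costs of the
`attacker(pᵢ)`. For such weights every simplification step is harmless: it replaces a clause by
clauses that are at most as expensive (`Covered`, `covered_of_simplify`). A use of a clause with a
selected hypothesis can be traded for a strictly cheaper use of a resolvent, so by induction on the
cost all uses of initial clauses can be replaced by derivations from `R₁` (`forwardBound`). The
delicate case is a clause of `R₁` with conclusion `attacker(x)`, whose instances may need
decomposing; it is resolved with the clauses for the projections (`exists_root_instance`).

*Backward search.* The search `deriv` loses no solution (`Deriv.exists_instance`): for the cheapest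
instance of the current clause with the wanted conclusion, the resolvent chosen by the derivation of
a selected hypothesis has a strictly cheaper instance. In particular a clause on the search path is
never subsumed by an ancestor. Clauses with a hypothesis that is an instance of a fact of `Fnot`
can be dropped since no such instance is derivable: applied to a cheapest one, the same argument
shows that the search for that fact would not have returned the empty set (`cost_notInst_eq_top`).
-/

namespace HornProtocol

variable {S : Signature}

/-! ### Substitutions on patterns, facts and environments -/

/-- The substitution that applies `σ` and then `θ`. -/
def Subst.comp (σ θ : Subst S) : Subst S where
  var x := (σ.var x).subst θ
  sess i := (σ.sess i).bind θ.sess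

/-- The identity substitution. -/
def Subst.id : Subst S where
  var := .var
  sess := .var

theorem Sess.bind_bind (s t : SVar → Sess) (u : Sess) :
    (u.bind s).bind t = u.bind (fun i => (s i).bind t) := by
  cases u <;> rfl

theorem Sess.bind_var (u : Sess) : u.bind .var = u := by
  cases u <;> rfl

theorem Pat.subst_subst (σ θ : Subst S) (p : Pat S) :
    (p.subst σ).subst θ = p.subst (σ.comp θ) := by
  induction p with
  | var x => rfl
  | name a n ps ss ih =>
    simp only [Pat.subst, ih, List.map_map]
    congr 1
    apply List.map_congr_left
    intro u _
    exact Sess.bind_bind _ _ u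
  | con f ps ih => simp only [Pat.subst, ih]

theorem Pat.subst_id (p : Pat S) : p.subst Subst.id = p := by
  induction p with
  | var x => rfl
  | name a n ps ss ih =>
    simp only [Pat.subst, ih]
    congr 1
    conv_rhs => rw [← List.map_id ss]
    apply List.map_congr_left
    intro u _
    exact Sess.bind_var u
  | con f ps ih => simp only [Pat.subst, ih]

theorem Pat.subst_congr {σ τ : Subst S} (p : Pat S) (hv : ∀ x ∈ p.vars, σ.var x = τ.var x)
    (hs : ∀ i ∈ p.svars, σ.sess i = τ.sess i) : p.subst σ = p.subst τ := by
  induction p with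
  | var x => exact hv x rfl
  | name a n ps ss ih =>
    simp only [Pat.subst]
    congr 1
    · funext k
      exact ih k (fun x hx => hv x (Set.mem_iUnion.2 ⟨k, hx⟩))
        (fun i hi => hs i (Or.inl (Set.mem_iUnion.2 ⟨k, hi⟩)))
    · apply List.map_congr_left
      intro u hu
      cases u with
      | var i => exact hs i (Or.inr hu)
      | const l => rfl
  | con f ps ih =>
    simp only [Pat.subst]
    congr 1
    funext k
    exact ih k (fun x hx => hv x (Set.mem_iUnion.2 ⟨k, hx⟩))
      (fun i hi => hs i (Set.mem_iUnion.2 ⟨k, hi⟩))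

theorem PFact.subst_subst (σ θ : Subst S) (F : PFact S) :
    (F.subst σ).subst θ = F.subst (σ.comp θ) := by
  cases F <;> simp [PFact.subst, Pat.subst_subst]

theorem PFact.subst_id (F : PFact S) : F.subst Subst.id = F := by
  cases F <;> simp [PFact.subst, Pat.subst_id]

theorem PFact.subst_congr {σ τ : Subst S} (F : PFact S)
    (hv : ∀ x ∈ F.vars, σ.var x = τ.var x) (hs : ∀ i ∈ F.svars, σ.sess i = τ.sess i) :
    F.subst σ = F.subst τ := by
  cases F with
  | message p q =>
    simp only [PFact.subst]
    rw [Pat.subst_congr p (fun x hx => hv x (Or.inl hx)) (fun x hx => hs x (Or.inl hx)),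
      Pat.subst_congr q (fun x hx => hv x (Or.inr hx)) (fun x hx => hs x (Or.inr hx))]
  | _ p =>
    simp only [PFact.subst]
    rw [Pat.subst_congr p hv hs]

theorem map_subst_subst (σ θ : Subst S) (H : Multiset (PFact S)) :
    (H.map (PFact.subst σ)).map (PFact.subst θ) = H.map (PFact.subst (σ.comp θ)) := by
  rw [Multiset.map_map]
  exact Multiset.map_congr rfl fun F _ => PFact.subst_subst σ θ F

theorem Subsumes.trans {R₁ R₂ R₃ : Clause S} (h₁ : Subsumes R₁ R₂) (h₂ : Subsumes R₂ R₃) :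
    Subsumes R₁ R₃ := by
  obtain ⟨σ, hc, hh⟩ := h₁
  obtain ⟨τ, hc', hh'⟩ := h₂
  refine ⟨σ.comp τ, ?_, ?_⟩
  · rw [← PFact.subst_subst, hc, hc']
  · rw [← map_subst_subst]
    exact (Multiset.map_le_map hh).trans hh'

theorem Subsumes.refl (R : Clause S) : Subsumes R R :=
  ⟨Subst.id, PFact.subst_id _, by
    rw [Multiset.map_congr rfl fun F _ => PFact.subst_id F, Multiset.map_id']⟩

/-! ### Weights of facts and decomposition of data constructors -/

/-- `F` is `attacker(f(p₁, …, pₙ))` for a data constructor `f`. -/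
def PFact.DataTop (F : PFact S) : Prop :=
  ∃ f ∈ S.dataCon, ∃ ps, F = .attacker (.con f ps)

/-- `F` can be the conclusion of a resolution step of a data-decomposed derivation: it cannot be
decomposed, and it is not one of the `mevent` facts, which are given. -/
def PFact.Final (F : PFact S) : Prop := ¬ F.DataTop ∧ ∀ p, F ≠ .mevent p

/-- `FPath d F F'`: the fact `F'` is obtained from `F` by `d` projections of data constructors. -/
inductive FPath : ℕ → PFact S → PFact S → Prop where
  | refl (F : PFact S) : FPath 0 F F
  | step (d : ℕ) (f : S.Con) (hf : f ∈ S.dataCon) (ps : Fin (S.arity f) → Pat S)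
      (i : Fin (S.arity f)) (F : PFact S) (h : FPath d (.attacker (ps i)) F) :
      FPath (d + 1) (.attacker (.con f ps)) F

/-- A weight of facts for which `attacker(f(p₁, …, pₙ))`, with `f` a data constructor, costs one
more than `attacker(p₁), …, attacker(pₙ)` together. -/
def DataAdditive (w : PFact S → ℕ∞) : Prop :=
  ∀ f ∈ S.dataCon, ∀ ps : Fin (S.arity f) → Pat S,
    w (.attacker (.con f ps)) = 1 + ∑ k, w (.attacker (ps k))

/-- `A` costs at most as much as `B` for every weight that is additive on data constructors. This
is the order in which all simplifications decrease the hypotheses of clauses. -/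
def Dominated (A B : Multiset (PFact S)) : Prop :=
  ∀ w : PFact S → ℕ∞, DataAdditive w → (A.map w).sum ≤ (B.map w).sum

theorem Dominated.trans {A B C : Multiset (PFact S)} (h₁ : Dominated A B) (h₂ : Dominated B C) :
    Dominated A C := fun w hw => (h₁ w hw).trans (h₂ w hw)

theorem weight_sum_le {A B : Multiset (PFact S)} (h : A ≤ B) (w : PFact S → ℕ∞) :
    (A.map w).sum ≤ (B.map w).sum := by
  obtain ⟨C, rfl⟩ := Multiset.le_iff_exists_add.1 h
  rw [Multiset.map_add, Multiset.sum_add]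
  exact le_self_add

theorem weight_le_sum {A : Multiset (PFact S)} {F : PFact S} (h : F ∈ A) (w : PFact S → ℕ∞) :
    w F ≤ (A.map w).sum := by
  simpa using weight_sum_le (Multiset.singleton_le.2 h) w

theorem weight_sum_ne_top {A : Multiset (PFact S)} {w : PFact S → ℕ∞}
    (h : ∀ F ∈ A, w F ≠ ⊤) : (A.map w).sum ≠ ⊤ := by
  induction A using Multiset.induction with
  | empty => simp
  | cons F A ih =>
    rw [Multiset.map_cons, Multiset.sum_cons]
    exact WithTop.add_ne_top.2 ⟨h F (by simp), ih fun G hG => h G (by simp [hG])⟩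

theorem Dominated.of_le {A B : Multiset (PFact S)} (h : A ≤ B) : Dominated A B :=
  fun w _ => weight_sum_le h w

theorem FPath.weight_le {d : ℕ} {F F' : PFact S} (h : FPath d F F') {w : PFact S → ℕ∞}
    (hw : DataAdditive w) : w F' + d ≤ w F := by
  induction h with
  | refl F => simp
  | step d f hf ps i F h ih =>
    rw [hw f hf]
    have h₁ : w (.attacker (ps i)) ≤ ∑ k, w (.attacker (ps k)) :=
      Finset.single_le_sum (f := fun k => w (.attacker (ps k))) (fun _ _ => zero_le)
        (Finset.mem_univ i)
    calc w F + ((d + 1 : ℕ) : ℕ∞) = 1 + (w F + d) := by push_cast; ring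
      _ ≤ _ := by gcongr; exact ih.trans h₁

theorem FPath.weight_le' {d : ℕ} {F F' : PFact S} (h : FPath d F F') {w : PFact S → ℕ∞}
    (hw : DataAdditive w) : w F' ≤ w F := le_self_add.trans (h.weight_le hw)

/-- A path to a final fact in an instance of a fact leaves the fact through one of its parts. -/
theorem FPath.exists_part {σ : Subst S} {C F : PFact S} {d : ℕ} (h : FPath d (C.subst σ) F)
    (hF : F.Final) : ∃ C' ∈ C.parts, ∃ d' ≤ d, FPath d' (C'.subst σ) F := by
  cases C with
  | attacker p =>
    induction p generalizing d with
    | var x => exact ⟨_, by simp [PFact.parts, Pat.parts], d, le_rfl, h⟩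
    | name a n ps ss => exact ⟨_, by simp [PFact.parts, Pat.parts], d, le_rfl, h⟩
    | con f ps ih =>
      by_cases hf : f ∈ S.dataCon
      · cases h with
        | refl => exact absurd ⟨f, hf, _, rfl⟩ hF.1
        | step d f hf ps' i F h =>
          obtain ⟨C', hC', d', hd', h'⟩ := ih i h
          refine ⟨C', ?_, d', by omega, h'⟩
          simp only [PFact.parts, Multiset.mem_map, Pat.parts, if_pos hf] at hC' ⊢
          obtain ⟨q, hq, rfl⟩ := hC'
          exact ⟨q, Multiset.mem_sum.2 ⟨i, Finset.mem_univ i, hq⟩, rfl⟩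
      · exact ⟨_, by simp [PFact.parts, Pat.parts, hf], d, le_rfl, h⟩
  | message p q => exact ⟨_, by simp [PFact.parts], d, le_rfl, h⟩
  | mevent p => exact ⟨_, by simp [PFact.parts], d, le_rfl, h⟩
  | event p => exact ⟨_, by simp [PFact.parts], d, le_rfl, h⟩

theorem Dominated.parts (σ : Subst S) (F : PFact S) :
    Dominated (F.parts.map (PFact.subst σ)) {F.subst σ} := by
  intro w hw
  cases F with
  | attacker p =>
    induction p with
    | var x => simp [PFact.parts, Pat.parts]
    | name a n ps ss => simp [PFact.parts, Pat.parts]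
    | con f ps ih =>
      by_cases hf : f ∈ S.dataCon
      · simp only [PFact.parts, Pat.parts, if_pos hf, PFact.subst, Pat.subst,
          Multiset.map_map, Multiset.map_singleton, Multiset.sum_singleton] at ih ⊢
        rw [hw f hf]
        refine le_trans ?_ le_add_self
        have := map_sum (Multiset.mapAddMonoidHom
          (w ∘ PFact.subst σ ∘ PFact.attacker)) (fun k => (ps k).parts) Finset.univ
        simp only [Multiset.coe_mapAddMonoidHom] at this
        rw [this, Multiset.sum_sum]
        exact Finset.sum_le_sum fun k _ => ih k
      · simp [PFact.parts, Pat.parts, hf]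
  | message p q => simp [PFact.parts]
  | mevent p => simp [PFact.parts]
  | event p => simp [PFact.parts]

theorem Dominated.bind_parts (σ : Subst S) (H : Multiset (PFact S)) :
    Dominated ((H.bind PFact.parts).map (PFact.subst σ)) (H.map (PFact.subst σ)) := by
  intro w hw
  induction H using Multiset.induction with
  | empty => simp
  | cons F H ih =>
    simp only [Multiset.cons_bind, Multiset.map_add, Multiset.sum_add, Multiset.map_cons,
      Multiset.sum_cons]
    have := Dominated.parts σ F w hw
    rw [Multiset.map_singleton, Multiset.sum_singleton] at this
    exact add_le_add this ih

theorem Pat.not_dataTop_of_mem_parts {p q : Pat S} (h : q ∈ p.parts) :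
    ¬ (PFact.attacker q).DataTop := by
  induction p with
  | var x =>
    rw [Pat.parts, Multiset.mem_singleton] at h
    rintro ⟨f, _, ps, hh⟩
    simp [h] at hh
  | name a n ps ss =>
    rw [Pat.parts, Multiset.mem_singleton] at h
    rintro ⟨f, _, ps, hh⟩
    simp [h] at hh
  | con f ps ih =>
    by_cases hf : f ∈ S.dataCon
    · rw [Pat.parts, if_pos hf] at h
      obtain ⟨i, _, hi⟩ := Multiset.mem_sum.1 h
      exact ih i hi
    · rw [Pat.parts, if_neg hf, Multiset.mem_singleton] at h
      subst h
      rintro ⟨g, hg, qs, hh⟩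
      simp only [PFact.attacker.injEq, Pat.con.injEq] at hh
      exact hf (hh.1 ▸ hg)

theorem PFact.not_dataTop_of_mem_parts {F G : PFact S} (h : G ∈ F.parts) : ¬ G.DataTop := by
  cases F with
  | attacker p =>
    obtain ⟨q, hq, rfl⟩ := Multiset.mem_map.1 h
    exact Pat.not_dataTop_of_mem_parts hq
  | _ =>
    rw [PFact.parts, Multiset.mem_singleton] at h
    rintro ⟨f, _, ps, hh⟩
    simp [h] at hh

/-! ### Derivations and their costs -/

/-- `Dv Me 𝓡 F n`: there is a derivation of cost at most `n` of `F` from the clauses of `𝓡` and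
the facts `mevent(p)` with `p ∈ Me`. Derivations are data-decomposed: the facts
`attacker(f(p₁, …, pₙ))` with `f` a data constructor are only obtained from `attacker(p₁)`, …,
`attacker(pₙ)`, and when the conclusion of a clause is such a fact, one of its components is
immediately extracted by projections, each of which adds one to the cost. -/
inductive Dv (Me : Set (Pat S)) (𝓡 : Set (Clause S)) : PFact S → ℕ → Prop where
  | me (p : Pat S) (hp : p ∈ Me) (n : ℕ) : Dv Me 𝓡 (.mevent p) n
  | comp (f : S.Con) (hf : f ∈ S.dataCon) (ps : Fin (S.arity f) → Pat S)
      (w : Fin (S.arity f) → ℕ) (h : ∀ k, Dv Me 𝓡 (.attacker (ps k)) (w k)) (n : ℕ)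
      (hn : 1 + ∑ k, w k ≤ n) : Dv Me 𝓡 (.attacker (.con f ps)) n
  | node (R : Clause S) (hR : R ∈ 𝓡) (σ : Subst S) (d : ℕ) (F : PFact S)
      (hp : FPath d (R.concl.subst σ) F) (hF : F.Final) (w : PFact S → ℕ)
      (h : ∀ G ∈ R.hyp.map (PFact.subst σ), Dv Me 𝓡 G (w G)) (n : ℕ)
      (hn : ((R.hyp.map (PFact.subst σ)).map w).sum + d + 1 ≤ n) : Dv Me 𝓡 F n

open Classical in
/-- The cost of the cheapest derivation of `F`, `⊤` if there is none. -/
noncomputable def cost (Me : Set (Pat S)) (𝓡 : Set (Clause S)) (F : PFact S) : ℕ∞ :=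
  if h : ∃ n, Dv Me 𝓡 F n then (Nat.find h : ℕ∞) else ⊤

variable {Me : Set (Pat S)} {𝓡 : Set (Clause S)}

theorem cost_le_of_dv {F : PFact S} {n : ℕ} (h : Dv Me 𝓡 F n) : cost Me 𝓡 F ≤ n := by
  classical
  rw [cost, dif_pos ⟨n, h⟩]
  exact_mod_cast Nat.find_min' _ h

theorem exists_dv {F : PFact S} (h : cost Me 𝓡 F ≠ ⊤) :
    ∃ n : ℕ, Dv Me 𝓡 F n ∧ cost Me 𝓡 F = n := by
  classical
  rw [cost] at h ⊢
  split_ifs at h ⊢ with hh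
  · exact ⟨_, Nat.find_spec hh, rfl⟩
  · exact absurd rfl h

theorem dv_toNat {F : PFact S} (h : cost Me 𝓡 F ≠ ⊤) : Dv Me 𝓡 F (cost Me 𝓡 F).toNat := by
  obtain ⟨n, hn, he⟩ := exists_dv h
  rwa [he, ENat.toNat_natCast]

theorem cost_mevent {p : Pat S} (hp : p ∈ Me) : cost Me 𝓡 (.mevent p) ≠ ⊤ :=
  ne_top_of_le_ne_top (ENat.natCast_ne_top 0) (cost_le_of_dv (.me p hp 0))

theorem dataAdditive_cost (Me : Set (Pat S)) (𝓡 : Set (Clause S)) :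
    DataAdditive (cost Me 𝓡) := by
  intro f hf ps
  apply le_antisymm
  · by_cases h : ∀ k, cost Me 𝓡 (.attacker (ps k)) ≠ ⊤
    · refine (cost_le_of_dv (.comp f hf ps _ (fun k => dv_toNat (h k)) _ le_rfl)).trans ?_
      push_cast
      gcongr with k
      rw [ENat.natCast_toNat (h k)]
    · push Not at h
      obtain ⟨k, hk⟩ := h
      have : (⊤ : ℕ∞) ≤ ∑ k, cost Me 𝓡 (.attacker (ps k)) := hk ▸
        Finset.single_le_sum (f := fun k => cost Me 𝓡 (.attacker (ps k)))
          (fun _ _ => zero_le) (Finset.mem_univ k)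
      rw [top_le_iff.1 this]
      simp
  · by_cases h : cost Me 𝓡 (.attacker (.con f ps)) = ⊤
    · rw [h]; exact le_top
    · obtain ⟨n, hn, he⟩ := exists_dv h
      rw [he]
      cases hn with
      | comp f hf ps w h n hn =>
        calc 1 + ∑ k, cost Me 𝓡 (.attacker (ps k)) ≤ 1 + ∑ k, (w k : ℕ∞) := by
              gcongr with k
              exact cost_le_of_dv (h k)
          _ = ((1 + ∑ k, w k : ℕ) : ℕ∞) := by push_cast; rfl
          _ ≤ n := by exact_mod_cast hn
      | node R hR σ d F hp hF => exact absurd ⟨f, hf, ps, rfl⟩ hF.1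

theorem cost_node {R : Clause S} (hR : R ∈ 𝓡) {σ : Subst S} {d : ℕ} {F : PFact S}
    (hp : FPath d (R.concl.subst σ) F) (hF : F.Final) :
    cost Me 𝓡 F ≤ ((R.hyp.map (PFact.subst σ)).map (cost Me 𝓡)).sum + d + 1 := by
  by_cases h : ∀ G ∈ R.hyp.map (PFact.subst σ), cost Me 𝓡 G ≠ ⊤
  · refine (cost_le_of_dv (.node R hR σ d F hp hF (fun G => (cost Me 𝓡 G).toNat)
      (fun G hG => dv_toNat (h G hG)) _ le_rfl)).trans ?_
    push_cast
    rw [Multiset.map_map Nat.cast]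
    gcongr
    exact le_of_eq (congrArg _ (Multiset.map_congr rfl fun G hG => ENat.natCast_toNat (h G hG)))
  · push Not at h
    obtain ⟨G, hG, ht⟩ := h
    have := weight_le_sum hG (cost Me 𝓡)
    rw [ht, top_le_iff] at this
    rw [this]
    simp

/-- The last step of a cheapest derivation of a final fact. -/
theorem exists_node_of_cost_ne_top {F : PFact S} (hF : F.Final) (h : cost Me 𝓡 F ≠ ⊤) :
    ∃ R ∈ 𝓡, ∃ (σ : Subst S) (d : ℕ), FPath d (R.concl.subst σ) F ∧
      ((R.hyp.map (PFact.subst σ)).map (cost Me 𝓡)).sum + d + 1 ≤ cost Me 𝓡 F := by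
  obtain ⟨n, hn, he⟩ := exists_dv h
  cases hn with
  | me p hp => exact absurd rfl (hF.2 p)
  | comp f hf ps => exact absurd ⟨f, hf, ps, rfl⟩ hF.1
  | node R hR σ d F hp hF' w h n hn =>
    refine ⟨R, hR, σ, d, hp, ?_⟩
    rw [he]
    refine le_trans ?_ (Nat.cast_le.2 hn)
    push_cast
    rw [Multiset.map_map Nat.cast]
    gcongr
    exact Multiset.sum_map_le_sum_map _ _ fun G hG => cost_le_of_dv (h G hG)

theorem mem_of_cost_mevent_ne_top {p : Pat S} (h : cost Me 𝓡 (.mevent p) ≠ ⊤) : p ∈ Me := by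
  obtain ⟨n, hn, _⟩ := exists_dv h
  cases hn with
  | me p hp => exact hp
  | node R hR σ d F hp hF' => exact absurd rfl (hF'.2 p)

/-- A fact is derivable as soon as all final facts that it contains are. -/
theorem cost_ne_top_of_paths {F : PFact S} (hF : ∀ p, F ≠ .mevent p)
    (h : ∀ d F', FPath d F F' → F'.Final → cost Me 𝓡 F' ≠ ⊤) : cost Me 𝓡 F ≠ ⊤ := by
  by_cases ht : F.DataTop
  · obtain ⟨f, hf, ps, rfl⟩ := ht
    clear hF
    generalize hp : Pat.con f ps = p at h
    clear hp
    induction p with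
    | var x => exact h 0 _ (.refl _) ⟨by rintro ⟨f, _, ps, hh⟩; simp at hh, by simp⟩
    | name a n ps ss => exact h 0 _ (.refl _) ⟨by rintro ⟨f, _, ps, hh⟩; simp at hh, by simp⟩
    | con g qs ih =>
      by_cases hg : g ∈ S.dataCon
      · rw [dataAdditive_cost Me 𝓡 g hg]
        refine WithTop.add_ne_top.2 ⟨ENat.natCast_ne_top 1, ?_⟩
        refine Finset.sum_induction _ (· ≠ ⊤) (fun a b ha hb => WithTop.add_ne_top.2 ⟨ha, hb⟩)
          (ENat.natCast_ne_top 0) fun k _ => ?_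
        exact ih k fun d F' hp => h _ F' (.step d g hg qs k F' hp)
      · refine h 0 _ (.refl _) ⟨?_, by simp⟩
        rintro ⟨f', hf', ps', hh⟩
        simp only [PFact.attacker.injEq, Pat.con.injEq] at hh
        exact hg (hh.1 ▸ hf')
  · exact h 0 F (.refl F) ⟨ht, hF⟩

/-! ### Covering of a clause by a set of clauses -/

/-- `B` is an instance of a fact of `Fnot`. -/
def NotInst (Fnot : Set (PFact S)) (B : PFact S) : Prop := ∃ G ∈ Fnot, ∃ σ : Subst S, B = G.subst σ

theorem NotInst.subst {Fnot : Set (PFact S)} {B : PFact S} (h : NotInst Fnot B) (θ : Subst S) :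
    NotInst Fnot (B.subst θ) := by
  obtain ⟨G, hG, σ, rfl⟩ := h
  exact ⟨G, hG, σ.comp θ, PFact.subst_subst _ _ _⟩

/-- The set `𝓡` makes the clause `R` superfluous: every use of an instance of `R` to obtain a final
fact `F` can be replaced with a use of a clause of `𝓡` that is not more expensive, unless `F` is
already obtained from the hypotheses, or the hypotheses yield an instance of a fact of `Fnot`. -/
def Covered (Fnot : Set (PFact S)) (R : Clause S) (𝓡 : Set (Clause S)) : Prop :=
  ∀ (σ : Subst S) (d : ℕ) (F : PFact S), FPath d (R.concl.subst σ) F → F.Final →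
    (∃ R' ∈ 𝓡, ∃ (σ' : Subst S) (d' : ℕ), d' ≤ d ∧ FPath d' (R'.concl.subst σ') F ∧
      Dominated (R'.hyp.map (PFact.subst σ')) (R.hyp.map (PFact.subst σ))) ∨
    Dominated {F} (R.hyp.map (PFact.subst σ)) ∨
    ∃ B, NotInst Fnot B ∧ Dominated {B} (R.hyp.map (PFact.subst σ))

variable {Fnot : Set (PFact S)}

theorem Covered.trans {R : Clause S} {𝓡 𝓡' : Set (Clause S)} (h : Covered Fnot R 𝓡)
    (h' : ∀ R' ∈ 𝓡, Covered Fnot R' 𝓡') : Covered Fnot R 𝓡' := by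
  intro σ d F hp hF
  obtain ⟨R', hR', σ', d', hd', hp', hdom⟩ | h₂ | h₃ := h σ d F hp hF
  · obtain ⟨R'', hR'', σ'', d'', hd'', hp'', hdom'⟩ | h₂ | ⟨B, hB, hB'⟩ := h' R' hR' σ' d' F hp' hF
    · exact Or.inl ⟨R'', hR'', σ'', d'', hd''.trans hd', hp'', hdom'.trans hdom⟩
    · exact Or.inr (Or.inl (h₂.trans hdom))
    · exact Or.inr (Or.inr ⟨B, hB, hB'.trans hdom⟩)
  · exact Or.inr (Or.inl h₂)
  · exact Or.inr (Or.inr h₃)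

theorem Covered.of_subsumes {R R' : Clause S} {𝓡 : Set (Clause S)} (hR' : R' ∈ 𝓡)
    (h : Subsumes R' R) : Covered Fnot R 𝓡 := by
  obtain ⟨τ, hc, hh⟩ := h
  intro σ d F hp hF
  refine Or.inl ⟨R', hR', τ.comp σ, d, le_rfl, ?_, ?_⟩
  · rwa [← PFact.subst_subst, hc]
  · rw [← map_subst_subst]
    exact Dominated.of_le (Multiset.map_le_map hh)

/-! ### Soundness of the simplifications -/

theorem RedundantStep.concl_hyp {R R' : Clause S} (h : RedundantStep R R') :
    R'.concl = R.concl ∧ R'.hyp ≤ R.hyp := by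
  obtain ⟨H, H', C, σ, rfl, rfl, -⟩ := h
  exact ⟨rfl, Multiset.le_add_left _ _⟩

theorem IsElimRedundantHyp.concl_hyp {e : Clause S → Clause S} (he : IsElimRedundantHyp e)
    (R : Clause S) : (e R).concl = R.concl ∧ (e R).hyp ≤ R.hyp := by
  have := he R
  generalize e R = R' at this
  induction this with
  | refl => exact ⟨rfl, le_rfl⟩
  | tail _ h ih => exact ⟨h.concl_hyp.1.trans ih.1, h.concl_hyp.2.trans ih.2⟩

theorem elimdup_hyp_le (R : Clause S) : (elimdup R).hyp ≤ R.hyp := by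
  classical
  unfold elimdup
  convert Multiset.dedup_le R.hyp

theorem elimattx_hyp_le (R : Clause S) : (elimattx R).hyp ≤ R.hyp := by
  classical
  exact Multiset.filter_le _ _

theorem covered_of_simplify {R : Clause S} {Rs : Set (Clause S)} (h : Simplify Fnot R Rs) :
    Covered Fnot R Rs := by
  classical
  obtain ⟨e, he, rfl⟩ := h
  intro σ d F hp hF
  obtain ⟨R₁, hR₁, d', hd', hp', hdom⟩ : ∃ R₁ ∈ decomp R, ∃ d' ≤ d,
      FPath d' (R₁.concl.subst σ) F ∧
      Dominated (R₁.hyp.map (PFact.subst σ)) (R.hyp.map (PFact.subst σ)) := by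
    unfold decomp
    split_ifs with hd
    · exact ⟨R, rfl, d, le_rfl, hp, Dominated.of_le le_rfl⟩
    · obtain ⟨C', hC', d', hd', hp'⟩ := hp.exists_part hF
      exact ⟨_, ⟨C', hC', rfl⟩, d', hd', hp', Dominated.bind_parts σ _⟩
  obtain ⟨hc, hh⟩ := he.concl_hyp (elimdup R₁)
  have hmem : e (elimdup R₁) ∈ e '' (elimdup '' decomp R) := ⟨_, ⟨_, hR₁, rfl⟩, rfl⟩
  replace hc : (e (elimdup R₁)).concl = R₁.concl := hc
  replace hh := hh.trans (elimdup_hyp_le R₁)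
  generalize e (elimdup R₁) = R₂ at hc hh hmem
  have hle : Dominated (R₂.hyp.map (PFact.subst σ)) (R.hyp.map (PFact.subst σ)) :=
    (Dominated.of_le (Multiset.map_le_map hh)).trans hdom
  have hsingle : ∀ G ∈ R₂.hyp, Dominated {G.subst σ} (R.hyp.map (PFact.subst σ)) := fun G hG =>
    (Dominated.of_le (Multiset.singleton_le.2 (Multiset.mem_map_of_mem _ hG))).trans hle
  by_cases hnot : ∃ F ∈ R₂.hyp, ∃ G ∈ Fnot, ∃ σ : Subst S, F = G.subst σ
  · obtain ⟨B, hB, hB'⟩ := hnot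
    exact Or.inr (Or.inr ⟨_, NotInst.subst hB' σ, hsingle B hB⟩)
  by_cases htaut : R₂.concl ∈ R₂.hyp
  · refine Or.inr (Or.inl (Dominated.trans ?_ (hsingle _ htaut)))
    intro w hw
    rw [← hc] at hp'
    simpa using hp'.weight_le' hw
  refine Or.inl ⟨elimattx R₂, ⟨R₂, ⟨⟨hmem, hnot⟩, htaut⟩, rfl⟩, σ, d', hd', ?_, ?_⟩
  · change FPath d' (R₂.concl.subst σ) F
    rwa [hc]
  · exact (Dominated.of_le (Multiset.map_le_map (elimattx_hyp_le R₂))).trans hle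

/-! ### Data clauses and the shape of simplified clauses -/

theorem mem_clauseRf_hyp {f : S.Con} {x : Fin (S.arity f) → Var} {F : PFact S} :
    F ∈ (clauseRf f x).hyp ↔ ∃ k, .attacker (.var (x k)) = F := by
  simp [clauseRf]

theorem Clause.IsData.nodup {R : Clause S} (h : R.IsData) : R.hyp.Nodup := by
  obtain ⟨f, hf, x, hx, rfl | ⟨i, rfl⟩⟩ := h
  · refine Multiset.Nodup.map (fun k l hkl => hx ?_) Finset.univ.nodup
    simpa using hkl
  · exact Multiset.nodup_singleton _

theorem Clause.IsData.concl_notMem {R : Clause S} (h : R.IsData) : R.concl ∉ R.hyp := by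
  obtain ⟨f, hf, x, hx, rfl | ⟨i, rfl⟩⟩ := h
  · intro h
    obtain ⟨k, hk⟩ := mem_clauseRf_hyp.1 h
    simp [clauseRf] at hk
  · simp

theorem Clause.IsData.redundantStep {R R' : Clause S} (h : R.IsData) (hs : RedundantStep R R') :
    R' = R := by
  obtain ⟨H, H', C, σ, rfl, rfl, h₁, h₂, h₃⟩ := hs
  have hnd := h.nodup
  suffices H = 0 by simp [this]
  by_contra hne
  obtain ⟨F, hF⟩ := Multiset.exists_mem_of_ne_zero hne
  have hFnot : F.subst σ ≠ F := by
    intro hh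
    exact Multiset.disjoint_left.1 (Multiset.nodup_add.1 hnd).2.2 hF (hh ▸ h₁ F hF)
  obtain ⟨f, hf, x, hx, hR | ⟨i, hR⟩⟩ := h
  · simp only [clauseRf, Clause.mk.injEq] at hR
    obtain ⟨hH, hC⟩ := hR
    have hF' : F ∈ H + H' := Multiset.mem_add.2 (Or.inl hF)
    rw [hH] at hF'
    obtain ⟨k, _, rfl⟩ := Multiset.mem_map.1 hF'
    apply hFnot
    rw [hC] at h₃
    simp only [PFact.subst, Pat.subst, PFact.attacker.injEq, Pat.con.injEq, heq_eq_eq,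
      true_and] at h₃ ⊢
    exact congrFun h₃ k
  · simp only [Clause.mk.injEq] at hR
    have := h₁ F hF
    have hc := congrArg Multiset.card hR.1
    rw [Multiset.card_add, Multiset.card_singleton] at hc
    have h1 := Multiset.card_pos_iff_exists_mem.2 ⟨_, hF⟩
    have h2 := Multiset.card_pos_iff_exists_mem.2 ⟨_, this⟩
    omega

theorem Clause.IsData.elimRedundantHyp {R : Clause S} (h : R.IsData) {e : Clause S → Clause S}
    (he : IsElimRedundantHyp e) : e R = R := by
  have := he R
  generalize e R = R' at this
  induction this with
  | refl => rfl
  | tail _ hs ih => subst ih; exact h.redundantStep hs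

theorem Clause.IsData.elimdup {R : Clause S} (h : R.IsData) : elimdup R = R := by
  classical
  unfold HornProtocol.elimdup
  congr 1
  convert Multiset.dedup_eq_self.2 h.nodup

theorem Clause.IsData.elimattx {R : Clause S} (h : R.IsData) : elimattx R = R := by
  classical
  unfold HornProtocol.elimattx
  congr 1
  refine Multiset.filter_eq_self.2 ?_
  rintro F hF ⟨y, rfl, hy, -⟩
  obtain ⟨f, hf, x, hx, rfl | ⟨i, rfl⟩⟩ := h
  · obtain ⟨k, hk⟩ := mem_clauseRf_hyp.1 hF
    simp only [PFact.attacker.injEq, Pat.var.injEq] at hk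
    exact hy (Set.mem_iUnion.2 ⟨k, hk.symm⟩)
  · simp at hF

/-- The shape of the clauses produced by simplification that the correctness of the resolution
steps relies on. -/
structure Normal (R : Clause S) : Prop where
  decomposed : R.IsData ∨ (¬ R.concl.DataTop ∧ ∀ F ∈ R.hyp, ¬ F.DataTop)
  ne_attx : ∀ y z, R ≠ ⟨{.attacker (.var z)}, .attacker (.var y)⟩

theorem normal_of_simplify {R : Clause S} {Rs : Set (Clause S)} (h : Simplify Fnot R Rs) :
    ∀ R' ∈ Rs, Normal R' := by
  classical
  obtain ⟨e, he, rfl⟩ := h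
  rintro _ ⟨R₂, ⟨⟨⟨_, ⟨R₁, hR₁, rfl⟩, rfl⟩, hnot⟩, htaut⟩, rfl⟩
  have htaut' : (elimattx (e (elimdup R₁))).concl ∉ (elimattx (e (elimdup R₁))).hyp :=
    fun hm => htaut (Multiset.mem_of_le (elimattx_hyp_le _) hm)
  refine ⟨?_, ?_⟩
  · unfold decomp at hR₁
    split_ifs at hR₁ with hd
    · rw [Set.mem_singleton_iff] at hR₁
      subst hR₁
      rw [hd.elimdup, hd.elimRedundantHyp he, hd.elimattx]
      exact Or.inl hd
    · obtain ⟨C, hC, rfl⟩ := hR₁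
      refine Or.inr ⟨?_, fun F hF => ?_⟩
      · change ¬ (e _).concl.DataTop
        rw [(he.concl_hyp _).1]
        exact PFact.not_dataTop_of_mem_parts hC
      · have := Multiset.mem_of_le ((elimattx_hyp_le _).trans
          ((he.concl_hyp _).2.trans (elimdup_hyp_le _))) hF
        obtain ⟨G, _, hG⟩ := Multiset.mem_bind.1 this
        exact PFact.not_dataTop_of_mem_parts hG
  · intro y z heq
    generalize e (elimdup R₁) = R₂ at *
    have hyz : y ≠ z := by
      rintro rfl
      rw [heq] at htaut'
      simp at htaut'
    have hc : R₂.concl = .attacker (.var y) := congrArg Clause.concl heq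
    have hh : R₂.hyp.filter (fun F => ¬ IsUselessAttx R₂ F) = {.attacker (.var z)} := by
      have := congrArg Clause.hyp heq
      unfold elimattx at this
      convert this
    have hz : PFact.attacker (.var z) ∈ R₂.hyp.filter (fun F => ¬ IsUselessAttx R₂ F) := by
      rw [hh]; simp
    obtain ⟨hz₁, hz₂⟩ := Multiset.mem_filter.1 hz
    apply hz₂
    refine ⟨z, rfl, ?_, ?_⟩
    · rw [hc]
      exact fun h => hyz h.symm
    -- Another occurrence of `z` would have to be in a useless hypothesis, hence in a second copy
    -- of `attacker(z)`, which would make neither copy useless.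
    · intro G hG hzG
      by_cases hu : IsUselessAttx R₂ G
      · obtain ⟨x, rfl, hx₁, hx₂⟩ := hu
        have hxz : z = x := hzG
        subst hxz
        exact hx₂ (.attacker (.var z)) (by convert hG) rfl
      · have : G ∈ R₂.hyp.filter (fun F => ¬ IsUselessAttx R₂ F) :=
          Multiset.mem_filter.2 ⟨Multiset.mem_of_mem_erase hG, hu⟩
        rw [hh, Multiset.mem_singleton] at this
        subst this
        have h2 : 2 ≤ R₂.hyp.count (.attacker (.var z)) := by
          have := Multiset.count_pos.2 hG
          rw [Multiset.count_erase_self] at this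
          omega
        have h1 := congrArg (Multiset.count (.attacker (.var z))) hh
        rw [Multiset.count_filter_of_pos (p := fun F => ¬ IsUselessAttx R₂ F) hu,
          Multiset.count_singleton_self] at h1
        omega

theorem mem_of_simplify_isData {R : Clause S} {Rs : Set (Clause S)} (h : Simplify Fnot R Rs)
    (hR : R.IsData) (hnot : ∀ F ∈ R.hyp, ¬ NotInst Fnot F) : R ∈ Rs := by
  obtain ⟨e, he, rfl⟩ := h
  refine ⟨R, ⟨⟨⟨R, ⟨R, ?_, hR.elimdup⟩, hR.elimRedundantHyp he⟩, ?_⟩, hR.concl_notMem⟩,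
    hR.elimattx⟩
  · unfold decomp
    rw [if_pos hR]
    rfl
  · rintro ⟨F, hF, hG⟩
    exact hnot F hF hG

/-! ### Saturated sets of clauses -/

/-- The properties of a fixpoint `𝓡` of the saturation of the set `R₀` on which the
correctness of resolution rests. -/
structure Saturated (sf : SelFun S) (Fnot : Set (PFact S)) (R₀ 𝓡 : Set (Clause S)) : Prop where
  covered : ∀ R ∈ R₀, Covered Fnot R 𝓡
  normal : ∀ R ∈ 𝓡, Normal R
  data : ∀ R ∈ R₀, R.IsData → (∀ F ∈ R.hyp, ¬ NotInst Fnot F) → ∃ R' ∈ 𝓡, Subsumes R' R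
  resolve : ∀ C ∈ 𝓡, sf.sel C = ∅ → ∀ C' ∈ 𝓡, ∀ F₀ ∈ sf.sel C', Unifiable C.concl F₀ →
    ∃ C'', Resolvent C F₀ C' C'' ∧ Covered Fnot C'' 𝓡

theorem Elim.subsumed {Rs 𝓡 𝓡' : Set (Clause S)} (h : Elim (Rs ∪ 𝓡) 𝓡') {R : Clause S}
    (hR : ∃ R' ∈ Rs ∪ 𝓡, Subsumes R' R) : ∃ R' ∈ 𝓡', Subsumes R' R := by
  obtain ⟨R', hR', hs⟩ := hR
  obtain ⟨R'', hR'', hs'⟩ := h.2.1 R' hR'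
  exact ⟨R'', hR'', hs'.trans hs⟩

theorem AddClause.subsumed {C R : Clause S} {𝓡 𝓡' : Set (Clause S)} (h : AddClause Fnot C 𝓡 𝓡')
    (hR : ∃ R' ∈ 𝓡, Subsumes R' R) : ∃ R' ∈ 𝓡', Subsumes R' R := by
  obtain ⟨Cs, _, he⟩ := h
  obtain ⟨R', hR', hs⟩ := hR
  exact he.subsumed ⟨R', Or.inr hR', hs⟩

theorem AddClause.covered {C : Clause S} {𝓡 𝓡' : Set (Clause S)} (h : AddClause Fnot C 𝓡 𝓡') :
    Covered Fnot C 𝓡' := by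
  obtain ⟨Cs, hs, he⟩ := h
  refine (covered_of_simplify hs).trans fun R hR => ?_
  obtain ⟨R', hR', hs'⟩ := he.subsumed ⟨R, Or.inl hR, Subsumes.refl R⟩
  exact Covered.of_subsumes hR' hs'

theorem AddClause.covered_mono {C R : Clause S} {𝓡 𝓡' : Set (Clause S)}
    (h : AddClause Fnot C 𝓡 𝓡') (hR : Covered Fnot R 𝓡) : Covered Fnot R 𝓡' := by
  refine hR.trans fun R hR => ?_
  obtain ⟨R', hR', hs'⟩ := h.subsumed ⟨R, hR, Subsumes.refl R⟩
  exact Covered.of_subsumes hR' hs'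

theorem AddClause.normal {C : Clause S} {𝓡 𝓡' : Set (Clause S)} (h : AddClause Fnot C 𝓡 𝓡')
    (hn : ∀ R ∈ 𝓡, Normal R) : ∀ R ∈ 𝓡', Normal R := by
  obtain ⟨Cs, hs, he⟩ := h
  intro R hR
  obtain h | h := he.1 hR
  · exact normal_of_simplify hs R h
  · exact hn R h

theorem AddClause.data {C : Clause S} {𝓡 𝓡' : Set (Clause S)} (h : AddClause Fnot C 𝓡 𝓡')
    (hC : C.IsData) (hnot : ∀ F ∈ C.hyp, ¬ NotInst Fnot F) : ∃ R' ∈ 𝓡', Subsumes R' C := by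
  obtain ⟨Cs, hs, he⟩ := h
  exact he.subsumed ⟨C, Or.inl (mem_of_simplify_isData hs hC hnot), Subsumes.refl C⟩

theorem AddList.spec {l : List (Clause S)} {𝓡 𝓡' : Set (Clause S)} (h : AddList Fnot l 𝓡 𝓡')
    (hn : ∀ R ∈ 𝓡, Normal R) :
    (∀ R ∈ 𝓡', Normal R) ∧ (∀ R, Covered Fnot R 𝓡 → Covered Fnot R 𝓡') ∧
      (∀ R, (∃ R' ∈ 𝓡, Subsumes R' R) → ∃ R' ∈ 𝓡', Subsumes R' R) ∧
      (∀ R ∈ l, Covered Fnot R 𝓡') ∧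
      ∀ R ∈ l, R.IsData → (∀ F ∈ R.hyp, ¬ NotInst Fnot F) → ∃ R' ∈ 𝓡', Subsumes R' R := by
  induction h with
  | nil => exact ⟨hn, fun _ h => h, fun _ h => h, by simp, by simp⟩
  | cons C l 𝓡 𝓡' 𝓡'' h hl ih =>
    obtain ⟨h₁, h₂, h₃, h₄, h₅⟩ := ih (h.normal hn)
    refine ⟨h₁, fun R hR => h₂ R (h.covered_mono hR), fun R hR => h₃ R (h.subsumed hR), ?_, ?_⟩
    · intro R hR
      rcases List.mem_cons.1 hR with rfl | hR
      · exact h₂ _ h.covered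
      · exact h₄ R hR
    · intro R hR hd hnot
      rcases List.mem_cons.1 hR with rfl | hR
      · exact h₃ _ (h.data hd hnot)
      · exact h₅ R hR hd hnot

theorem Saturate.exists_saturated {sf : SelFun S} {R₀ R₁ : Set (Clause S)}
    (h : Saturate sf Fnot R₀ R₁) :
    ∃ 𝓡, Saturated sf Fnot R₀ 𝓡 ∧ R₁ = {C ∈ 𝓡 | sf.sel C = ∅} := by
  obtain ⟨l, 𝓡, 𝓡', hl, hadd, hstar, hfix, rfl⟩ := h
  obtain ⟨h₁, -, -, h₄, h₅⟩ := hadd.spec (by simp)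
  suffices hs : (∀ R ∈ 𝓡', Normal R) ∧ (∀ R ∈ l, Covered Fnot R 𝓡') ∧
      ∀ R ∈ l, R.IsData → (∀ F ∈ R.hyp, ¬ NotInst Fnot F) → ∃ R' ∈ 𝓡', Subsumes R' R by
    obtain ⟨h₁, h₄, h₅⟩ := hs
    refine ⟨𝓡', ⟨fun R hR => h₄ R ((hl R).2 hR), h₁, fun R hR => h₅ R ((hl R).2 hR), ?_⟩, rfl⟩
    intro C hC hsel C' hC' F₀ hF₀ hu
    obtain ⟨C'', hr, ha⟩ := hfix C hC hsel C' hC' F₀ hF₀ hu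
    exact ⟨C'', hr, ha.covered⟩
  clear hfix
  induction hstar with
  | refl => exact ⟨h₁, h₄, h₅⟩
  | tail _ hstep ih =>
    obtain ⟨h₁, h₄, h₅⟩ := ih
    obtain ⟨C, hC, _, C', hC', F₀, hF₀, C'', hr, ha⟩ := hstep
    exact ⟨ha.normal h₁, fun R hR => ha.covered_mono (h₄ R hR),
      fun R hR hd hnot => ha.subsumed (h₅ R hR hd hnot)⟩

/-! ### Resolution steps on derivations -/

theorem PFact.Unselectable.of_subst {F : PFact S} {σ : Subst S} (h : (F.subst σ).Unselectable) :
    F.Unselectable := by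
  obtain ⟨x, hx⟩ | ⟨p, hp⟩ := h
  · cases F with
    | attacker p =>
      cases p with
      | var y => exact Or.inl ⟨y, rfl⟩
      | _ => simp [PFact.subst, Pat.subst] at hx
    | _ => simp [PFact.subst] at hx
  · cases F with
    | mevent q => exact Or.inr ⟨q, rfl⟩
    | _ => simp [PFact.subst] at hp

theorem PFact.Unselectable.parts {F : PFact S} (h : F.Unselectable) : F.parts = {F} := by
  obtain ⟨x, rfl⟩ | ⟨p, rfl⟩ := h <;> simp [PFact.parts, Pat.parts]

/-- A variable fact that is the conclusion of an unselected clause comes with unselectable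
hypotheses only. -/
theorem unselectable_of_sel_eq_empty {sf : SelFun S} {R : Clause S} (hsel : sf.sel R = ∅) {y : Var}
    (hc : R.concl = .attacker (.var y)) : ∀ F ∈ R.hyp, F.Unselectable := by
  by_contra! h
  refine sf.sel_attacker_var R.hyp y h ?_
  rw [← hc]
  exact hsel

/-- The instance of a resolvent given by unifying instances of the two clauses: in the hypotheses
of the instance of `R'`, the selected fact is replaced with the hypotheses of the instance of
`R`. -/
theorem Resolvent.exists_instance {R R' R'' : Clause S} {F₀ : PFact S}
    (h : Resolvent R F₀ R' R'') {τ₁ τ₂ : Subst S} (hτ : R.concl.subst τ₁ = F₀.subst τ₂) :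
    ∃ (θ : Subst S) (A : Multiset (PFact S)), R''.concl.subst θ = R'.concl.subst τ₂ ∧
      F₀.subst τ₂ ::ₘ A = R'.hyp.map (PFact.subst τ₂) ∧
      R''.hyp.map (PFact.subst θ) = R.hyp.map (PFact.subst τ₁) + A := by
  classical
  obtain ⟨hF₀, σ₁, σ₂, -, hmg, rfl⟩ := h
  obtain ⟨θ, h₁, h₂⟩ := hmg τ₁ τ₂ hτ
  refine ⟨θ, ((R'.hyp.erase F₀).map (PFact.subst τ₂)), h₂ _ (by simp), ?_, ?_⟩
  · rw [← Multiset.map_cons, Multiset.cons_erase hF₀]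
  · rw [Multiset.map_add, Multiset.map_map, Multiset.map_map]
    congr 1
    · exact Multiset.map_congr rfl fun F hF => h₁ F (by simp [hF])
    · exact Multiset.map_congr (by congr!) fun F hF =>
        h₂ F (by simp [Multiset.mem_of_mem_erase hF])

/-! ### Consequences of the successful checks on `Fnot` -/

variable {sf : SelFun S} {Fnot : Set (PFact S)} {R₁ : Set (Clause S)}

theorem not_unselectable_of_derivable_empty {G : PFact S} (h : Derivable sf Fnot G R₁ ∅) :
    ¬ G.Unselectable := by
  intro hG
  have hsel : sf.sel ⟨{G}, G⟩ = ∅ := by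
    by_contra hne
    obtain ⟨F, hF⟩ := Set.nonempty_iff_ne_empty.2 hne
    have := sf.sel_subset _ F hF
    rw [Multiset.mem_singleton] at this
    exact sf.sel_selectable _ F hF (this ▸ hG)
  unfold Derivable at h
  obtain ⟨out, ho, h⟩ : ∃ out, out = ∅ ∧ Deriv sf Fnot R₁ ⟨{G}, G⟩ ∅ out := ⟨_, rfl, h⟩
  cases h with
  | cycle _ _ h => obtain ⟨C', hC', _⟩ := h; exact hC'
  | leaf => exact Set.singleton_ne_empty _ ho
  | node _ _ h hs => exact hs hsel

theorem not_notInst_of_unselectable (hF : ∀ G ∈ Fnot, Derivable sf Fnot G R₁ ∅) {B : PFact S}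
    (hB : B.Unselectable) : ¬ NotInst Fnot B := by
  rintro ⟨G, hG, σ, rfl⟩
  exact not_unselectable_of_derivable_empty (hF G hG) hB.of_subst

/-- If a clause of `R₁` concludes `attacker(y)`, then resolving it with the query for a fact
`attacker(p)` yields a clause without selectable hypotheses. Hence no such fact can be in `Fnot`. -/
theorem attacker_notMem_of_var_concl (hF : ∀ G ∈ Fnot, Derivable sf Fnot G R₁ ∅) {R : Clause S}
    (hR : R ∈ R₁) (hsel : sf.sel R = ∅) {y : Var} (hc : R.concl = .attacker (.var y))
    (hy : .attacker (.var y) ∉ R.hyp) (p : Pat S) : .attacker p ∉ Fnot := by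
  classical
  intro hp
  have hns := not_unselectable_of_derivable_empty (hF _ hp)
  have hder := hF _ hp
  have hunif : R.concl.subst ⟨Function.update .var y p, .var⟩ =
      (PFact.attacker p).subst Subst.id := by
    rw [hc]
    simp [PFact.subst, Pat.subst, Pat.subst_id]
  obtain ⟨out, ho, hder⟩ : ∃ out, out = ∅ ∧
      Deriv sf Fnot R₁ ⟨{PFact.attacker p}, .attacker p⟩ ∅ out := ⟨∅, rfl, hder⟩
  cases hder with
  | cycle _ _ h => obtain ⟨C', hC', _⟩ := h; exact hC'
  | leaf => exact Set.singleton_ne_empty _ ho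
  | node _ _ h hs res simp out' hres hsimp hout =>
    obtain ⟨F₀, hF₀⟩ := Set.nonempty_iff_ne_empty.2 hs
    have := sf.sel_subset _ _ hF₀
    rw [Multiset.mem_singleton] at this
    subst this
    have hu : Unifiable R.concl (.attacker p) := ⟨_, _, hunif⟩
    have hres' := hres R hR _ hF₀ hu
    have hunsel : ∀ F ∈ (res R (.attacker p)).hyp, F.Unselectable := by
      obtain ⟨-, σ₁, σ₂, -, hmg, he⟩ := hres'
      obtain ⟨θ, h₁, -⟩ := hmg _ _ hunif
      rw [he]
      intro F hF
      obtain hF | hF := Multiset.mem_add.1 hF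
      · obtain ⟨G, hG, rfl⟩ := Multiset.mem_map.1 hF
        have h₁ := h₁ G (by simp [hG])
        obtain ⟨z, rfl⟩ | ⟨q, rfl⟩ := unselectable_of_sel_eq_empty hsel hc G hG
        · have hzy : z ≠ y := fun h => hy (h ▸ hG)
          apply PFact.Unselectable.of_subst (σ := θ)
          rw [h₁]
          exact Or.inl ⟨z, by simp [PFact.subst, Pat.subst, hzy]⟩
        · exact Or.inr ⟨_, rfl⟩
      · have hem : ∀ (inst : DecidableEq (PFact S)) (G : PFact S),
            (({G} : Multiset (PFact S)).erase G) = 0 := by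
          intro _ G
          exact Multiset.erase_cons_head (s := 0) G
        rw [hem] at hF
        simp at hF
    obtain ⟨e, he, hsim⟩ := hsimp R hR _ hF₀ hu
    set C₁ := e (elimdup (decomphyp (res R (.attacker p)))) with hC₁
    have hunsel₁ : ∀ F ∈ C₁.hyp, F.Unselectable := by
      intro F hF
      have hF := Multiset.mem_of_le ((he.concl_hyp _).2.trans (elimdup_hyp_le _)) hF
      unfold decomphyp at hF
      split_ifs at hF
      · exact hunsel F hF
      · obtain ⟨G, hG, hFG⟩ := Multiset.mem_bind.1 hF
        rw [(hunsel G hG).parts, Multiset.mem_singleton] at hFG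
        exact hFG ▸ hunsel G hG
    have hunsel₂ : ∀ F ∈ (elimattx C₁).hyp, F.Unselectable := fun F hF =>
      hunsel₁ F (Multiset.mem_of_le (elimattx_hyp_le _) hF)
    have hmem : elimattx C₁ ∈ simp R (.attacker p) := by
      rw [hsim]
      exact ⟨C₁, ⟨rfl, fun ⟨F, hF', hG⟩ =>
        not_notInst_of_unselectable hF (hunsel₁ F hF') hG⟩, rfl⟩
    have hempty : ∀ D, D ∉ out' R (.attacker p) (elimattx C₁) := by
      intro D hD
      have : D ∈ (∅ : Set (Clause S)) := ho ▸ ⟨R, hR, _, hF₀, hu, _, hmem, hD⟩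
      exact this
    have hsel' : sf.sel (elimattx C₁) = ∅ := by
      by_contra hne
      obtain ⟨F, hF⟩ := Set.nonempty_iff_ne_empty.2 hne
      exact sf.sel_selectable _ F hF (hunsel₂ F (sf.sel_subset _ F hF))
    have hd := hout R hR _ hF₀ hu _ hmem
    generalize out' R (.attacker p) (elimattx C₁) = o at hd hempty
    cases hd with
    | cycle _ _ h =>
      obtain ⟨C', hC', τ, -, hle⟩ := h
      obtain rfl | hC' := hC'
      · refine hns (PFact.Unselectable.of_subst (σ := τ) (hunsel₂ _ ?_))
        exact Multiset.mem_of_le hle (by simp)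
      · exact hC'
    | leaf => exact hempty _ rfl
    | node _ _ h hs => exact hs hsel'

/-! ### Forward correctness: the clauses without selected hypothesis suffice -/

/-- The clauses for the data constructors and their projections belong to `R₀`. -/
structure HasDataClauses (R₀ : Set (Clause S)) : Prop where
  constr : ∀ f ∈ S.dataCon, clauseRf f (fun k => (k : ℕ)) ∈ R₀
  proj : ∀ f ∈ S.dataCon, ∀ i : Fin (S.arity f), ∃ x : Fin (S.arity f) → Var,
    Function.Injective x ∧
      (⟨{.attacker (.con f (fun k => .var (x k)))}, .attacker (.var (x i))⟩ : Clause S) ∈ R₀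

variable {Me : Set (Pat S)} {R₀ 𝓡 : Set (Clause S)}

/-- With cost `m` for the use of an instance of a clause of `𝓡`, its conclusion has cost at most `m`
for the clauses without selected hypothesis, or an instance of a fact of `Fnot` is cheaper. -/
def ForwardBound (sf : SelFun S) (Fnot : Set (PFact S)) (Me : Set (Pat S)) (𝓡 : Set (Clause S))
    (m : ℕ) : Prop :=
  ∀ R ∈ 𝓡, ∀ (σ : Subst S) (d : ℕ) (F : PFact S), F.Final → FPath d (R.concl.subst σ) F →
    ((R.hyp.map (PFact.subst σ)).map (cost Me {C ∈ 𝓡 | sf.sel C = ∅})).sum + d + 1 ≤ m →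
    cost Me {C ∈ 𝓡 | sf.sel C = ∅} F ≤ m ∨
      ∃ B, NotInst Fnot B ∧ cost Me {C ∈ 𝓡 | sf.sel C = ∅} B < m

theorem exists_nat_of_add_le {a : ℕ∞} {d m : ℕ} (h : a + d + 1 ≤ m) :
    ∃ n : ℕ, a = n ∧ n + d + 1 ≤ m := by
  have ha : a ≠ ⊤ := by
    rintro rfl
    simp at h
  lift a to ℕ using ha
  exact ⟨a, rfl, by exact_mod_cast h⟩

/-- A cover of a clause transfers bounds on its use. -/
theorem Covered.cost_le {R : Clause S} (hcov : Covered Fnot R 𝓡) {σ : Subst S} {d : ℕ} {F : PFact S}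
    (hF : F.Final) (hp : FPath d (R.concl.subst σ) F) {m : ℕ} (hm : ForwardBound sf Fnot Me 𝓡 m)
    (hle : ((R.hyp.map (PFact.subst σ)).map (cost Me {C ∈ 𝓡 | sf.sel C = ∅})).sum + d + 1 ≤ m) :
    cost Me {C ∈ 𝓡 | sf.sel C = ∅} F ≤ m ∨
      ∃ B, NotInst Fnot B ∧ cost Me {C ∈ 𝓡 | sf.sel C = ∅} B < m := by
  have hadd := dataAdditive_cost Me {C ∈ 𝓡 | sf.sel C = ∅}
  obtain ⟨n, hn, hnm⟩ := exists_nat_of_add_le hle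
  obtain ⟨R', hR', σ', d', hd', hp', hdom⟩ | h₂ | ⟨B, hB, hB'⟩ := hcov σ d F hp hF
  · refine hm R' hR' σ' d' F hF hp' (le_trans ?_ hle)
    gcongr
    exact hdom _ hadd
  · have := h₂ _ hadd
    rw [hn, Multiset.map_singleton, Multiset.sum_singleton] at this
    exact Or.inl (this.trans (Nat.cast_le.2 (by omega)))
  · have := hB' _ hadd
    rw [hn, Multiset.map_singleton, Multiset.sum_singleton] at this
    exact Or.inr ⟨B, hB, this.trans_lt (Nat.cast_lt.2 (by omega))⟩

/-- A final derivable fact is the conclusion of an instance of a clause of `R₁` without any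
projection, unless an instance of a fact of `Fnot` is cheaper. If a cheapest derivation ends with projections, its clause concludes `attacker(y)`;
resolving it with the clause for the first projection gives a cheaper derivation. -/
theorem exists_root_instance (hS : Saturated sf Fnot R₀ 𝓡) (hD : HasDataClauses R₀)
    (hnot : ∀ G ∈ Fnot, Derivable sf Fnot G {C ∈ 𝓡 | sf.sel C = ∅} ∅)
    {F : PFact S} (hF : F.Final) {n : ℕ} (hn : cost Me {C ∈ 𝓡 | sf.sel C = ∅} F = n)
    (hm : ∀ m < n, ForwardBound sf Fnot Me 𝓡 m) :
    (∃ R ∈ 𝓡, sf.sel R = ∅ ∧ ∃ σ : Subst S, R.concl.subst σ = F ∧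
      ((R.hyp.map (PFact.subst σ)).map (cost Me {C ∈ 𝓡 | sf.sel C = ∅})).sum + 1 ≤ n) ∨
    ∃ B, NotInst Fnot B ∧ cost Me {C ∈ 𝓡 | sf.sel C = ∅} B < n := by
  have hadd := dataAdditive_cost Me {C ∈ 𝓡 | sf.sel C = ∅}
  obtain ⟨R, ⟨hR, hsel⟩, σ, d, hp, hle⟩ :=
    exists_node_of_cost_ne_top (Me := Me) (𝓡 := {C ∈ 𝓡 | sf.sel C = ∅}) hF
      (by rw [hn]; exact ENat.natCast_ne_top n)
  rw [hn] at hle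
  obtain ⟨s, hs, hsn⟩ := exists_nat_of_add_le hle
  -- The fact `F` cannot be obtained from the hypotheses of its own cheapest derivation.
  have hself : ∀ G ∈ R.hyp.map (PFact.subst σ), ∀ d', ¬ FPath d' G F := by
    intro G hG d' hp'
    have h₁ := (hp'.weight_le' hadd).trans (weight_le_sum hG _)
    rw [hs, hn, Nat.cast_le] at h₁
    omega
  generalize hC : R.concl.subst σ = C at hp
  cases hp with
  | refl =>
    refine Or.inl ⟨R, hR, hsel, σ, hC, ?_⟩
    simpa using hle
  | step d f hf ps i F hp =>
    obtain ⟨p, hRc⟩ : ∃ p, R.concl = .attacker p := by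
      cases hc : R.concl with
      | attacker p => exact ⟨p, rfl⟩
      | _ => rw [hc] at hC; simp [PFact.subst] at hC
    rw [hRc] at hC
    simp only [PFact.subst, PFact.attacker.injEq] at hC
    cases p with
    | name => simp [Pat.subst] at hC
    | con g q =>
      simp only [Pat.subst, Pat.con.injEq] at hC
      obtain ⟨rfl, hC⟩ := hC
      obtain hd | hd := (hS.normal R hR).decomposed
      · obtain ⟨g', hg', x, hx, rfl | ⟨j, rfl⟩⟩ := hd
        · simp only [clauseRf, PFact.attacker.injEq, Pat.con.injEq] at hRc
          obtain ⟨rfl, hRc⟩ := hRc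
          simp only [heq_eq_eq] at hRc hC
          subst hRc hC
          exact (hself _ (Multiset.mem_map_of_mem _ (mem_clauseRf_hyp.2 ⟨i, rfl⟩)) d hp).elim
        · simp at hRc
      · exact (hd.1 ⟨g, hf, q, hRc⟩).elim
    | var y =>
      have hy : .attacker (.var y) ∉ R.hyp := by
        intro hy
        refine hself _ (Multiset.mem_map_of_mem _ hy) (d + 1) ?_
        simp only [PFact.subst, hC]
        exact .step d f hf ps i F hp
      have hno := attacker_notMem_of_var_concl (R₁ := {C ∈ 𝓡 | sf.sel C = ∅}) hnot ⟨hR, hsel⟩ hsel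
        hRc hy
      obtain ⟨x, hx, hpr⟩ := hD.proj f hf i
      obtain ⟨R', hR', τ, hτc, hτh⟩ := hS.data _ hpr ⟨f, hf, x, hx, Or.inr ⟨i, rfl⟩⟩ (by
        rintro F hF ⟨G, hG, ρ, rfl⟩
        rw [Multiset.mem_singleton] at hF
        cases G with
        | attacker p => exact hno p hG
        | _ => simp [PFact.subst] at hF)
      -- The instance of the projection clause that is used at the end of the derivation.
      set ξ : Subst S := ⟨Function.extend x ps .var, .var⟩ with hξ
      have hξx : ∀ k, ξ.var (x k) = ps k := fun k => hx.extend_apply _ _ _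
      have hR'c : R'.concl.subst (τ.comp ξ) = .attacker (ps i) := by
        rw [← PFact.subst_subst, hτc]
        simp [PFact.subst, Pat.subst, hξx]
      obtain ⟨u, hu⟩ : ∃ u, R'.concl = .attacker (.var u) := by
        cases hc : R'.concl with
        | attacker p =>
          cases p with
          | var u => exact ⟨u, rfl⟩
          | _ => rw [hc] at hτc; simp [PFact.subst, Pat.subst] at hτc
        | _ => rw [hc] at hτc; simp [PFact.subst] at hτc
      obtain hH | ⟨F', hH⟩ : R'.hyp = 0 ∨ ∃ F', R'.hyp = {F'} := by
        have := Multiset.card_le_card hτh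
        rw [Multiset.card_map, Multiset.card_singleton] at this
        interval_cases h : Multiset.card R'.hyp
        · exact Or.inl (Multiset.card_eq_zero.1 h)
        · exact Or.inr (Multiset.card_eq_one.1 h)
      · have hsel' : sf.sel R' = ∅ := by
          by_contra hne
          obtain ⟨G, hG⟩ := Set.nonempty_iff_ne_empty.2 hne
          have := sf.sel_subset _ _ hG
          simp [hH] at this
        have := cost_node (Me := Me) (𝓡 := {C ∈ 𝓡 | sf.sel C = ∅}) ⟨hR', hsel'⟩
          (σ := τ.comp ξ) (d := d) (hR'c ▸ hp) hF
        rw [hH, hn] at this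
        simp only [Multiset.map_zero, Multiset.sum_zero, zero_add] at this
        norm_cast at this
        omega
      · rw [hH, Multiset.map_singleton, Multiset.singleton_le, Multiset.mem_singleton] at hτh
        have hF'sel : ¬ F'.Unselectable := by
          rintro (⟨z, rfl⟩ | ⟨q, rfl⟩)
          · refine (hS.normal R' hR').ne_attx u z ?_
            cases R'
            simp_all
          · simp [PFact.subst] at hτh
        have hF'mem : F' ∈ sf.sel R' := by
          have hne : sf.sel R' ≠ ∅ := by
            have := sf.sel_attacker_var R'.hyp u ⟨F', by simp [hH], hF'sel⟩
            rwa [← hu] at this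
          obtain ⟨G, hG⟩ := Set.nonempty_iff_ne_empty.2 hne
          have := sf.sel_subset _ _ hG
          rw [hH, Multiset.mem_singleton] at this
          exact this ▸ hG
        have hunif : R.concl.subst σ = F'.subst (τ.comp ξ) := by
          rw [← PFact.subst_subst, hτh, hRc]
          simp only [PFact.subst, Pat.subst, hξx]
          exact congrArg _ hC
        obtain ⟨R'', hres, hcov⟩ := hS.resolve R hR hsel R' hR' F' hF'mem ⟨_, _, hunif⟩
        obtain ⟨θ, A, hθ, hA, hhyp⟩ := hres.exists_instance hunif
        obtain rfl : A = 0 := by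
          rw [hH, Multiset.map_singleton] at hA
          exact (Multiset.cons_inj_right _).1 hA
        rw [add_zero] at hhyp
        obtain h | ⟨B, hB, hB'⟩ := hcov.cost_le (σ := θ) (d := d) (m := s + d + 1) hF
          (by rw [hθ, hR'c]; exact hp) (hm _ (by omega)) (by rw [hhyp, hs]; norm_cast)
        · rw [hn, Nat.cast_le] at h
          omega
        · exact Or.inr ⟨B, hB, hB'.trans (Nat.cast_lt.2 (by omega))⟩

theorem forwardBound (hS : Saturated sf Fnot R₀ 𝓡) (hD : HasDataClauses R₀)
    (hnot : ∀ G ∈ Fnot, Derivable sf Fnot G {C ∈ 𝓡 | sf.sel C = ∅} ∅) (m : ℕ) :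
    ForwardBound sf Fnot Me 𝓡 m := by
  induction m using Nat.strong_induction_on with
  | _ m ih =>
    intro R hR σ d F hF hp hle
    have hadd := dataAdditive_cost Me {C ∈ 𝓡 | sf.sel C = ∅}
    by_cases hsel : sf.sel R = ∅
    · exact Or.inl ((cost_node (𝓡 := {C ∈ 𝓡 | sf.sel C = ∅}) ⟨hR, hsel⟩ hp hF).trans hle)
    obtain ⟨s, hs, hsm⟩ := exists_nat_of_add_le hle
    obtain ⟨F₀, hF₀⟩ := Set.nonempty_iff_ne_empty.2 hsel
    have hmem := sf.sel_subset _ _ hF₀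
    have hns := sf.sel_selectable _ _ hF₀
    have hF₀s := weight_le_sum (Multiset.mem_map_of_mem (PFact.subst σ) hmem)
      (cost Me {C ∈ 𝓡 | sf.sel C = ∅})
    rw [hs] at hF₀s
    obtain ⟨n, hn⟩ := ENat.ne_top_iff_exists.1 (ne_top_of_le_ne_top (ENat.natCast_ne_top s) hF₀s)
    rw [← hn, Nat.cast_le] at hF₀s
    by_cases htop : (F₀.subst σ).DataTop
    -- Only the projection clauses have an undecomposed hypothesis.
    · obtain ⟨f, hf, ps, he⟩ := htop
      have hF₀top : F₀.DataTop := by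
        cases F₀ with
        | attacker p =>
          cases p with
          | var x => exact (hns (Or.inl ⟨x, rfl⟩)).elim
          | name => simp [PFact.subst, Pat.subst] at he
          | con g q =>
            simp only [PFact.subst, Pat.subst, PFact.attacker.injEq, Pat.con.injEq] at he
            exact ⟨g, he.1 ▸ hf, q, rfl⟩
        | _ => simp [PFact.subst] at he
      obtain hd | hd := (hS.normal R hR).decomposed
      · obtain ⟨g, hg, x, hx, rfl | ⟨j, rfl⟩⟩ := hd
        · obtain ⟨k, rfl⟩ := mem_clauseRf_hyp.1 hmem
          exact (hns (Or.inl ⟨_, rfl⟩)).elim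
        · rw [Multiset.mem_singleton] at hmem
          subst hmem
          have hp' := FPath.step d g hg (fun k => σ.var (x k)) j F hp
          have := hp'.weight_le' hadd
          refine Or.inl (this.trans ?_)
          change cost Me {C ∈ 𝓡 | sf.sel C = ∅}
            ((PFact.attacker (Pat.con g fun k => Pat.var (x k))).subst σ) ≤ m
          rw [← hn]
          exact Nat.cast_le.2 (by omega)
      · exact (hd.2 _ hmem hF₀top).elim
    · have hfin : (F₀.subst σ).Final := by
        refine ⟨htop, fun p hp => hns ?_⟩
        exact PFact.Unselectable.of_subst (σ := σ) (Or.inr ⟨p, hp⟩)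
      obtain ⟨R', hR', hsel', σ', he, hle'⟩ | ⟨B, hB, hB'⟩ :=
        exists_root_instance hS hD hnot hfin hn.symm (fun k hk => ih k (by omega))
      · obtain ⟨R'', hres, hcov⟩ := hS.resolve R' hR' hsel' R hR F₀ hF₀ ⟨_, _, he⟩
        obtain ⟨θ, A, hθ, hA, hhyp⟩ := hres.exists_instance he
        rw [← hA, Multiset.map_cons, Multiset.sum_cons, ← hn] at hs
        obtain ⟨s', hs', hsn⟩ := exists_nat_of_add_le (d := 0) (m := n)
          (a := ((R'.hyp.map (PFact.subst σ')).map (cost Me {C ∈ 𝓡 | sf.sel C = ∅})).sum)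
          (by rw [Nat.cast_zero, add_zero]; exact hle')
        obtain ⟨a, ha, haa⟩ : ∃ a : ℕ,
            (A.map (cost Me {C ∈ 𝓡 | sf.sel C = ∅})).sum = a ∧ n + a = s := by
          generalize (A.map (cost Me {C ∈ 𝓡 | sf.sel C = ∅})).sum = t at hs
          have ht : t ≠ ⊤ := by
            rintro rfl
            simp at hs
          lift t to ℕ using ht
          exact ⟨t, rfl, by exact_mod_cast hs⟩
        obtain h | ⟨B, hB, hB'⟩ := hcov.cost_le (σ := θ) (d := d) (m := s' + a + d + 1) hF
          (by rw [hθ]; exact hp) (ih _ (by omega))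
          (by rw [hhyp, Multiset.map_add, Multiset.sum_add, hs', ha]; norm_cast)
        · exact Or.inl (h.trans (Nat.cast_le.2 (by omega)))
        · exact Or.inr ⟨B, hB, hB'.trans (Nat.cast_lt.2 (by omega))⟩
      · exact Or.inr ⟨B, hB, hB'.trans (Nat.cast_lt.2 (by omega))⟩

/-! ### Correctness of the backward search -/

theorem exists_subsumes_clauseRf (hS : Saturated sf Fnot R₀ 𝓡) (hD : HasDataClauses R₀)
    (hnot : ∀ G ∈ Fnot, Derivable sf Fnot G {C ∈ 𝓡 | sf.sel C = ∅} ∅) {f : S.Con}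
    (hf : f ∈ S.dataCon) :
    ∃ R ∈ 𝓡, sf.sel R = ∅ ∧ Subsumes R (clauseRf f (fun k => (k : ℕ))) := by
  obtain ⟨R, hR, hs⟩ := hS.data _ (hD.constr f hf) ⟨f, hf, _, Fin.val_injective, Or.inl rfl⟩ (by
    intro F hF
    obtain ⟨k, rfl⟩ := mem_clauseRf_hyp.1 hF
    exact not_notInst_of_unselectable hnot (Or.inl ⟨_, rfl⟩))
  refine ⟨R, hR, ?_, hs⟩
  by_contra hne
  obtain ⟨F, hF⟩ := Set.nonempty_iff_ne_empty.2 hne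
  obtain ⟨τ, -, hh⟩ := hs
  have := Multiset.mem_of_le hh (Multiset.mem_map_of_mem _ (sf.sel_subset _ _ hF))
  obtain ⟨k, hk⟩ := mem_clauseRf_hyp.1 this
  exact sf.sel_selectable _ _ hF (PFact.Unselectable.of_subst (σ := τ) (Or.inl ⟨_, hk.symm⟩))

/-- A derivable fact that is an instance of a selectable fact is the conclusion of an instance of a
clause of `R₁` with cheaper hypotheses, unless an instance of a fact of `Fnot` is cheaper. When the
fact is `attacker(f(p₁, …, pₙ))` for a data constructor `f`, the clause is one that subsumes the
clause for `f`. -/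
theorem exists_instance_of_selectable (hS : Saturated sf Fnot R₀ 𝓡) (hD : HasDataClauses R₀)
    (hnot : ∀ G ∈ Fnot, Derivable sf Fnot G {C ∈ 𝓡 | sf.sel C = ∅} ∅) {F : PFact S}
    (hF : ¬ F.Unselectable) (σ : Subst S) {n : ℕ}
    (hn : cost Me {C ∈ 𝓡 | sf.sel C = ∅} (F.subst σ) = n) :
    (∃ R ∈ 𝓡, sf.sel R = ∅ ∧ ∃ σ' : Subst S, R.concl.subst σ' = F.subst σ ∧
      ((R.hyp.map (PFact.subst σ')).map (cost Me {C ∈ 𝓡 | sf.sel C = ∅})).sum + 1 ≤ n) ∨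
    ∃ B, NotInst Fnot B ∧ cost Me {C ∈ 𝓡 | sf.sel C = ∅} B < n := by
  by_cases htop : (F.subst σ).DataTop
  · obtain ⟨f, hf, ps, he⟩ := htop
    obtain ⟨R, hR, hsel, τ, hc, hh⟩ := exists_subsumes_clauseRf hS hD hnot hf
    set ξ : Subst S := ⟨Function.extend (fun k : Fin (S.arity f) => (k : ℕ)) ps .var, .var⟩ with hξ
    have hξk : ∀ k : Fin (S.arity f), ξ.var (k : ℕ) = ps k :=
      fun k => Fin.val_injective.extend_apply _ _ k
    refine Or.inl ⟨R, hR, hsel, τ.comp ξ, ?_, ?_⟩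
    · rw [← PFact.subst_subst, hc, he]
      simp [clauseRf, PFact.subst, Pat.subst, hξk]
    · rw [← map_subst_subst, ← hn, he, dataAdditive_cost Me _ f hf, add_comm]
      gcongr
      refine (weight_sum_le (Multiset.map_le_map hh) _).trans (le_of_eq ?_)
      simp only [clauseRf, Multiset.map_map, Function.comp_def, PFact.subst, Pat.subst, hξk]
      rfl
  · refine exists_root_instance hS hD hnot ⟨htop, fun p hp => hF ?_⟩ hn
      fun m _ => forwardBound hS hD hnot m
    exact PFact.Unselectable.of_subst (σ := σ) (Or.inr ⟨p, hp⟩)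

/-- If an instance of the clause `C` that concludes `F'` has derivable hypotheses, then the search
from `C` returns a clause with the same property. The hypothesis on the ancestors, that their
instances concluding `F'` are more expensive, makes the search never stop at a cycle. -/
theorem Deriv.exists_instance (hS : Saturated sf Fnot R₀ 𝓡) (hD : HasDataClauses R₀)
    (hnot : ∀ G ∈ Fnot, Derivable sf Fnot G {C ∈ 𝓡 | sf.sel C = ∅} ∅)
    {C : Clause S} {anc out : Set (Clause S)}
    (h : Deriv sf Fnot {C ∈ 𝓡 | sf.sel C = ∅} C anc out) {F' : PFact S} {n : ℕ}
    (hbad : ∀ B, NotInst Fnot B → (n : ℕ∞) ≤ cost Me {C ∈ 𝓡 | sf.sel C = ∅} B)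
    {σ : Subst S} (hc : C.concl.subst σ = F')
    (hle : ((C.hyp.map (PFact.subst σ)).map (cost Me {C ∈ 𝓡 | sf.sel C = ∅})).sum ≤ n)
    (hanc : ∀ C' ∈ anc, ∀ σ' : Subst S, C'.concl.subst σ' = F' →
      ((C.hyp.map (PFact.subst σ)).map (cost Me {C ∈ 𝓡 | sf.sel C = ∅})).sum <
        ((C'.hyp.map (PFact.subst σ')).map (cost Me {C ∈ 𝓡 | sf.sel C = ∅})).sum) :
    ∃ D ∈ out, ∃ σ' : Subst S, D.concl.subst σ' = F' ∧
      ∀ G ∈ D.hyp.map (PFact.subst σ'), cost Me {C ∈ 𝓡 | sf.sel C = ∅} G ≠ ⊤ := by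
  have hadd := dataAdditive_cost Me {C ∈ 𝓡 | sf.sel C = ∅}
  induction h generalizing σ with
  | cycle C anc h =>
    obtain ⟨C', hC', τ, hτ, hh⟩ := h
    have := hanc C' hC' (τ.comp σ) (by rw [← PFact.subst_subst, hτ, hc])
    rw [← map_subst_subst] at this
    exact (this.not_ge (weight_sum_le (Multiset.map_le_map hh) _)).elim
  | leaf C anc h hs =>
    exact ⟨C, rfl, σ, hc, fun G hG =>
      ne_top_of_le_ne_top (ENat.natCast_ne_top n) ((weight_le_sum hG _).trans hle)⟩
  | node C anc h hs res simp out hres hsimp hout ih =>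
    -- Choose the instance of `C` with the cheapest hypotheses.
    obtain ⟨σ₀, hc₀, hle₀, hmin⟩ : ∃ σ₀ : Subst S, C.concl.subst σ₀ = F' ∧
        ((C.hyp.map (PFact.subst σ₀)).map (cost Me {C ∈ 𝓡 | sf.sel C = ∅})).sum ≤
          ((C.hyp.map (PFact.subst σ)).map (cost Me {C ∈ 𝓡 | sf.sel C = ∅})).sum ∧
        ∀ σ' : Subst S, C.concl.subst σ' = F' →
          ((C.hyp.map (PFact.subst σ₀)).map (cost Me {C ∈ 𝓡 | sf.sel C = ∅})).sum ≤
            ((C.hyp.map (PFact.subst σ')).map (cost Me {C ∈ 𝓡 | sf.sel C = ∅})).sum := by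
      obtain ⟨_, ⟨σ₀, hσ₀, rfl⟩, hm⟩ := (wellFounded_lt (α := ℕ∞)).has_min
        ((fun σ : Subst S =>
          ((C.hyp.map (PFact.subst σ)).map (cost Me {C ∈ 𝓡 | sf.sel C = ∅})).sum) ''
            {σ | C.concl.subst σ = F'}) ⟨_, σ, hc, rfl⟩
      exact ⟨σ₀, hσ₀, not_lt.1 (hm _ ⟨σ, hc, rfl⟩), fun σ' hσ' => not_lt.1 (hm _ ⟨σ', hσ', rfl⟩)⟩
    have hanc₀ := fun C' hC' σ' hσ' => hle₀.trans_lt (hanc C' hC' σ' hσ')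
    have hlen := hle₀.trans hle
    clear hanc hle₀ hle hc σ
    obtain ⟨s, hs'⟩ := ENat.ne_top_iff_exists.1
      (ne_top_of_le_ne_top (ENat.natCast_ne_top n) hlen)
    replace hs' := hs'.symm
    have hsn : s ≤ n := by rwa [hs', Nat.cast_le] at hlen
    obtain ⟨F₀, hF₀⟩ := Set.nonempty_iff_ne_empty.2 hs
    have hmem := sf.sel_subset _ _ hF₀
    have hns := sf.sel_selectable _ _ hF₀
    have hF₀s := weight_le_sum (Multiset.mem_map_of_mem (PFact.subst σ₀) hmem)
      (cost Me {C ∈ 𝓡 | sf.sel C = ∅})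
    rw [hs'] at hF₀s
    obtain ⟨k, hk⟩ := ENat.ne_top_iff_exists.1 (ne_top_of_le_ne_top (ENat.natCast_ne_top s) hF₀s)
    rw [← hk, Nat.cast_le] at hF₀s
    obtain ⟨R, hR, hsel, σ', he, hle'⟩ | ⟨B, hB, hB'⟩ :=
      exists_instance_of_selectable hS hD hnot hns σ₀ hk.symm
    · have hR₁ : R ∈ {C ∈ 𝓡 | sf.sel C = ∅} := ⟨hR, hsel⟩
      have hu : Unifiable R.concl F₀ := ⟨_, _, he⟩
      obtain ⟨θ, A, hθ, hA, hhyp⟩ := (hres R hR₁ F₀ hF₀ hu).exists_instance he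
      -- The instance of the resolvent is strictly cheaper than that of `C`.
      have hlt : (((res R F₀).hyp.map (PFact.subst θ)).map
          (cost Me {C ∈ 𝓡 | sf.sel C = ∅})).sum < s := by
        rw [hhyp, ← hs', ← hA, Multiset.map_add, Multiset.sum_add, Multiset.map_cons,
          Multiset.sum_cons, ← hk]
        rw [← hA, Multiset.map_cons, Multiset.sum_cons] at hs'
        have ht : (A.map (cost Me {C ∈ 𝓡 | sf.sel C = ∅})).sum ≠ ⊤ := by
          intro ht
          rw [ht] at hs'
          simp at hs'
        refine (ENat.add_lt_add_iff_right ht).2 ?_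
        exact (ENat.add_one_le_iff (by
          rintro ht
          rw [ht] at hle'
          simp at hle')).1 hle'
      obtain ⟨e, hel, hsim⟩ := hsimp R hR₁ F₀ hF₀ hu
      set C₁ := e (elimdup (decomphyp (res R F₀))) with hC₁
      have hC₁c : C₁.concl.subst θ = F' := by
        rw [hC₁, (hel.concl_hyp _).1, ← hc₀, ← hθ]
        unfold decomphyp
        split_ifs <;> rfl
      have hC₁h : ((C₁.hyp.map (PFact.subst θ)).map
          (cost Me {C ∈ 𝓡 | sf.sel C = ∅})).sum < s := by
        refine lt_of_le_of_lt ?_ hlt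
        refine (weight_sum_le (Multiset.map_le_map
          ((hel.concl_hyp _).2.trans (elimdup_hyp_le _))) _).trans ?_
        unfold decomphyp
        split_ifs
        · exact le_rfl
        · exact Dominated.bind_parts θ _ _ hadd
      have hC₂h := (weight_sum_le (Multiset.map_le_map (f := PFact.subst θ)
        (elimattx_hyp_le C₁)) (cost Me {C ∈ 𝓡 | sf.sel C = ∅})).trans_lt hC₁h
      have hC₂ : elimattx C₁ ∈ simp R F₀ := by
        rw [hsim]
        refine ⟨C₁, ⟨rfl, ?_⟩, rfl⟩
        rintro ⟨F, hF, hB⟩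
        have h₁ := hbad _ (NotInst.subst hB θ)
        have h₂ := weight_le_sum (Multiset.mem_map_of_mem (PFact.subst θ) hF)
          (cost Me {C ∈ 𝓡 | sf.sel C = ∅})
        have h₃ := (h₁.trans h₂).trans_lt hC₁h
        rw [Nat.cast_lt] at h₃
        omega
      obtain ⟨D, hD', hDσ⟩ := ih R hR₁ F₀ hF₀ hu _ hC₂ (σ := θ) hC₁c
        (hC₂h.le.trans (Nat.cast_le.2 (by omega))) (by
          intro C' hC' σ'' hσ''
          refine hC₂h.trans_le ?_
          rw [← hs']
          obtain rfl | hC' := hC'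
          · exact hmin _ hσ''
          · exact (hanc₀ C' hC' σ'' hσ'').le)
      exact ⟨D, ⟨R, hR₁, F₀, hF₀, hu, _, hC₂, hD'⟩, hDσ⟩
    · have := (hbad B hB).trans_lt hB'
      rw [Nat.cast_lt] at this
      omega

/-- No instance of a fact of `Fnot` is derivable. -/
theorem cost_notInst_eq_top (hS : Saturated sf Fnot R₀ 𝓡) (hD : HasDataClauses R₀)
    (hnot : ∀ G ∈ Fnot, Derivable sf Fnot G {C ∈ 𝓡 | sf.sel C = ∅} ∅) {B : PFact S}
    (hB : NotInst Fnot B) : cost Me {C ∈ 𝓡 | sf.sel C = ∅} B = ⊤ := by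
  by_contra hne
  obtain ⟨_, ⟨B₀, hB₀, rfl⟩, hm⟩ := (wellFounded_lt (α := ℕ∞)).has_min
    (cost Me {C ∈ 𝓡 | sf.sel C = ∅} '' {B | NotInst Fnot B}) ⟨_, B, hB, rfl⟩
  have hmin := fun B' hB' => not_lt.1 (hm _ ⟨B', hB', rfl⟩)
  obtain ⟨n, hn⟩ := ENat.ne_top_iff_exists.1 (ne_top_of_le_ne_top hne (hmin B hB))
  obtain ⟨G, hG, σ, rfl⟩ := hB₀
  obtain ⟨D, hD', -⟩ := (hnot G hG).exists_instance hS hD hnot (Me := Me) (n := n) (σ := σ)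
    (fun B hB => hn ▸ hmin B hB) rfl (by simp [← hn]) (by simp)
  exact hD'

/-- The derivable facts are closed under the clauses of `R₀`. -/
theorem cost_ne_top_of_clause (hS : Saturated sf Fnot R₀ 𝓡) (hD : HasDataClauses R₀)
    (hnot : ∀ G ∈ Fnot, Derivable sf Fnot G {C ∈ 𝓡 | sf.sel C = ∅} ∅) {R : Clause S} (hR : R ∈ R₀)
    (hconcl : ∀ p, R.concl ≠ .mevent p) (σ : Subst S)
    (hh : ∀ F ∈ R.hyp, cost Me {C ∈ 𝓡 | sf.sel C = ∅} (F.subst σ) ≠ ⊤) :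
    cost Me {C ∈ 𝓡 | sf.sel C = ∅} (R.concl.subst σ) ≠ ⊤ := by
  refine cost_ne_top_of_paths ?_ fun d F hp hF => ?_
  · intro p hp
    cases hc : R.concl with
    | mevent q => exact hconcl q hc
    | _ => rw [hc] at hp; simp [PFact.subst] at hp
  · have hs : ((R.hyp.map (PFact.subst σ)).map (cost Me {C ∈ 𝓡 | sf.sel C = ∅})).sum ≠ ⊤ := by
      refine weight_sum_ne_top fun G hG => ?_
      obtain ⟨F, hF, rfl⟩ := Multiset.mem_map.1 hG
      exact hh F hF
    obtain ⟨s, hs⟩ := ENat.ne_top_iff_exists.1 hs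
    obtain h | ⟨B, hB, hB'⟩ := (hS.covered R hR).cost_le hF hp
      (forwardBound hS hD hnot (s + d + 1)) (by rw [← hs]; norm_cast)
    · exact ne_top_of_le_ne_top (ENat.natCast_ne_top _) h
    · rw [cost_notInst_eq_top hS hD hnot hB] at hB'
      exact (not_top_lt hB').elim

/-- If an instance of `F` is derivable, then it is the conclusion of an instance of a clause found
by the backward search for `F`, with derivable hypotheses. -/
theorem Derivable.exists_instance (hS : Saturated sf Fnot R₀ 𝓡) (hD : HasDataClauses R₀)
    (hnot : ∀ G ∈ Fnot, Derivable sf Fnot G {C ∈ 𝓡 | sf.sel C = ∅} ∅) {F : PFact S}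
    {out : Set (Clause S)} (h : Derivable sf Fnot F {C ∈ 𝓡 | sf.sel C = ∅} out) (τ : Subst S)
    (hF : cost Me {C ∈ 𝓡 | sf.sel C = ∅} (F.subst τ) ≠ ⊤) :
    ∃ D ∈ out, ∃ σ : Subst S, D.concl.subst σ = F.subst τ ∧
      ∀ G ∈ D.hyp.map (PFact.subst σ), cost Me {C ∈ 𝓡 | sf.sel C = ∅} G ≠ ⊤ := by
  obtain ⟨n, hn⟩ := ENat.ne_top_iff_exists.1 hF
  exact Deriv.exists_instance hS hD hnot h (n := n) (σ := τ)
    (fun B hB => by rw [cost_notInst_eq_top hS hD hnot hB]; exact le_top) rfl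
    (by simp [← hn]) (by simp)

/-! ### Typing of instrumented processes -/

/-- The process `P` is well-typed in the environment `ρ` with respect to a set `D` of facts: the
outputs and events of `P` satisfy facts of `D`, for all inputs and destructor results that are
compatible with `D` and for which the must-events are in `D`. -/
def WT (D : Set (PFact S)) : IProc S → Env S → Prop
  | .nil, _ => True
  | .par P Q, ρ => WT D P ρ ∧ WT D Q ρ
  | .repl i P, ρ => ∀ u : Sess, WT D P (ρ.setSess i u)
  | .new a l P, ρ => WT D P (ρ.setBnm a (l.eval ρ))
  | .out M N P, ρ => .message (M.eval ρ) (N.eval ρ) ∈ D ∧ WT D P ρ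
  | .inp M x P, ρ => ∀ p, .message (M.eval ρ) p ∈ D → WT D P (ρ.setVar x p)
  | .letd x g Ms P Q, ρ =>
      (∀ r ∈ S.rules g, ∀ τ : Var → Pat S, (∀ k, (Ms k).eval ρ = (r.lhs k).toPat τ) →
        WT D P (ρ.setVar x (r.rhs.toPat τ))) ∧ WT D Q ρ
  | .cond M N P Q, ρ => (M.eval ρ = N.eval ρ → WT D P ρ) ∧ WT D Q ρ
  | .event M P, ρ => .event (M.eval ρ) ∈ D ∧ (.mevent (M.eval ρ) ∈ D → WT D P ρ)

theorem Term.eval_subst (M : Term S) (ρ : Env S) (θ : Subst S) :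
    (M.eval ρ).subst θ = M.eval (ρ.subst θ) := by
  induction M with
  | con f ts ih => simp only [Term.eval, Pat.subst, ih]
  | _ => rfl

theorem map_sess_subst (ss : List Sess) (ρ : Env S) (θ : Subst S) :
    (ss.map (Sess.bind ρ.sess)).map (Sess.bind θ.sess) =
      ss.map (Sess.bind (ρ.subst θ).sess) := by
  rw [List.map_map]
  exact List.map_congr_left fun u _ => Sess.bind_bind _ _ u

theorem Label.eval_subst (l : Label S) (ρ : Env S) (θ : Subst S) :
    (l.eval ρ).subst θ = l.eval (ρ.subst θ) := by
  cases l <;> simp only [Label.eval, Pat.subst, Term.eval_subst, map_sess_subst]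
  simp only [List.map_nil, Pat.name.injEq, heq_eq_eq, and_true, true_and]
  funext _
  simp only [Pat.name.injEq, heq_eq_eq, and_true, true_and]
  exact Subsingleton.elim _ _

theorem Env.subst_setVar (ρ : Env S) (x : Var) (p : Pat S) (θ : Subst S) :
    (ρ.setVar x p).subst θ = (ρ.subst θ).setVar x (p.subst θ) := by
  simp only [Env.setVar, Env.subst, Env.mk.injEq, and_true]
  funext y
  by_cases h : y = x
  · subst h; simp
  · simp [h]

theorem Env.subst_setBnm (ρ : Env S) (a : Name) (p : Pat S) (θ : Subst S) :
    (ρ.setBnm a p).subst θ = (ρ.subst θ).setBnm a (p.subst θ) := by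
  simp only [Env.setBnm, Env.subst, Env.mk.injEq, and_true, true_and]
  funext y
  by_cases h : y = a
  · subst h; simp
  · simp [h]

theorem Env.subst_setSess (ρ : Env S) (i : SVar) (u : Sess) (θ : Subst S) :
    (ρ.setSess i u).subst θ = (ρ.subst θ).setSess i (u.bind θ.sess) := by
  simp only [Env.setSess, Env.subst, Env.mk.injEq, true_and]
  funext y
  by_cases h : y = i
  · subst h; simp
  · simp [h]

theorem Tm.toPat_subst (t : Tm S.arity) (σ : Var → Pat S) (θ : Subst S) :
    (t.toPat σ).subst θ = t.toPat (fun y => (σ y).subst θ) := by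
  induction t with
  | var x => rfl
  | con f ts ih => simp only [Tm.toPat, Pat.subst, ih]

theorem Tm.toPat_congr (t : Tm S.arity) {σ τ : Var → Pat S} (h : ∀ y ∈ t.vars, σ y = τ y) :
    t.toPat σ = t.toPat τ := by
  induction t with
  | var x => exact h x rfl
  | con f ts ih =>
    simp only [Tm.toPat]
    congr 1
    funext k
    exact ih k fun y hy => h y (Set.mem_iUnion.2 ⟨k, hy⟩)

/-- A substitution may be changed freely on a fresh variable. -/
theorem FreshVar.exists_subst {x : Var} {ρ : Env S} {H : Multiset (PFact S)} (h : FreshVar x ρ H)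
    (θ : Subst S) (p : Pat S) :
    ∃ θ' : Subst S, θ'.var x = p ∧ ρ.subst θ' = ρ.subst θ ∧
      ∀ F ∈ H, F.subst θ' = F.subst θ := by
  refine ⟨⟨Function.update θ.var x p, θ.sess⟩, by simp, ?_, ?_⟩
  · have key : ∀ q : Pat S, x ∉ q.vars →
        q.subst ⟨Function.update θ.var x p, θ.sess⟩ = q.subst θ := fun q hq =>
      q.subst_congr (fun y hy => Function.update_of_ne (by rintro rfl; exact hq hy) _ _) fun _ _ => rfl
    simp only [Env.subst, Env.mk.injEq, and_true]
    exact ⟨funext fun y => key _ (h.1 y), funext fun y => key _ (h.2.1 y),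
      funext fun y => key _ (h.2.2.1 y)⟩
  · exact fun F hF => F.subst_congr
      (fun y hy => Function.update_of_ne (by rintro rfl; exact h.2.2.2 F hF hy) _ _) fun _ _ => rfl

theorem FreshSVar.exists_subst {i : SVar} {ρ : Env S} {H : Multiset (PFact S)}
    (h : FreshSVar i ρ H) (θ : Subst S) (u : Sess) :
    ∃ θ' : Subst S, θ'.sess i = u ∧ ρ.subst θ' = ρ.subst θ ∧
      ∀ F ∈ H, F.subst θ' = F.subst θ := by
  refine ⟨⟨θ.var, Function.update θ.sess i u⟩, by simp, ?_, ?_⟩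
  · have key : ∀ q : Pat S, i ∉ q.svars →
        q.subst ⟨θ.var, Function.update θ.sess i u⟩ = q.subst θ := fun q hq =>
      q.subst_congr (fun _ _ => rfl)
        fun j hj => Function.update_of_ne (by rintro rfl; exact hq hj) _ _
    simp only [Env.subst, Env.mk.injEq]
    refine ⟨funext fun y => key _ (h.1 y), funext fun y => key _ (h.2.1 y),
      funext fun y => key _ (h.2.2.1 y), funext fun j => ?_⟩
    cases hj : ρ.sess j with
    | const l => rfl
    | var k =>
      refine Function.update_of_ne ?_ _ _
      rintro rfl
      exact h.2.2.2.1 j hj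
  · exact fun F hF => F.subst_congr (fun _ _ => rfl)
      fun y hy => Function.update_of_ne (by rintro rfl; exact h.2.2.2.2 F hF hy) _ _

/-- The set `D` of facts is closed under the clause `C`. -/
def ClosedUnder (D : Set (PFact S)) (C : Clause S) : Prop :=
  ∀ θ : Subst S, (∀ F ∈ C.hyp, F.subst θ ∈ D) → C.concl.subst θ ∈ D

theorem Trans.concl_ne_mevent {P : IProc S} {ρ : Env S} {H : Multiset (PFact S)}
    {R : Set (Clause S)} (h : Trans P ρ H R) : ∀ C ∈ R, ∀ p, C.concl ≠ .mevent p := by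
  induction h with
  | nil => simp
  | par P Q ρ H RP RQ hP hQ ihP ihQ =>
    rintro C (hC | hC)
    exacts [ihP C hC, ihQ C hC]
  | repl i i' P ρ H R hi hP ih => exact ih
  | new a b ts ss P ρ H R hP ih => exact ih
  | inp M x x' P ρ H R hx hP ih => exact ih
  | out M N P ρ H R hP ih =>
    rintro C (hC | rfl)
    exacts [ih C hC, by simp]
  | letd x g Ms P Q ρ H σ σ' RP RQ hσ hP hQ ihP ihQ =>
    rintro C (⟨r, hr, hu, hC⟩ | hC)
    exacts [ihP r hr hu C hC, ihQ C hC]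
  | condUnif M N P Q ρ H σ RP RQ hσ hP hQ ihP ihQ =>
    rintro C (hC | hC)
    exacts [ihP C hC, ihQ C hC]
  | condNotUnif M N P Q ρ H RQ h hQ ih => exact ih
  | event M P ρ H R hP ih =>
    rintro C (hC | rfl)
    exacts [ih C hC, by simp]

/-- A process is well-typed with respect to every set of facts that is closed under the clauses
generated from it, as soon as the hypotheses collected so far hold. -/
theorem Trans.wt {D : Set (PFact S)} {P : IProc S} {ρ : Env S} {H : Multiset (PFact S)}
    {R : Set (Clause S)} (h : Trans P ρ H R) (hR : ∀ C ∈ R, ClosedUnder D C) (θ : Subst S)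
    (hH : ∀ F ∈ H, F.subst θ ∈ D) : WT D P (ρ.subst θ) := by
  induction h generalizing θ with
  | nil => trivial
  | par P Q ρ H RP RQ hP hQ ihP ihQ =>
    exact ⟨ihP (fun C hC => hR C (Or.inl hC)) θ hH, ihQ (fun C hC => hR C (Or.inr hC)) θ hH⟩
  | repl i i' P ρ H R hi hP ih =>
    intro u
    obtain ⟨θ', hu, hρ, hF⟩ := hi.exists_subst θ u
    have := ih hR θ' fun F hF' => by rw [hF F hF']; exact hH F hF'
    rw [Env.subst_setSess, hρ] at this
    simpa only [Sess.bind, hu] using this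
  | new a b ts ss P ρ H R hP ih =>
    have := ih hR θ hH
    rw [Env.subst_setBnm, Label.eval_subst] at this
    exact this
  | inp M x x' P ρ H R hx hP ih =>
    intro p hp
    obtain ⟨θ', hu, hρ, hF⟩ := hx.exists_subst θ p
    have := ih hR θ' (by
      intro F hF'
      obtain rfl | hF' := Multiset.mem_cons.1 hF'
      · simpa only [PFact.subst, Term.eval_subst, hρ, Pat.subst, hu] using hp
      · rw [hF F hF']
        exact hH F hF')
    rw [Env.subst_setVar, hρ] at this
    simpa only [Pat.subst, hu] using this
  | out M N P ρ H R hP ih =>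
    refine ⟨?_, ih (fun C hC => hR C (Or.inl hC)) θ hH⟩
    have := hR _ (Or.inr rfl) θ hH
    simpa only [PFact.subst, Term.eval_subst] using this
  | letd x g Ms P Q ρ H σ σ' RP RQ hσ hP hQ ihP ihQ =>
    refine ⟨fun r hr τ hτ => ?_, ihQ (fun C hC => hR C (Or.inr hC)) θ hH⟩
    have hu : PairUnifies ρ Ms r θ τ := fun k => by rw [Term.eval_subst]; exact hτ k
    obtain ⟨θ', hρ, hF, hy⟩ := (hσ r hr ⟨θ, τ, hu⟩).2 θ τ hu
    have := ihP r hr ⟨θ, τ, hu⟩ (fun C hC => hR C (Or.inl ⟨r, hr, ⟨θ, τ, hu⟩, hC⟩)) θ' (by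
      intro F hF'
      obtain ⟨G, hG, rfl⟩ := Multiset.mem_map.1 hF'
      rw [hF G hG]
      exact hH G hG)
    rw [Env.subst_setVar, hρ, Tm.toPat_subst] at this
    rwa [Tm.toPat_congr r.rhs (τ := τ)] at this
    intro y hy'
    obtain ⟨k, hk⟩ := Set.mem_iUnion.1 (r.vars_rhs hy')
    exact hy k y hk
  | condUnif M N P Q ρ H σ RP RQ hσ hP hQ ihP ihQ =>
    refine ⟨fun he => ?_, ihQ (fun C hC => hR C (Or.inr hC)) θ hH⟩
    rw [← Term.eval_subst, ← Term.eval_subst] at he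
    obtain ⟨θ', hρ, hF⟩ := hσ.2 θ he
    rw [← hρ]
    refine ihP (fun C hC => hR C (Or.inl hC)) θ' ?_
    intro F hF'
    obtain ⟨G, hG, rfl⟩ := Multiset.mem_map.1 hF'
    rw [hF G hG]
    exact hH G hG
  | condNotUnif M N P Q ρ H RQ h hQ ih =>
    refine ⟨fun he => (h ⟨θ, ?_⟩).elim, ih hR θ hH⟩
    rw [Term.eval_subst, Term.eval_subst, he]
  | event M P ρ H R hP ih =>
    refine ⟨?_, fun hm => ih (fun C hC => hR C (Or.inl hC)) θ ?_⟩
    · have := hR _ (Or.inr rfl) θ hH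
      simpa only [PFact.subst, Term.eval_subst] using this
    · intro F hF'
      obtain rfl | hF' := Multiset.mem_cons.1 hF'
      · simpa only [PFact.subst, Term.eval_subst] using hm
      · exact hH F hF'

/-! ### Typing of adversaries -/

/-- The closure properties of the set of facts known to hold in the presence of an adversary. -/
structure AdvClosed (D : Set (PFact S)) (Init : Finset Name) : Prop where
  init : ∀ a ∈ Init, .attacker (.atom (.nm a)) ∈ D
  fresh : ∀ p : Pat S, .attacker (.name .b0 1 (fun _ => p) []) ∈ D
  con : ∀ f ∈ S.publicCon, ∀ ps, (∀ k, .attacker (ps k) ∈ D) → .attacker (.con f ps) ∈ D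
  des : ∀ g ∈ S.publicDes, ∀ r ∈ S.rules g, ∀ τ : Var → Pat S,
    (∀ k, .attacker ((r.lhs k).toPat τ) ∈ D) → .attacker (r.rhs.toPat τ) ∈ D
  listen : ∀ p q, .message p q ∈ D → .attacker p ∈ D → .attacker q ∈ D
  send : ∀ p q, .attacker p ∈ D → .attacker q ∈ D → .message p q ∈ D

theorem advClosed_of_closedUnder {D : Set (PFact S)} {Init : Finset Name}
    (h : ∀ C, AttackerClause Init C → ClosedUnder D C) : AdvClosed D Init where
  init a ha := by
    have := h _ (.init a ha) Subst.id (by simp)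
    rwa [PFact.subst_id] at this
  fresh p := by
    have := h _ .rn ⟨fun _ => p, .var⟩ (by simp)
    simpa [PFact.subst, Pat.subst] using this
  con f hf ps hps := by
    set ξ : Subst S := ⟨Function.extend (fun k : Fin (S.arity f) => (k : ℕ)) ps .var, .var⟩ with hξ
    have hξk : ∀ k : Fin (S.arity f), ξ.var (k : ℕ) = ps k :=
      fun k => Fin.val_injective.extend_apply _ _ k
    have := h _ (.rf f hf) ξ (by
      intro F hF
      obtain ⟨k, rfl⟩ := mem_clauseRf_hyp.1 hF
      simpa only [PFact.subst, Pat.subst, hξk] using hps k)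
    simpa only [clauseRf, PFact.subst, Pat.subst, hξk] using this
  des g hg r hr τ hτ := by
    have := h _ (.rg g hg r hr) ⟨τ, .var⟩ (by
      intro F hF
      simp only [clauseRg, Multiset.mem_map] at hF
      obtain ⟨k, -, rfl⟩ := hF
      simp only [PFact.subst, Tm.toPat_subst]
      exact hτ k)
    simp only [clauseRg, PFact.subst, Tm.toPat_subst] at this
    exact this
  listen p q hm ha := by
    have := h _ .rl ⟨fun x => if x = 0 then p else q, .var⟩ (by
      simpa [PFact.subst, Pat.subst] using ⟨hm, ha⟩)
    simpa [PFact.subst, Pat.subst] using this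
  send p q hp hq := by
    have := h _ .rs ⟨fun x => if x = 0 then p else q, .var⟩ (by
      simpa [PFact.subst, Pat.subst] using ⟨hp, hq⟩)
    simpa [PFact.subst, Pat.subst] using this

theorem Term.attacker_eval {D : Set (PFact S)} {Init : Finset Name} (hD : AdvClosed D Init)
    {ρ : Env S} {M : Term S} (hpub : M.Public) (hv : ∀ x ∈ M.fv, .attacker (ρ.var x) ∈ D)
    (hb : ∀ a ∈ M.fbn, .attacker (ρ.bnm a) ∈ D) (hn : ∀ a ∈ M.fn, .attacker (ρ.nm a) ∈ D) :
    .attacker (M.eval ρ) ∈ D := by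
  induction M with
  | var x => exact hv x rfl
  | bname a => exact hb a rfl
  | name a => exact hn a rfl
  | con f ts ih =>
    refine hD.con f hpub.1 _ fun k => ih k (hpub.2 k) ?_ ?_ ?_
    · exact fun x hx => hv x (Set.mem_iUnion.2 ⟨k, hx⟩)
    · exact fun x hx => hb x (Set.mem_iUnion.2 ⟨k, hx⟩)
    · exact fun x hx => hn x (Set.mem_iUnion.2 ⟨k, hx⟩)

/-- An adversary is well-typed in every environment whose values it may know. -/
theorem wt_instrAux_adv {D : Set (PFact S)} {Init : Finset Name} (hD : AdvClosed D Init)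
    (Q : PlainProc S) (hev : Q.EventFree) (hpub : Q.Public) (ρ : Env S)
    (hv : ∀ x ∈ Q.fv, .attacker (ρ.var x) ∈ D) (hb : ∀ a ∈ Q.fbn, .attacker (ρ.bnm a) ∈ D)
    (hn : ∀ a ∈ Q.fn, .attacker (ρ.nm a) ∈ D) (t : List Var) (s : List SVar) (k : ℕ) :
    WT D (instrAux (fun a _ s => .adv a (s.map .var)) Q t s k).1 ρ := by
  induction Q generalizing ρ t s k with
  | nil => trivial
  | par P Q ihP ihQ =>
    exact ⟨ihP hev.1 hpub.1 ρ (fun x hx => hv x (Or.inl hx)) (fun x hx => hb x (Or.inl hx))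
        (fun x hx => hn x (Or.inl hx)) _ _ _,
      ihQ hev.2 hpub.2 ρ (fun x hx => hv x (Or.inr hx)) (fun x hx => hb x (Or.inr hx))
        (fun x hx => hn x (Or.inr hx)) _ _ _⟩
  | repl i P ih => exact fun u => ih hev hpub (ρ.setSess k u) hv hb hn _ _ _
  | new a l P ih =>
    refine ih hev hpub (ρ.setBnm a _) hv (fun b hb' => ?_) hn _ _ _
    by_cases h : b = a
    · subst h
      simpa [Env.setBnm, Label.eval] using hD.fresh _
    · simpa [Env.setBnm, h] using hb b ⟨hb', h⟩
  | out M N P ih =>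
    refine ⟨hD.send _ _ ?_ ?_, ih hev hpub.2.2 ρ (fun x hx => hv x (Or.inr hx))
      (fun x hx => hb x (Or.inr hx)) (fun x hx => hn x (Or.inr hx)) _ _ _⟩
    · exact Term.attacker_eval hD hpub.1 (fun x hx => hv x (Or.inl (Or.inl hx)))
        (fun x hx => hb x (Or.inl (Or.inl hx))) (fun x hx => hn x (Or.inl (Or.inl hx)))
    · exact Term.attacker_eval hD hpub.2.1 (fun x hx => hv x (Or.inl (Or.inr hx)))
        (fun x hx => hb x (Or.inl (Or.inr hx))) (fun x hx => hn x (Or.inl (Or.inr hx)))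
  | inp M x P ih =>
    intro p hp
    have hM := Term.attacker_eval hD hpub.1 (fun x hx => hv x (Or.inl hx))
      (fun x hx => hb x (Or.inl hx)) (fun x hx => hn x (Or.inl hx))
    refine ih hev hpub.2 (ρ.setVar x p) (fun y hy => ?_) (fun x hx => hb x (Or.inr hx))
      (fun x hx => hn x (Or.inr hx)) _ _ _
    by_cases h : y = x
    · subst h
      simpa [Env.setVar] using hD.listen _ _ hp hM
    · simpa [Env.setVar, h] using hv y (Or.inr ⟨hy, h⟩)
  | letd x g Ms P Q ihP ihQ =>
    refine ⟨fun r hr τ hτ => ?_, ihQ hev.2 hpub.2.2.2 ρ (fun x hx => hv x (Or.inr hx))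
      (fun x hx => hb x (Or.inr hx)) (fun x hx => hn x (Or.inr hx)) _ _ _⟩
    refine ihP hev.1 hpub.2.2.1 (ρ.setVar x _) (fun y hy => ?_) (fun x hx => hb x (Or.inl (Or.inr hx)))
      (fun x hx => hn x (Or.inl (Or.inr hx))) _ _ _
    by_cases h : y = x
    · subst h
      simp only [Env.setVar, Function.update_self]
      refine hD.des g hpub.1 r hr τ fun k => ?_
      rw [← hτ k]
      exact Term.attacker_eval hD (hpub.2.1 k)
        (fun x hx => hv x (Or.inl (Or.inl (Set.mem_iUnion.2 ⟨k, hx⟩))))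
        (fun x hx => hb x (Or.inl (Or.inl (Set.mem_iUnion.2 ⟨k, hx⟩))))
        (fun x hx => hn x (Or.inl (Or.inl (Set.mem_iUnion.2 ⟨k, hx⟩))))
    · simpa [Env.setVar, h] using hv y (Or.inl (Or.inr ⟨hy, h⟩))
  | cond M N P Q ihP ihQ =>
    exact ⟨fun _ => ihP hev.1 hpub.2.2.1 ρ (fun x hx => hv x (Or.inl (Or.inr hx)))
        (fun x hx => hb x (Or.inl (Or.inr hx))) (fun x hx => hn x (Or.inl (Or.inr hx))) _ _ _,
      ihQ hev.2 hpub.2.2.2 ρ (fun x hx => hv x (Or.inr hx))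
        (fun x hx => hb x (Or.inr hx)) (fun x hx => hn x (Or.inr hx)) _ _ _⟩
  | event M P ih => exact hev.elim

/-! ### Scopes of identifiers -/

/-- The variables, bound-name identifiers and names of `M` belong to the given sets. -/
def Term.Cl (V : Set Var) (B N : Set Name) (M : Term S) : Prop :=
  M.fv ⊆ V ∧ M.fbn ⊆ B ∧ M.fn ⊆ N

/-- The identifiers of the label belong to the given sets. -/
def Label.Cl (V : Set Var) (B : Set Name) (I : Set SVar) (N : Set Name) : Label S → Prop
  | .honest _ ts ss => (∀ M ∈ ts, M.Cl V B N) ∧ ∀ i, Sess.var i ∈ ss → i ∈ I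
  | .adv _ ss => ∀ i, Sess.var i ∈ ss → i ∈ I

/-- The free identifiers of the process, including those of the labels of its restrictions, belong
to the given sets. -/
def Proc.Cl : IProc S → Set Var → Set Name → Set SVar → Set Name → Prop
  | .nil, _, _, _, _ => True
  | .par P Q, V, B, I, N => P.Cl V B I N ∧ Q.Cl V B I N
  | .repl i P, V, B, I, N => P.Cl V B (insert i I) N
  | .new a l P, V, B, I, N => l.Cl V B I N ∧ P.Cl V (insert a B) I N
  | .out M M' P, V, B, I, N => M.Cl V B N ∧ M'.Cl V B N ∧ P.Cl V B I N
  | .inp M x P, V, B, I, N => M.Cl V B N ∧ P.Cl (insert x V) B I N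
  | .letd x _ Ms P Q, V, B, I, N =>
      (∀ k, (Ms k).Cl V B N) ∧ P.Cl (insert x V) B I N ∧ Q.Cl V B I N
  | .cond M M' P Q, V, B, I, N => M.Cl V B N ∧ M'.Cl V B N ∧ P.Cl V B I N ∧ Q.Cl V B I N
  | .event M P, V, B, I, N => M.Cl V B N ∧ P.Cl V B I N

theorem Term.cl_con {V : Set Var} {B N : Set Name} {f : S.Con} {ts : Fin (S.arity f) → Term S} :
    (Term.con f ts).Cl V B N ↔ ∀ k, (ts k).Cl V B N := by
  simp only [Term.Cl, Term.fv, Term.fbn, Term.fn, Set.iUnion_subset_iff, forall_and]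

theorem Term.Cl.mono {V V' : Set Var} {B B' N N' : Set Name} {M : Term S} (h : M.Cl V B N)
    (hV : V ⊆ V') (hB : B ⊆ B') (hN : N ⊆ N') : M.Cl V' B' N' :=
  ⟨h.1.trans hV, h.2.1.trans hB, h.2.2.trans hN⟩

theorem Label.Cl.mono {V : Set Var} {B N N' : Set Name} {I : Set SVar} {l : Label S}
    (h : l.Cl V B I N) (hN : N ⊆ N') : l.Cl V B I N' := by
  cases l with
  | honest a ts ss => exact ⟨fun M hM => (h.1 M hM).mono subset_rfl subset_rfl hN, h.2⟩
  | adv a ss => exact h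

theorem Proc.Cl.mono {P : IProc S} {V : Set Var} {B N N' : Set Name} {I : Set SVar}
    (h : P.Cl V B I N) (hN : N ⊆ N') : P.Cl V B I N' := by
  have ht : ∀ {V : Set Var} {B : Set Name} {M : Term S}, M.Cl V B N → M.Cl V B N' :=
    fun h => h.mono subset_rfl subset_rfl hN
  induction P generalizing V B I with
  | nil => trivial
  | par P Q ihP ihQ => exact ⟨ihP h.1, ihQ h.2⟩
  | repl i P ih => exact ih (B := B) h
  | new a l P ih => exact ⟨h.1.mono hN, ih h.2⟩
  | out M M' P ih => exact ⟨ht h.1, ht h.2.1, ih h.2.2⟩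
  | inp M x P ih => exact ⟨ht h.1, ih h.2⟩
  | letd x g Ms P Q ihP ihQ => exact ⟨fun k => ht (h.1 k), ihP h.2.1, ihQ h.2.2⟩
  | cond M M' P Q ihP ihQ => exact ⟨ht h.1, ht h.2.1, ihP h.2.2.1, ihQ h.2.2.2⟩
  | event M P ih => exact ⟨ht h.1, ih h.2⟩

theorem Term.Cl.bind {V V' : Set Var} {B B' N : Set Name} {v : Var → Term S} {b : Name → Term S}
    {M : Term S} (h : M.Cl V B N) (hv : ∀ x ∈ V, (v x).Cl V' B' N)
    (hb : ∀ a ∈ B, (b a).Cl V' B' N) : (M.bind v b).Cl V' B' N := by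
  induction M with
  | var x => exact hv x (h.1 rfl)
  | bname a => exact hb a (h.2.1 rfl)
  | name a => exact ⟨Set.empty_subset _, Set.empty_subset _, h.2.2⟩
  | con f ts ih => exact Term.cl_con.2 fun k => ih k (Term.cl_con.1 h k)

theorem sess_cl_bind {I I' : Set SVar} {s : SVar → Sess} {ss : List Sess}
    (h : ∀ i, Sess.var i ∈ ss → i ∈ I) (hs : ∀ i ∈ I, ∀ j, s i = .var j → j ∈ I') (j : SVar)
    (hj : Sess.var j ∈ ss.map (Sess.bind s)) : j ∈ I' := by
  obtain ⟨u, hu, he⟩ := List.mem_map.1 hj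
  cases u with
  | var i => exact hs i (h i hu) j he
  | const l => simp [Sess.bind] at he

theorem Label.Cl.bind {V V' : Set Var} {B B' N : Set Name} {I I' : Set SVar} {v : Var → Term S}
    {b : Name → Term S} {s : SVar → Sess} {l : Label S} (h : l.Cl V B I N)
    (hv : ∀ x ∈ V, (v x).Cl V' B' N) (hb : ∀ a ∈ B, (b a).Cl V' B' N)
    (hs : ∀ i ∈ I, ∀ j, s i = .var j → j ∈ I') : (l.bind v b s).Cl V' B' I' N := by
  cases l with
  | honest a ts ss =>
    refine ⟨fun M hM => ?_, sess_cl_bind h.2 hs⟩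
    obtain ⟨M', hM', rfl⟩ := List.mem_map.1 hM
    exact (h.1 M' hM').bind hv hb
  | adv a ss => exact sess_cl_bind h hs

theorem Proc.Cl.bind {V V' : Set Var} {B B' N : Set Name} {I I' : Set SVar} {v : Var → Term S}
    {b : Name → Term S} {s : SVar → Sess} {P : IProc S} (h : P.Cl V B I N)
    (hv : ∀ x ∈ V, (v x).Cl V' B' N) (hb : ∀ a ∈ B, (b a).Cl V' B' N)
    (hs : ∀ i ∈ I, ∀ j, s i = .var j → j ∈ I') : (P.bind v b s).Cl V' B' I' N := by
  have hv' : ∀ {V V' : Set Var} {B' : Set Name} {v : Var → Term S} (x : Var),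
      (∀ x ∈ V, (v x).Cl V' B' N) →
      ∀ y ∈ insert x V, (Function.update v x (.var x) y).Cl (insert x V') B' N := by
    intro V V' B' v x hv y hy
    by_cases hyx : y = x
    · subst hyx
      rw [Function.update_self]
      exact ⟨by simp [Term.fv], Set.empty_subset _, Set.empty_subset _⟩
    · rw [Function.update_of_ne hyx]
      exact (hv y (hy.resolve_left hyx)).mono (Set.subset_insert _ _) subset_rfl subset_rfl
  induction P generalizing V V' B B' I I' v b s with
  | nil => trivial
  | par P Q ihP ihQ => exact ⟨ihP h.1 hv hb hs, ihQ h.2 hv hb hs⟩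
  | repl i P ih =>
    refine ih (B := B) h hv hb fun k hk j hj => ?_
    by_cases hki : k = i
    · subst hki
      rw [Function.update_self] at hj
      exact Or.inl (Sess.var.inj hj).symm
    · rw [Function.update_of_ne hki] at hj
      exact Or.inr (hs k (hk.resolve_left hki) j hj)
  | new a l P ih =>
    refine ⟨h.1.bind hv hb hs, ih h.2 (fun x hx => (hv x hx).mono subset_rfl
      (Set.subset_insert _ _) subset_rfl) (fun c hc => ?_) hs⟩
    by_cases hca : c = a
    · subst hca
      rw [Function.update_self]
      exact ⟨Set.empty_subset _, by simp [Term.fbn], Set.empty_subset _⟩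
    · rw [Function.update_of_ne hca]
      exact (hb c (hc.resolve_left hca)).mono subset_rfl (Set.subset_insert _ _) subset_rfl
  | out M M' P ih => exact ⟨h.1.bind hv hb, h.2.1.bind hv hb, ih h.2.2 hv hb hs⟩
  | inp M x P ih =>
    exact ⟨h.1.bind hv hb, ih h.2 (hv' x hv)
      (fun a ha => (hb a ha).mono (Set.subset_insert _ _) subset_rfl subset_rfl) hs⟩
  | letd x g Ms P Q ihP ihQ =>
    exact ⟨fun k => (h.1 k).bind hv hb, ihP h.2.1 (hv' x hv)
      (fun a ha => (hb a ha).mono (Set.subset_insert _ _) subset_rfl subset_rfl) hs,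
      ihQ h.2.2 hv hb hs⟩
  | cond M M' P Q ihP ihQ =>
    exact ⟨h.1.bind hv hb, h.2.1.bind hv hb, ihP h.2.2.1 hv hb hs, ihQ h.2.2.2 hv hb hs⟩
  | event M P ih => exact ⟨h.1.bind hv hb, ih h.2 hv hb hs⟩

/-! ### Instrumented processes are closed -/

theorem fn_instrAux (lab : Name → List Var → List SVar → Label S) (P : PlainProc S)
    (t : List Var) (s : List SVar) (k : ℕ) : (instrAux lab P t s k).1.fn = P.fn := by
  induction P generalizing t s k with
  | nil => rfl
  | par P Q ihP ihQ => simp [instrAux, Proc.fn, ihP, ihQ]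
  | repl i P ih => simp [instrAux, Proc.fn, ih]
  | new a l P ih => simp [instrAux, Proc.fn, ih]
  | out M N P ih => simp [instrAux, Proc.fn, ih]
  | inp M x P ih => simp [instrAux, Proc.fn, ih]
  | letd x g Ms P Q ihP ihQ => simp [instrAux, Proc.fn, ihP, ihQ]
  | cond M N P Q ihP ihQ => simp [instrAux, Proc.fn, ihP, ihQ]
  | event M P ih => simp [instrAux, Proc.fn, ih]

theorem cl_instrAux {lab : Name → List Var → List SVar → Label S}
    (hlab : ∀ a t s (V : Set Var) (B : Set Name) (I : Set SVar) (N : Set Name),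
      (∀ x ∈ t, x ∈ V) → (∀ i ∈ s, i ∈ I) → (lab a t s).Cl V B I N)
    (P : PlainProc S) (t : List Var) (s : List SVar) (k : ℕ) (V : Set Var) (B : Set Name)
    (I : Set SVar) (N : Set Name) (hv : P.fv ⊆ V) (hb : P.fbn ⊆ B) (hn : P.fn ⊆ N)
    (ht : ∀ x ∈ t, x ∈ V) (hs : ∀ i ∈ s, i ∈ I) : (instrAux lab P t s k).1.Cl V B I N := by
  have hsub : ∀ {x : Var} {A V : Set Var}, A \ {x} ⊆ V → A ⊆ insert x V := by
    intro x A V h y hy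
    by_cases hyx : y = x
    · exact Or.inl hyx
    · exact Or.inr (h ⟨hy, hyx⟩)
  have htx : ∀ {x : Var} {t : List Var} {V : Set Var}, (∀ x ∈ t, x ∈ V) →
      ∀ y ∈ t ++ [x], y ∈ insert x V := by
    intro x t V h y hy
    obtain hy | hy := List.mem_append.1 hy
    · exact Or.inr (h y hy)
    · exact Or.inl (List.mem_singleton.1 hy)
  induction P generalizing t s k V B I with
  | nil => trivial
  | par P Q ihP ihQ =>
    simp only [Proc.fv, Proc.fbn, Proc.fn, Set.union_subset_iff] at hv hb hn
    exact ⟨ihP _ _ _ _ _ _ hv.1 hb.1 hn.1 ht hs, ihQ _ _ _ _ _ _ hv.2 hb.2 hn.2 ht hs⟩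
  | repl i P ih => exact ih _ _ _ V B (insert k I) hv hb hn ht (htx hs)
  | new a l P ih =>
    exact ⟨hlab a t s _ _ _ _ ht hs, ih _ _ _ _ _ _ hv (hsub hb) hn ht hs⟩
  | out M M' P ih =>
    simp only [Proc.fv, Proc.fbn, Proc.fn, Set.union_subset_iff] at hv hb hn
    exact ⟨⟨hv.1.1, hb.1.1, hn.1.1⟩, ⟨hv.1.2, hb.1.2, hn.1.2⟩, ih _ _ _ _ _ _ hv.2 hb.2 hn.2 ht hs⟩
  | inp M x P ih =>
    simp only [Proc.fv, Proc.fbn, Proc.fn, Set.union_subset_iff] at hv hb hn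
    exact ⟨⟨hv.1, hb.1, hn.1⟩, ih _ _ _ _ _ _ (hsub hv.2) hb.2 hn.2 (htx ht) hs⟩
  | letd x g Ms P Q ihP ihQ =>
    simp only [Proc.fv, Proc.fbn, Proc.fn, Set.union_subset_iff, Set.iUnion_subset_iff]
      at hv hb hn
    refine ⟨fun k => ⟨hv.1.1 k, hb.1.1 k, hn.1.1 k⟩,
      ihP _ _ _ _ _ _ (hsub hv.1.2) hb.1.2 hn.1.2 ?_ hs, ihQ _ _ _ _ _ _ hv.2 hb.2 hn.2 ht hs⟩
    split_ifs
    · exact htx ht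
    · exact fun y hy => Or.inr (ht y hy)
  | cond M M' P Q ihP ihQ =>
    simp only [Proc.fv, Proc.fbn, Proc.fn, Set.union_subset_iff] at hv hb hn
    exact ⟨⟨hv.1.1.1, hb.1.1.1, hn.1.1.1⟩, ⟨hv.1.1.2, hb.1.1.2, hn.1.1.2⟩,
      ihP _ _ _ _ _ _ hv.1.2 hb.1.2 hn.1.2 ht hs, ihQ _ _ _ _ _ _ hv.2 hb.2 hn.2 ht hs⟩
  | event M P ih =>
    simp only [Proc.fv, Proc.fbn, Proc.fn, Set.union_subset_iff] at hv hb hn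
    exact ⟨⟨hv.1, hb.1, hn.1⟩, ih _ _ _ _ _ _ hv.2 hb.2 hn.2 ht hs⟩

theorem cl_instr {P : PlainProc S} (hP : P.Closed) {N : Set Name} (hN : (instr P).fn ⊆ N) :
    (instr P).Cl ∅ ∅ ∅ N := by
  rw [instr, fn_instrAux] at hN
  refine cl_instrAux ?_ P _ _ _ _ _ _ _ hP.1.subset hP.2.subset hN (by simp) (by simp)
  intro a t s V B I N ht hs
  refine ⟨fun M hM => ?_, fun i hi => hs i (by simpa using hi)⟩
  obtain ⟨x, hx, rfl⟩ := List.mem_map.1 hM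
  exact ⟨by simpa [Term.fv] using ht x hx, Set.empty_subset _, Set.empty_subset _⟩

theorem cl_instrAdv {P : PlainProc S} (hP : P.Closed) {N : Set Name} (hN : P.fn ⊆ N) :
    (instrAdv P).Cl ∅ ∅ ∅ N := by
  refine cl_instrAux ?_ P _ _ _ _ _ _ _ hP.1.subset hP.2.subset hN (by simp) (by simp)
  exact fun a t s V B I N _ hs i hi => hs i (by simpa using hi)

/-! ### Typing under a change of environment and under substitution -/

/-- The environments agree on the identifiers of the given sets. -/
structure Env.AgreeOn (V : Set Var) (B : Set Name) (I : Set SVar) (N : Set Name)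
    (ρ ρ' : Env S) : Prop where
  var : ∀ x ∈ V, ρ.var x = ρ'.var x
  bnm : ∀ a ∈ B, ρ.bnm a = ρ'.bnm a
  sess : ∀ i ∈ I, ρ.sess i = ρ'.sess i
  nm : ∀ a ∈ N, ρ.nm a = ρ'.nm a

section

variable {V : Set Var} {B N : Set Name} {I : Set SVar} {ρ ρ' : Env S}

theorem Env.AgreeOn.setVar (h : Env.AgreeOn V B I N ρ ρ') (x : Var) (p : Pat S) :
    Env.AgreeOn (insert x V) B I N (ρ.setVar x p) (ρ'.setVar x p) where
  var y hy := by
    by_cases hyx : y = x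
    · simp [Env.setVar, hyx]
    · simpa [Env.setVar, hyx] using h.var y (hy.resolve_left hyx)
  bnm := h.bnm
  sess := h.sess
  nm := h.nm

theorem Env.AgreeOn.setBnm (h : Env.AgreeOn V B I N ρ ρ') (a : Name) (p : Pat S) :
    Env.AgreeOn V (insert a B) I N (ρ.setBnm a p) (ρ'.setBnm a p) where
  var := h.var
  bnm y hy := by
    by_cases hya : y = a
    · simp [Env.setBnm, hya]
    · simpa [Env.setBnm, hya] using h.bnm y (hy.resolve_left hya)
  sess := h.sess
  nm := h.nm

theorem Env.AgreeOn.setSess (h : Env.AgreeOn V B I N ρ ρ') (i : SVar) (u : Sess) :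
    Env.AgreeOn V B (insert i I) N (ρ.setSess i u) (ρ'.setSess i u) where
  var := h.var
  bnm := h.bnm
  sess y hy := by
    by_cases hyi : y = i
    · simp [Env.setSess, hyi]
    · simpa [Env.setSess, hyi] using h.sess y (hy.resolve_left hyi)
  nm := h.nm

theorem Env.AgreeOn.eval {M : Term S} (h : Env.AgreeOn V B I N ρ ρ') (hM : M.Cl V B N) :
    M.eval ρ = M.eval ρ' := by
  induction M with
  | var x => exact h.var x (hM.1 rfl)
  | bname a => exact h.bnm a (hM.2.1 rfl)
  | name a => exact h.nm a (hM.2.2 rfl)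
  | con f ts ih =>
    simp only [Term.eval]
    congr 1
    funext k
    exact ih k (Term.cl_con.1 hM k)

theorem Env.AgreeOn.map_sess (h : Env.AgreeOn V B I N ρ ρ') {ss : List Sess}
    (hss : ∀ i, Sess.var i ∈ ss → i ∈ I) :
    ss.map (Sess.bind ρ.sess) = ss.map (Sess.bind ρ'.sess) := by
  refine List.map_congr_left fun u hu => ?_
  cases u with
  | var i => exact h.sess i (hss i hu)
  | const l => rfl

theorem Env.AgreeOn.label {l : Label S} (h : Env.AgreeOn V B I N ρ ρ') (hl : l.Cl V B I N) :
    l.eval ρ = l.eval ρ' := by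
  cases l with
  | honest a ts ss =>
    simp only [Label.eval, h.map_sess hl.2]
    congr 1
    funext k
    exact h.eval (hl.1 _ (List.get_mem ts k))
  | adv a ss => simp only [Label.eval, h.map_sess hl]

theorem WT.congr {D : Set (PFact S)} {P : IProc S} (hP : P.Cl V B I N)
    (h : Env.AgreeOn V B I N ρ ρ') (hwt : WT D P ρ) : WT D P ρ' := by
  induction P generalizing V B I ρ ρ' with
  | nil => trivial
  | par P Q ihP ihQ => exact ⟨ihP hP.1 h hwt.1, ihQ hP.2 h hwt.2⟩
  | repl i P ih => exact fun u => ih (B := B) hP (h.setSess i u) (hwt u)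
  | new a l P ih =>
    refine ih hP.2 (h.setBnm a _) ?_
    rw [← h.label hP.1]
    exact hwt
  | out M M' P ih =>
    refine ⟨?_, ih hP.2.2 h hwt.2⟩
    rw [← h.eval hP.1, ← h.eval hP.2.1]
    exact hwt.1
  | inp M x P ih =>
    intro p hp
    rw [← h.eval hP.1] at hp
    exact ih hP.2 (h.setVar x p) (hwt p hp)
  | letd x g Ms P Q ihP ihQ =>
    refine ⟨fun r hr τ hτ => ?_, ihQ hP.2.2 h hwt.2⟩
    refine ihP hP.2.1 (h.setVar x _) (hwt.1 r hr τ fun k => ?_)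
    rw [h.eval (hP.1 k)]
    exact hτ k
  | cond M M' P Q ihP ihQ =>
    refine ⟨fun he => ihP hP.2.2.1 h (hwt.1 ?_), ihQ hP.2.2.2 h hwt.2⟩
    rwa [h.eval hP.1, h.eval hP.2.1]
  | event M P ih =>
    refine ⟨?_, fun hm => ih hP.2 h (hwt.2 ?_)⟩
    · rw [← h.eval hP.1]
      exact hwt.1
    · rwa [h.eval hP.1]

end

/-- The environment in which a process `P` has the meaning that `P.bind v b s` has in `ρ`. -/
def Env.comp (ρ : Env S) (v : Var → Term S) (b : Name → Term S) (s : SVar → Sess) : Env S where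
  var x := (v x).eval ρ
  bnm a := (b a).eval ρ
  nm := ρ.nm
  sess i := (s i).bind ρ.sess

theorem Term.eval_bind (M : Term S) (ρ : Env S) (v : Var → Term S) (b : Name → Term S)
    (s : SVar → Sess) : (M.bind v b).eval ρ = M.eval (ρ.comp v b s) := by
  induction M with
  | con f ts ih => simp only [Term.bind, Term.eval, ih]
  | _ => rfl

theorem Label.eval_bind (l : Label S) (ρ : Env S) (v : Var → Term S) (b : Name → Term S)
    (s : SVar → Sess) : (l.bind v b s).eval ρ = l.eval (ρ.comp v b s) := by
  have hs : ∀ ss : List Sess, (ss.map (Sess.bind s)).map (Sess.bind ρ.sess) =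
      ss.map (Sess.bind (ρ.comp v b s).sess) := by
    intro ss
    rw [List.map_map]
    exact List.map_congr_left fun u _ => Sess.bind_bind _ _ u
  cases l with
  | honest a ts ss =>
    have key : ∀ us : List (Term S), us = ts.map (Term.bind v b) →
        Pat.name (.nm a) us.length (fun k => (us.get k).eval ρ)
          ((ss.map (Sess.bind s)).map (Sess.bind ρ.sess)) =
        (Label.honest a ts ss).eval (ρ.comp v b s) := by
      rintro us rfl
      simp only [Label.eval, hs, Pat.name.injEq, List.length_map, and_true, true_and]
      refine (Fin.heq_fun_iff (List.length_map _)).2 fun k => ?_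
      simp [Term.eval_bind _ ρ v b s]
    exact key _ rfl
  | adv a ss => simp only [Label.bind, Label.eval, hs]

/-- Each identifier is either left alone or replaced with a closed term. -/
structure ClosedSubst (v : Var → Term S) (b : Name → Term S) (s : SVar → Sess) : Prop where
  var : ∀ x, v x = .var x ∨ (v x).Cl ∅ ∅ Set.univ
  bnm : ∀ a, b a = .bname a ∨ (b a).Cl ∅ ∅ Set.univ
  sess : ∀ i, s i = .var i ∨ ∃ l, s i = .const l

theorem ClosedSubst.updateVar {v : Var → Term S} {b : Name → Term S} {s : SVar → Sess}
    (h : ClosedSubst v b s) (x : Var) : ClosedSubst (Function.update v x (.var x)) b s where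
  var y := by
    by_cases hyx : y = x
    · subst hyx; simp
    · simpa [hyx] using h.var y
  bnm := h.bnm
  sess := h.sess

theorem ClosedSubst.updateBnm {v : Var → Term S} {b : Name → Term S} {s : SVar → Sess}
    (h : ClosedSubst v b s) (a : Name) : ClosedSubst v (Function.update b a (.bname a)) s where
  var := h.var
  bnm y := by
    by_cases hya : y = a
    · subst hya; simp
    · simpa [hya] using h.bnm y
  sess := h.sess

theorem ClosedSubst.updateSess {v : Var → Term S} {b : Name → Term S} {s : SVar → Sess}
    (h : ClosedSubst v b s) (i : SVar) : ClosedSubst v b (Function.update s i (.var i)) where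
  var := h.var
  bnm := h.bnm
  sess y := by
    by_cases hyi : y = i
    · subst hyi; simp
    · simpa [hyi] using h.sess y

theorem Term.Cl.eval_eq {M : Term S} (h : M.Cl ∅ ∅ Set.univ) {ρ ρ' : Env S}
    (hρ : ρ.nm = ρ'.nm) : M.eval ρ = M.eval ρ' :=
  Env.AgreeOn.eval (I := ∅) ⟨by simp, by simp, by simp, by simp [hρ]⟩ h

theorem Env.comp_setVar {v : Var → Term S} {b : Name → Term S} {s : SVar → Sess}
    (h : ClosedSubst v b s) (ρ : Env S) (x : Var) (p : Pat S) :
    (ρ.setVar x p).comp (Function.update v x (.var x)) b s = (ρ.comp v b s).setVar x p := by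
  simp only [Env.comp, Env.setVar, Env.mk.injEq, and_true]
  refine ⟨funext fun y => ?_, funext fun a => ?_⟩
  · by_cases hyx : y = x
    · subst hyx; simp [Term.eval]
    · rw [Function.update_of_ne hyx, Function.update_of_ne hyx]
      obtain hv | hv := h.var y
      · simp [hv, Term.eval, hyx]
      · exact hv.eval_eq rfl
  · obtain hb | hb := h.bnm a
    · simp [hb, Term.eval]
    · exact hb.eval_eq rfl

theorem Env.comp_setBnm {v : Var → Term S} {b : Name → Term S} {s : SVar → Sess}
    (h : ClosedSubst v b s) (ρ : Env S) (a : Name) (p : Pat S) :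
    (ρ.setBnm a p).comp v (Function.update b a (.bname a)) s = (ρ.comp v b s).setBnm a p := by
  simp only [Env.comp, Env.setBnm, Env.mk.injEq, and_true]
  refine ⟨funext fun y => ?_, funext fun y => ?_⟩
  · obtain hv | hv := h.var y
    · simp [hv, Term.eval]
    · exact hv.eval_eq rfl
  · by_cases hya : y = a
    · subst hya; simp [Term.eval]
    · rw [Function.update_of_ne hya, Function.update_of_ne hya]
      obtain hv | hv := h.bnm y
      · simp [hv, Term.eval, hya]
      · exact hv.eval_eq rfl

theorem Env.comp_setSess {v : Var → Term S} {b : Name → Term S} {s : SVar → Sess}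
    (h : ClosedSubst v b s) (ρ : Env S) (i : SVar) (u : Sess) :
    (ρ.setSess i u).comp v b (Function.update s i (.var i)) = (ρ.comp v b s).setSess i u := by
  simp only [Env.comp, Env.setSess, Env.mk.injEq, true_and]
  refine ⟨funext fun y => ?_, funext fun y => ?_, funext fun y => ?_⟩
  · obtain hv | hv := h.var y
    · simp [hv, Term.eval]
    · exact hv.eval_eq rfl
  · obtain hv | hv := h.bnm y
    · simp [hv, Term.eval]
    · exact hv.eval_eq rfl
  · by_cases hyi : y = i
    · subst hyi; simp [Sess.bind]
    · rw [Function.update_of_ne hyi, Function.update_of_ne hyi]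
      obtain hv | ⟨l, hv⟩ := h.sess y
      · simp [hv, Sess.bind, hyi]
      · simp [hv, Sess.bind]

theorem WT.bind {D : Set (PFact S)} {P : IProc S} {ρ : Env S} {v : Var → Term S}
    {b : Name → Term S} {s : SVar → Sess} (h : ClosedSubst v b s)
    (hwt : WT D P (ρ.comp v b s)) : WT D (P.bind v b s) ρ := by
  induction P generalizing ρ v b s with
  | nil => trivial
  | par P Q ihP ihQ => exact ⟨ihP h hwt.1, ihQ h hwt.2⟩
  | repl i P ih =>
    refine fun u => ih (h.updateSess i) ?_
    rw [Env.comp_setSess h]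
    exact hwt u
  | new a l P ih =>
    refine ih (h.updateBnm a) ?_
    rw [Env.comp_setBnm h, Label.eval_bind]
    exact hwt
  | out M M' P ih =>
    refine ⟨?_, ih h hwt.2⟩
    rw [Term.eval_bind _ _ _ _ s, Term.eval_bind _ _ _ _ s]
    exact hwt.1
  | inp M x P ih =>
    intro p hp
    rw [Term.eval_bind _ _ _ _ s] at hp
    refine ih (h.updateVar x) ?_
    rw [Env.comp_setVar h]
    exact hwt p hp
  | letd x g Ms P Q ihP ihQ =>
    refine ⟨fun r hr τ hτ => ihP (h.updateVar x) ?_, ihQ h hwt.2⟩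
    rw [Env.comp_setVar h]
    refine hwt.1 r hr τ fun k => ?_
    rw [← Term.eval_bind]
    exact hτ k
  | cond M M' P Q ihP ihQ =>
    refine ⟨fun he => ihP h (hwt.1 ?_), ihQ h hwt.2⟩
    rwa [Term.eval_bind _ _ _ _ s, Term.eval_bind _ _ _ _ s] at he
  | event M P ih =>
    refine ⟨?_, fun hm => ih h (hwt.2 ?_)⟩
    · rw [Term.eval_bind _ _ _ _ s]
      exact hwt.1
    · rwa [Term.eval_bind _ _ _ _ s] at hm

/-! ### Subject reduction along a trace -/

theorem Tm.toTerm_eval (t : Tm S.arity) (σ : Var → Term S) (ρ : Env S) :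
    (t.toTerm σ).eval ρ = t.toPat (fun y => (σ y).eval ρ) := by
  induction t with
  | var x => rfl
  | con f ts ih => simp only [Tm.toTerm, Term.eval, Tm.toPat, ih]

theorem Tm.toTerm_cl {V : Set Var} {B N : Set Name} {t : Tm S.arity} {σ : Var → Term S} :
    (t.toTerm σ).Cl V B N ↔ ∀ y ∈ t.vars, (σ y).Cl V B N := by
  induction t with
  | var x => simp [Tm.toTerm, Tm.vars]
  | con f ts ih =>
    simp only [Tm.toTerm, Term.cl_con, ih, Tm.vars, Set.mem_iUnion, forall_exists_index]
    exact forall_comm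

theorem Step.env {c c' : Config S} (h : Step c c') :
    c.env.dom ⊆ c'.env.dom ∧ ∀ a ∈ c.env.dom, c'.env.val a = c.env.val a := by
  cases h with
  | res L E Ps a l P a' ha' =>
    refine ⟨Set.subset_insert _ _, fun b hb => Function.update_of_ne ?_ _ _⟩
    rintro rfl
    exact ha' hb
  | _ => exact ⟨subset_rfl, fun _ _ => rfl⟩

theorem Trace.env (T : Trace S) {j k : ℕ} (hjk : j ≤ k) (hk : k ≤ T.len) :
    (T.conf j).env.dom ⊆ (T.conf k).env.dom ∧
      ∀ a ∈ (T.conf j).env.dom, (T.conf k).env.val a = (T.conf j).env.val a := by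
  induction k, hjk using Nat.le_induction with
  | base => exact ⟨subset_rfl, fun _ _ => rfl⟩
  | succ k hjk ih =>
    obtain ⟨h₁, h₂⟩ := ih (by omega)
    obtain ⟨h₃, h₄⟩ := (T.step k (by omega)).env
    exact ⟨h₁.trans h₃, fun a ha => (h₄ a (h₁ ha)).trans (h₂ a ha)⟩

/-- All processes of the configuration are closed, and well-typed in the environment `E`. -/
def Config.WellTyped (D : Set (PFact S)) (E : NameEnv S) (c : Config S) : Prop :=
  ∀ P ∈ c.procs, WT D P E.toEnv ∧ P.Cl ∅ ∅ ∅ c.env.dom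

theorem closedSubst_var {M : Term S} {N : Set Name} (hM : M.Cl ∅ ∅ N) (x : Var) :
    ClosedSubst (Function.update .var x M) .bname .var where
  var y := by
    by_cases hyx : y = x
    · subst hyx
      rw [Function.update_self]
      exact Or.inr (hM.mono subset_rfl subset_rfl (Set.subset_univ _))
    · exact Or.inl (Function.update_of_ne hyx _ _)
  bnm _ := Or.inl rfl
  sess _ := Or.inl rfl

theorem WT.substVar {D : Set (PFact S)} {P : IProc S} {E : NameEnv S} {x : Var} {M : Term S}
    {N : Set Name} (hM : M.Cl ∅ ∅ N) (h : WT D P (E.toEnv.setVar x (M.eval E.toEnv))) :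
    WT D (P.substVar x M) E.toEnv := by
  refine WT.bind (closedSubst_var hM x) ?_
  convert h using 1
  simp only [Env.comp, Env.setVar, Env.mk.injEq]
  refine ⟨funext fun y => ?_, rfl, trivial, rfl⟩
  by_cases hyx : y = x
  · subst hyx; simp
  · simp [hyx, Term.eval]

theorem Proc.Cl.substVar {P : IProc S} {x : Var} {M : Term S} {N : Set Name}
    (hM : M.Cl ∅ ∅ N) (h : P.Cl (insert x ∅) ∅ ∅ N) : (P.substVar x M).Cl ∅ ∅ ∅ N := by
  refine h.bind (fun y hy => ?_) (by simp) (by simp)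
  obtain rfl : y = x := by simpa using hy
  rwa [Function.update_self]

/-- Reduction preserves typing in the final environment `E` of a trace. -/
theorem Config.WellTyped.step {D : Set (PFact S)} {E : NameEnv S} {c c' : Config S}
    (h : c.WellTyped D E) (hs : Step c c')
    (hE : ∀ a ∈ c'.env.dom, E.val a = c'.env.val a)
    (hev : ∀ (L : Set SId) (E₁ : NameEnv S) (Ps : Multiset (IProc S)) (M : Term S) (P : IProc S),
      c = ⟨L, E₁, .event M P ::ₘ Ps⟩ → c' = ⟨L, E₁, P ::ₘ Ps⟩ → .mevent (M.eval E.toEnv) ∈ D) :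
    c'.WellTyped D E := by
  -- A process that takes part in the reduction gives one new process; the others are unchanged.
  have hcons : ∀ {L E₁ P Ps} {A : Multiset (IProc S)},
      (⟨L, E₁, A⟩ : Config S).WellTyped D E → WT D P E.toEnv ∧ P.Cl ∅ ∅ ∅ E₁.dom →
      (∀ Q ∈ Ps, Q ∈ A) → (⟨L, E₁, P ::ₘ Ps⟩ : Config S).WellTyped D E := by
    intro L E₁ P Ps A hA hP hPs Q hQ
    obtain rfl | hQ := Multiset.mem_cons.1 hQ
    · exact hP
    · exact hA Q (hPs Q hQ)
  cases hs with
  | nil L E₁ Ps => exact fun P hP => h P (Multiset.mem_cons_of_mem hP)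
  | repl L E₁ Ps i P l hl =>
    obtain ⟨hwt, hcl⟩ := h _ (Multiset.mem_cons_self _ _)
    refine hcons (L := L) h ⟨?_, ?_⟩ (fun Q hQ => hQ)
    · refine WT.bind ⟨fun _ => Or.inl rfl, fun _ => Or.inl rfl, fun j => ?_⟩ ?_
      · by_cases hji : j = i
        · subst hji
          exact Or.inr ⟨l, Function.update_self _ _ _⟩
        · exact Or.inl (Function.update_of_ne hji _ _)
      · convert hwt (.const l) using 1
        simp only [Env.comp, Env.setSess, Env.mk.injEq]
        refine ⟨rfl, rfl, trivial, funext fun j => ?_⟩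
        by_cases hji : j = i
        · subst hji; simp [Sess.bind]
        · simp [hji, Sess.bind]
    · refine Proc.Cl.bind (show P.Cl ∅ ∅ (insert i ∅) E₁.dom from hcl) (by simp) (by simp) ?_
      intro j hj k hk
      obtain rfl : j = i := by simpa using hj
      simp at hk
  | par L E₁ Ps P Q =>
    obtain ⟨hwt, hcl⟩ := h _ (Multiset.mem_cons_self _ _)
    have h₁ := hcons (P := Q) (Ps := Ps) h ⟨hwt.2, hcl.2⟩ fun R hR => Multiset.mem_cons_of_mem hR
    exact hcons h₁ ⟨hwt.1, hcl.1⟩ fun R hR => hR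
  | res L E₁ Ps a l P a' ha' =>
    obtain ⟨hwt, hcl⟩ := h _ (Multiset.mem_cons_self _ _)
    have hsub : E₁.dom ⊆ (E₁.extend a' (l.eval E₁.toEnv)).dom := Set.subset_insert _ _
    have hval : E.val a' = l.eval E.toEnv := by
      rw [hE a' (Set.mem_insert _ _)]
      simp only [NameEnv.extend, Function.update_self]
      refine Env.AgreeOn.label ⟨by simp, by simp, by simp, fun b hb => ?_⟩ hcl.1
      refine Eq.trans ?_ (hE b (hsub hb)).symm
      refine (Function.update_of_ne ?_ _ _).symm
      rintro rfl
      exact ha' hb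
    refine hcons (A := Ps)
      (fun Q hQ => (h Q (Multiset.mem_cons_of_mem hQ)).imp id fun h => h.mono hsub)
      ⟨?_, ?_⟩ (fun Q hQ => hQ)
    · refine WT.bind ⟨fun _ => Or.inl rfl, fun b => ?_, fun _ => Or.inl rfl⟩ ?_
      · by_cases hba : b = a
        · subst hba
          rw [Function.update_self]
          exact Or.inr ⟨by simp [Term.fv], by simp [Term.fbn], Set.subset_univ _⟩
        · exact Or.inl (Function.update_of_ne hba _ _)
      · convert show WT D P (E.toEnv.setBnm a (l.eval E.toEnv)) from hwt using 1
        simp only [Env.comp, Env.setBnm, Env.mk.injEq]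
        refine ⟨rfl, funext fun b => ?_, trivial, rfl⟩
        by_cases hba : b = a
        · subst hba
          simp only [Function.update_self]
          exact hval
        · simp [hba, Term.eval]
    · refine (Proc.Cl.mono hcl.2 hsub).bind (by simp) (fun b hb => ?_) (by simp)
      obtain rfl : b = a := by simpa using hb
      rw [Function.update_self]
      refine ⟨by simp [Term.fv], by simp [Term.fbn], ?_⟩
      simp [Term.fn, NameEnv.extend]
  | io L E₁ Ps N M x Q P =>
    obtain ⟨hwt, hcl⟩ := h _ (Multiset.mem_cons_self _ _)
    obtain ⟨hwt', hcl'⟩ := h (.inp N x P) (by simp)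
    have h₁ := hcons (P := P.substVar x M) (Ps := Ps) h
      ⟨WT.substVar hcl.2.1 (hwt' _ hwt.1), Proc.Cl.substVar hcl.2.1 hcl'.2⟩
      fun R hR => by simp [hR]
    exact hcons h₁ ⟨hwt.2, hcl.2.2⟩ fun R hR => hR
  | destr1 L E₁ Ps x g Ms P Q M' hd =>
    obtain ⟨hwt, hcl⟩ := h _ (Multiset.mem_cons_self _ _)
    obtain ⟨r, hr, σ, hMs, rfl⟩ := hd
    have hM' : (r.rhs.toTerm σ).Cl ∅ ∅ E₁.dom := by
      refine Tm.toTerm_cl.2 fun y hy => ?_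
      obtain ⟨k, hk⟩ := Set.mem_iUnion.1 (r.vars_rhs hy)
      have := hcl.1 k
      rw [hMs k] at this
      exact Tm.toTerm_cl.1 this y hk
    refine hcons h ⟨WT.substVar hM' ?_, Proc.Cl.substVar hM' hcl.2.1⟩
      fun R hR => Multiset.mem_cons_of_mem hR
    rw [Tm.toTerm_eval]
    refine hwt.1 r hr _ fun k => ?_
    rw [hMs k, Tm.toTerm_eval]
  | destr2 L E₁ Ps x g Ms P Q hd =>
    obtain ⟨hwt, hcl⟩ := h _ (Multiset.mem_cons_self _ _)
    exact hcons h ⟨hwt.2, hcl.2.2⟩ fun R hR => Multiset.mem_cons_of_mem hR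
  | cond1 L E₁ Ps M P Q =>
    obtain ⟨hwt, hcl⟩ := h _ (Multiset.mem_cons_self _ _)
    exact hcons h ⟨hwt.1 rfl, hcl.2.2.1⟩ fun R hR => Multiset.mem_cons_of_mem hR
  | cond2 L E₁ Ps M N P Q hne =>
    obtain ⟨hwt, hcl⟩ := h _ (Multiset.mem_cons_self _ _)
    exact hcons h ⟨hwt.2, hcl.2.2.2⟩ fun R hR => Multiset.mem_cons_of_mem hR
  | event L E₁ Ps M P =>
    obtain ⟨hwt, hcl⟩ := h _ (Multiset.mem_cons_self _ _)
    exact hcons h ⟨hwt.2 (hev L E₁ Ps M P rfl rfl), hcl.2⟩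
      fun R hR => Multiset.mem_cons_of_mem hR

/-- All facts satisfied by a trace that starts from well-typed processes are in `D`. -/
theorem Trace.mem_of_satisfies {T : Trace S} {D : Set (PFact S)} {Init : Finset Name}
    (hD : AdvClosed D Init) (hMe : ∀ p, T.Satisfies Init (.event p) → .mevent p ∈ D)
    (hInit : ∀ a ∈ Init, a ∈ (T.conf 0).env.dom ∧ (T.conf 0).env.val a = Pat.atom (.nm a))
    (h₀ : (T.conf 0).WellTyped D (T.conf T.len).env) {F : PFact S} (hF : T.Satisfies Init F) :
    F ∈ D := by
  have hwt : ∀ k ≤ T.len, (T.conf k).WellTyped D (T.conf T.len).env := by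
    intro k
    induction k with
    | zero => exact fun _ => h₀
    | succ k ih =>
      intro hk
      refine (ih (by omega)).step (T.step k (by omega)) (T.env hk le_rfl).2 ?_
      intro L E Ps M P hc hc'
      exact hMe _ ⟨.event M, ⟨k, by omega, L, E, Ps, P, hc, hc'⟩, rfl⟩
  have hcomm : ∀ M N, T.Comm M N →
      .message (M.eval (T.conf T.len).env.toEnv) (N.eval (T.conf T.len).env.toEnv) ∈ D := by
    rintro M N ⟨k, hk, L, E, Ps, x, Q, P, hc, -⟩
    exact (hwt k hk.le (.out M N Q) (by rw [hc]; simp)).1.1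
  obtain ⟨α, hα, rfl⟩ := hF
  cases α with
  | attacker M =>
    obtain ⟨c, hc, hcM⟩ := hα
    refine hD.listen _ _ (hcomm _ _ hcM) ?_
    obtain ⟨h₁, h₂⟩ := hInit c hc
    have : (T.conf T.len).env.val c = Pat.atom (.nm c) :=
      ((T.env (Nat.zero_le _) le_rfl).2 c h₁).trans h₂
    change .attacker ((T.conf T.len).env.val c) ∈ D
    rw [this]
    exact hD.init c hc
  | message M N => exact hcomm M N hα
  | event M =>
    obtain ⟨k, hk, L, E, Ps, P, hc, -⟩ := hα
    exact (hwt k hk.le (.event M P) (by rw [hc]; simp)).1.1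

/-! ### Facts satisfied by a trace are derivable -/

theorem Pat.atom_subst (a : NameSym) (θ : Subst S) :
    (Pat.atom a : Pat S).subst θ = Pat.atom a := by
  simp only [Pat.atom, Pat.subst, List.map_nil, Pat.name.injEq, heq_eq_eq, and_true, true_and]
  exact Subsingleton.elim _ _

/-- The facts satisfied by a trace of the protocol with an adversary belong to every set of facts
that is closed under the clauses of the protocol and contains the must-events of the trace. -/
theorem mem_of_closedUnder {Init : Finset Name} {P₀ Q : PlainProc S} (hP₀ : P₀.Closed)
    (hQ : IsAdversary Init Q) {T : Trace S} {S₀ : Set SId} {E₀ : NameEnv S}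
    (hT : T.conf 0 = ⟨S₀, E₀, {instr P₀, instrAdv Q}⟩)
    (hdom : (instr P₀).fn ∪ (Init : Set Name) ⊆ E₀.dom)
    (hE₀ : ∀ a ∈ E₀.dom, E₀.val a = Pat.atom (.nm a)) {R₀ : Set (Clause S)}
    (hR₀ : ProtocolClauses (instr P₀) Init R₀) {D : Set (PFact S)}
    (hD : ∀ C ∈ R₀, ClosedUnder D C) (hMe : ∀ p, T.Satisfies Init (.event p) → .mevent p ∈ D)
    {F : PFact S} (hF : T.Satisfies Init F) : F ∈ D := by
  obtain ⟨R, htr, rfl⟩ := hR₀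
  have hadv : AdvClosed D Init := advClosed_of_closedUnder fun C hC => hD C (Or.inr hC)
  have hval : ∀ a ∈ E₀.dom, (T.conf T.len).env.val a = Pat.atom (.nm a) := by
    intro a ha
    have := (T.env (Nat.zero_le _) le_rfl).2 a
    rw [hT] at this
    exact (this ha).trans (hE₀ a ha)
  have hdom' := Set.union_subset_iff.1 hdom
  have hclP := cl_instr hP₀ hdom'.1
  refine Trace.mem_of_satisfies hadv hMe ?_ ?_ hF
  · rw [hT]
    exact fun a ha => ⟨hdom'.2 ha, hE₀ a (hdom'.2 ha)⟩
  · rw [hT]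
    intro P hP
    simp only [Multiset.insert_eq_cons, Multiset.mem_cons, Multiset.mem_singleton] at hP
    obtain rfl | rfl := hP
    · refine ⟨?_, hclP⟩
      refine WT.congr hclP ⟨by simp, by simp, by simp, fun a ha => ?_⟩
        (htr.wt (fun C hC => hD C (Or.inl hC)) Subst.id (by simp))
      exact (Pat.atom_subst _ _).trans (hval a ha).symm
    · refine ⟨?_, cl_instrAdv hQ.1 (hQ.2.1.trans hdom'.2)⟩
      refine wt_instrAux_adv hadv Q hQ.2.2.1 hQ.2.2.2 _ (by simp [hQ.1.1]) (by simp [hQ.1.2]) ?_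
        _ _ _
      intro a ha
      change .attacker ((T.conf T.len).env.val a) ∈ D
      rw [hval a (hdom'.2 (hQ.2.1 ha))]
      exact hadv.init a (hQ.2.1 ha)

theorem hasDataClauses {P' : IProc S} {Init : Finset Name} {R₀ : Set (Clause S)}
    (h : ProtocolClauses P' Init R₀) : HasDataClauses R₀ := by
  obtain ⟨R, -, rfl⟩ := h
  refine ⟨fun f hf => Or.inr (.rf f (S.data_public hf)), fun f hf i => ?_⟩
  obtain ⟨g, hg, hn, r, x, hx, hrules, hlhs, hrhs⟩ := S.data_proj f hf i
  refine ⟨x, hx, Or.inr ?_⟩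
  have hcard : (Finset.univ : Finset (Fin (S.desArity g))).val.card = 1 := by simp [hn]
  have he : clauseRg r =
      ⟨{.attacker (.con f (fun k => .var (x k)))}, .attacker (.var (x i))⟩ := by
    simp only [clauseRg, hlhs, hrhs, Tm.toPat, Multiset.map_const', hcard,
      Multiset.replicate_one]
  exact he ▸ AttackerClause.rg g hg r (by simp [hrules])

theorem ProtocolClauses.concl_ne_mevent {P' : IProc S} {Init : Finset Name} {R₀ : Set (Clause S)}
    (h : ProtocolClauses P' Init R₀) : ∀ C ∈ R₀, ∀ p, C.concl ≠ .mevent p := by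
  obtain ⟨R, htr, rfl⟩ := h
  rintro C (hC | hC)
  · exact htr.concl_ne_mevent C hC
  · cases hC <;> simp [clauseRf, clauseRg]

end HornProtocol

open HornProtocol
theorem mainTheorem1 (S : Signature) (sf : SelFun S) (Fnot : Set (PFact S))
    (Init : Finset Name)
    (P₀ : PlainProc S) (hP₀ : P₀.Closed)
    (Q : PlainProc S) (hQ : IsAdversary Init Q)
    (T : Trace S) (S₀ : Set SId) (E₀ : NameEnv S)
    (hT : T.conf 0 = ⟨S₀, E₀, {instr P₀, instrAdv Q}⟩)
    (hdom : (instr P₀).fn ∪ (Init : Set Name) ⊆ E₀.dom)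
    (hE₀ : ∀ a ∈ E₀.dom, E₀.val a = Pat.atom (.nm a))
    (F F' : PFact S) (hF' : ∃ τ : Subst S, F' = F.subst τ)
    (hsat : T.Satisfies Init F')
    (out : Set (Clause S)) (hsolve : Solve sf Fnot (instr P₀) Init F out) :
    ∃ R ∈ out, ∃ σ : Subst S, F' = R.concl.subst σ ∧
      ∀ p : Pat S, PFact.mevent p ∈ R.hyp.map (PFact.subst σ) → T.Satisfies Init (.event p) := by
  obtain ⟨R₀, R₁, hR₀, hsat₁, hnot, hder⟩ := hsolve
  obtain ⟨τ, rfl⟩ := hF'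
  obtain ⟨𝓡, hS, rfl⟩ := hsat₁.exists_saturated
  have hD := hasDataClauses hR₀
  set Me : Set (Pat S) := {p | T.Satisfies Init (.event p)}
  have hcost := mem_of_closedUnder hP₀ hQ hT hdom hE₀ hR₀
    (D := {F | cost Me {C ∈ 𝓡 | sf.sel C = ∅} F ≠ ⊤})
    (fun C hC θ hθ => cost_ne_top_of_clause hS hD hnot hC (hR₀.concl_ne_mevent C hC) θ hθ)
    (fun p hp => cost_mevent hp) hsat
  obtain ⟨R, hR, σ, hc, hh⟩ := hder.exists_instance hS hD hnot τ hcost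
  exact ⟨R, hR, σ, hc.symm, fun p hp => mem_of_cost_mevent_ne_top (hh _ hp)⟩
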